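/- Let $3\le d<n$. A sign vector $\alpha\in\{0,\pm1\}^k$ represents the nonempty face $\{x\in[-1,1]^k : x_i=\alpha_i \text{ whenever } \alpha_i\neq 0\}$ of the $k$-cube; cubical complexes in the cube are given by the sets of sign vectors of their nonempty faces, ordered by inclusion of faces. *The cubical sphere.* For $i\ge d$ let $C_{d-1}(i)=\operatorname{conv}\{v_1,\dots,v_i\}$ with $v_j=(j,j^2,\dots,j^{d-1})$ be the cyclic polytope, and let $T_i$ be its pulling triangulation with respect to the last vertex $v_i$, that is, the simplicial complex of all simplices spanned by $v_i$ and the vertices of a proper face of $C_{d-1}(i)$ not containing $v_i$, together with their faces; it is viewed as a family of subsets of $\{1,\dots,i\}$. For a simplicial complex $\Delta$ on $\{1,\dots,k\}$ let $\mathrm{M}(\Delta)$ be the set of all $\alpha\in\{0,\pm1\}^k$ with $\{i:\alpha_i=0\}\in\Delta$. Let $S_{d+1}$ be the boundary complex of the $(d+1)$-cube, and for $d+1\le k<n$ let $$S_{k+1}=\bigl(\mathrm{M}(T_k)\times\{+1\}\bigr)\cup\bigl((\mathrm{M}(T_k)\cap C_k)\times\{0\}\bigr)\cup\bigl(C_k\times\{-1\}\bigr),$$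 where $C_k$ is the subcomplex of $S_k$ generated by the facets of $S_k$ that are not in $\mathrm{M}(T_k)$. Put $\mathrm{BBC}\bigl((T_i)_{i=d}^{n-1}\bigr)=S_n$. *The neighborly cubical polytope.* For $\varepsilon,K>0$ let $Q\subset\mathbb R^n$ be the deformed cube given by the inequalities $$\pm\varepsilon x_i+\sum_{k=1}^{n-d-1}a_{ik}x_k\le K^{i-1}\qquad(i=1,\dots,n),$$ where $a_{ik}=(-1)^i\binom{i-2}{k-1}$ for $k<i$ and $a_{ik}=0$ otherwise, and let $\mathrm{NCP}_{d+1}(n)\subset\mathbb R^{d+1}$ be the image of $Q$ under the projection to the last $d+1$ coordinates. For $\beta\in\{0,\pm1\}^n$ let $P_\beta$ be the image of the set of those points of $Q$ at which, for every $i$ with $\beta_i\ne0$, the inequality with index $i$ and sign $\beta_i$ is tight. Then for all sufficiently small $\varepsilon>0$, and for all $K$ that are sufficiently large (depending on $\varepsilon$), the following holds. 1. $\mathrm{NCP}_{d+1}(n)$ satisfies the Cubical Gale Evenness Condition that characterizes the Joswig–Ziegler neighborly cubical polytope: $\beta\mapsto P_\beta$ is a bijection from the set of the following sign vectors $\beta\in\{0,\pm1\}^n$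 with exactly $d$ zeros, where $t$ denotes the number of leading nonzero entries, onto the set of facets of $\mathrm{NCP}_{d+1}(n)$: - $t=0$, and between any two nonzero entries of $\beta$ there is an even number of zeros; - $0<t<n-d$ and $\beta=(-1,+1,\dots,(-1)^{t-1},\sigma,0,\beta')$ with $\sigma\in\{\pm1\}$ and $\beta'\in\{0,\pm1\}^{n-t-1}$, where between any two nonzero entries of $\beta'$ there is an even number of zeros, and $\beta'$ starts with an even number of zeros if $\sigma=(-1)^{t+1}$ and with an odd number of zeros if $\sigma=(-1)^t$; - $t=n-d$ and $\beta=(-1,+1,\dots,(-1)^{t-1},\sigma,0,\dots,0)$ with $\sigma\in\{\pm1\}$. 2. $\mathrm{BBC}\bigl((T_i)_{i=d}^{n-1}\bigr)$ and the boundary complex of $\mathrm{NCP}_{d+1}(n)$ are combinatorially isomorphic. The isomorphism is given by reversing the order of the coordinates and flipping the signs of alternate coordinates: with $$\Phi(\alpha_1,\dots,\alpha_n)=(\alpha_n,-\alpha_{n-1},\dots,(-1)^n\alpha_2,(-1)^{n+1}\alpha_1),$$ the map $\alpha\mapsto P_{\Phi(\alpha)}$ is an isomorphism from the poset of nonempty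 faces of $\mathrm{BBC}\bigl((T_i)_{i=d}^{n-1}\bigr)$ to the poset of nonempty proper faces of $\mathrm{NCP}_{d+1}(n)$. -/

import Mathlib

open Filter Topology

noncomputable section

/-! ## Faces of polytopes -/

/-- The boundary complex of a convex polytope `P`: its nonempty proper faces.  For a polytope the
faces are exactly the exposed faces, i.e. the intersections with supporting hyperplanes. -/
def boundaryFaces {m : ℕ} (P : Set (Fin m → ℝ)) : Set (Set (Fin m → ℝ)) :=
  {F | IsExposed ℝ P F ∧ F.Nonempty ∧ F ≠ P}

/-- The facets of a convex polytope `P`: its maximal proper faces. -/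
def polytopeFacets {m : ℕ} (P : Set (Fin m → ℝ)) : Set (Set (Fin m → ℝ)) :=
  {F | Maximal (fun G => G ∈ boundaryFaces P) F}

/-! ## Sign vectors and cubical complexes

A sign vector `α ∈ {0,±1}ⁿ` stands for the nonempty face `{x ∈ [-1,1]ⁿ | αᵢ ≠ 0 → xᵢ = αᵢ}` of the
`n`-cube; its dimension is the number of zero entries.  A cubical complex in the boundary of the
`n`-cube is given by the set of its (nonempty) faces. -/

/-- Inclusion of faces of the cube in terms of their sign vectors (`+1 < 0` and `-1 < 0` in every
coordinate). -/
def FaceLE {n : ℕ} (α β : Fin n → SignType) : Prop := ∀ i, β i = 0 ∨ α i = β i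

/-- The set of coordinates in which a sign vector vanishes. -/
def zeroSet {n : ℕ} (α : Fin n → SignType) : Finset (Fin n) :=
  Finset.univ.filter (fun i => α i = 0)

/-- The boundary complex of the `k`-cube: all faces except the cube itself. -/
def cubeBoundary (k : ℕ) : Set (Fin k → SignType) := {α | α ≠ 0}

/-- The mirror complex of a simplicial complex on `k` vertices.  A simplex is encoded by the
characteristic function of its complement, so `|α|` encodes the simplex `zeroSet α`. -/
def mirror {k : ℕ} (Δ : Set (Finset (Fin k))) : Set (Fin k → SignType) :=
  {α | zeroSet α ∈ Δ}

/-- `β` is a facet (a maximal face) of the cubical complex `C`. -/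
def IsFacet {k : ℕ} (C : Set (Fin k → SignType)) (β : Fin k → SignType) : Prop :=
  β ∈ C ∧ ∀ γ ∈ C, FaceLE β γ → γ = β

/-- The complement of the subcomplex `C₁` in the pure complex `C`: the subcomplex generated by
the facets of `C` that do not belong to `C₁`. -/
def complementComplex {k : ℕ} (C C₁ : Set (Fin k → SignType)) : Set (Fin k → SignType) :=
  {α | ∃ β, IsFacet C β ∧ β ∉ C₁ ∧ FaceLE α β}

/-- The cubical fissure between `C₁` and `C₂`:
`(C₁ × {+1}) ∪ ((C₁ ∩ C₂) × {0}) ∪ (C₂ × {-1})`. -/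
def fissure {k : ℕ} (C₁ C₂ : Set (Fin k → SignType)) : Set (Fin (k + 1) → SignType) :=
  {α | (Fin.init α ∈ C₁ ∧ α (Fin.last k) = 1) ∨
       (Fin.init α ∈ C₁ ∩ C₂ ∧ α (Fin.last k) = 0) ∨
       (Fin.init α ∈ C₂ ∧ α (Fin.last k) = -1)}

/-- The cubical complexes `S_k` of a sequence `T` of simplicial complexes, `T k` having the vertex
set `Fin k`: `S_{d+1}` is the boundary of the `(d+1)`-cube, and for `k ≥ d + 1` the complex
`S_{k+1}` is the fissure of `S_k` between the mirror complex of `T k` and its complement.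
The final complex `BBC((T_i)_{i=d}^{n-1})` is `bbc d T n`.
(The values for `k ≤ d` are irrelevant.) -/
def bbc (d : ℕ) (T : (k : ℕ) → Set (Finset (Fin k))) : (k : ℕ) → Set (Fin k → SignType)
  | 0 => cubeBoundary 0
  | k + 1 =>
    if k ≤ d then cubeBoundary (k + 1)
    else fissure (mirror (T k)) (complementComplex (bbc d T k) (mirror (T k)))

/-! ## Pulling triangulations of cyclic polytopes -/

/-- The `i` points `v_j = (j, j², …, jᵐ)`, `j = 1, …, i`, on the moment curve in `ℝᵐ`. -/
def momentPoint (m i : ℕ) (j : Fin i) : Fin m → ℝ := fun k => ((j : ℝ) + 1) ^ ((k : ℕ) + 1)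

/-- The cyclic polytope `C_m(i)`. -/
def cyclicPolytope (m i : ℕ) : Set (Fin m → ℝ) := convexHull ℝ (Set.range (momentPoint m i))

/-- The pulling triangulation of the (simplicial) cyclic polytope `C_m(i)` with respect to its last
vertex `v_i`: its faces are the simplices spanned by `v_i` and a proper face `F` of the polytope
that does not contain `v_i`, together with all faces of these simplices. -/
def pullingTriangulation (m i : ℕ) : Set (Finset (Fin i)) :=
  {S | ∃ F ∈ boundaryFaces (cyclicPolytope m i),
    (∀ j : Fin i, (j : ℕ) + 1 = i → momentPoint m i j ∉ F) ∧
    ∀ j ∈ S, momentPoint m i j ∈ F ∨ (j : ℕ) + 1 = i}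

/-! ## The neighborly cubical polytopes

The polytope `NCP_{d+1}(n)` is obtained from a deformed `n`-cube in `ℝⁿ` with inequality system
`± ε xᵢ + ∑_k a_{ik} x_k ≤ bᵢ`, where `ε` is small, the right-hand sides grow rapidly, and the
matrix `(a_{ik})` is strictly lower triangular with only its first `n-d-1` columns nonzero, by
projecting to the last `d + 1` coordinates.  The rows `2, …, n` of `(a_{ik})`, truncated
to the first `n-d-1` columns, are (up to positive scaling) a Gale transform of the cyclic polytope
`C_{d-1}(n-1)`. -/

/-- The entries of the matrix.  In 1-based indices `i ≥ 2`, `1 ≤ k ≤ n-d-1` this is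
`(-1)^i * binom (i-2) (k-1)`; the first row is zero. -/
def galeEntry (d n : ℕ) (i k : Fin n) : ℝ :=
  if (k : ℕ) + d + 1 < n ∧ (k : ℕ) < i then
    (-1) ^ ((i : ℕ) + 1) * (Nat.choose ((i : ℕ) - 1) k : ℝ) else 0

/-- The left-hand side of the inequality of the deformed cube with index `i` and sign `s`. -/
def cubeForm (d n : ℕ) (ε : ℝ) (i : Fin n) (s : SignType) (x : Fin n → ℝ) : ℝ :=
  (s : ℝ) * ε * x i + ∑ k, galeEntry d n i k * x k

/-- The deformed `n`-cube, with right-hand sides `1, K, K², …`. -/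
def deformedCube (d n : ℕ) (ε K : ℝ) : Set (Fin n → ℝ) :=
  {x | ∀ i : Fin n, cubeForm d n ε i 1 x ≤ K ^ (i : ℕ) ∧ cubeForm d n ε i (-1) x ≤ K ^ (i : ℕ)}

/-- The face of the deformed cube with sign vector `β`: for every `i` with `β i ≠ 0` the inequality
with index `i` and sign `β i` is tight. -/
def deformedCubeFace (d n : ℕ) (ε K : ℝ) (β : Fin n → SignType) : Set (Fin n → ℝ) :=
  {x ∈ deformedCube d n ε K | ∀ i, β i ≠ 0 → cubeForm d n ε i (β i) x = K ^ (i : ℕ)}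

/-- The projection of `ℝⁿ` to the last `d + 1` coordinates. -/
def lastCoords {d n : ℕ} (h : d < n) (x : Fin n → ℝ) : Fin (d + 1) → ℝ :=
  fun j => x ⟨n - (d + 1) + j, by omega⟩

/-- The neighborly cubical polytope `NCP_{d+1}(n)` in `ℝ^{d+1}` (with parameters `ε` and `K`). -/
def ncp {d n : ℕ} (h : d < n) (ε K : ℝ) : Set (Fin (d + 1) → ℝ) :=
  lastCoords h '' deformedCube d n ε K

/-- The subset of `NCP_{d+1}(n)` that corresponds to the face `β` of the `n`-cube. -/
def ncpFace {d n : ℕ} (h : d < n) (ε K : ℝ) (β : Fin n → SignType) : Set (Fin (d + 1) → ℝ) :=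
  lastCoords h '' deformedCubeFace d n ε K β

/-! ## The cubical Gale evenness condition -/

/-- Gale's evenness condition for the entries of `α` from (0-based) position `s` on: between any two
nonzero entries there is an even number of zeros. -/
def GaleEvenFrom {n : ℕ} (α : Fin n → SignType) (s : ℕ) : Prop :=
  ∀ i j : Fin n, s ≤ i → i < j → α i ≠ 0 → α j ≠ 0 →
    Even (Finset.univ.filter (fun k => i < k ∧ k < j ∧ α k = 0)).card

/-- The number of zeros with which the sequence of the entries of `α` from (0-based) position `s`
on starts. -/
def leadingZeros {n : ℕ} (α : Fin n → SignType) (s : ℕ) : ℕ :=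
  (Finset.univ.filter (fun k : Fin n => s ≤ k ∧ ∀ l : Fin n, s ≤ l → l ≤ k → α l = 0)).card

/-- The sign vector `α` has exactly `d` zeros and exactly `t` leading nonzero entries, and it is of
one of the types `t = 0`, `0 < t < n - d`, `t = n - d` of the cubical Gale evenness condition.
(The 1-based position `p` is the 0-based position `p - 1`.) -/
def CubicalGale (d n : ℕ) (α : Fin n → SignType) : Prop :=
  (zeroSet α).card = d ∧
  ∃ t : ℕ, (∀ i : Fin n, (i : ℕ) < t → α i ≠ 0) ∧ (∀ i : Fin n, (i : ℕ) = t → α i = 0) ∧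
    ((t = 0 ∧ GaleEvenFrom α 0) ∨
     (0 < t ∧ t + d < n ∧
       (∀ i : Fin n, (i : ℕ) + 1 < t → α i = (-1) ^ ((i : ℕ) + 1)) ∧
       GaleEvenFrom α (t + 1) ∧
       (∀ i : Fin n, (i : ℕ) + 1 = t →
         (α i = (-1) ^ (t + 1) → Even (leadingZeros α (t + 1))) ∧
         (α i = (-1) ^ t → Odd (leadingZeros α (t + 1))))) ∨
     (t + d = n ∧ ∀ i : Fin n, (i : ℕ) + 1 < t → α i = (-1) ^ ((i : ℕ) + 1)))

/-! ## The isomorphism -/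

/-- The map `(α₁, α₂, …, αₙ) ↦ (αₙ, -αₙ₋₁, …, (-1)ⁿ α₂, (-1)ⁿ⁺¹ α₁)`. -/
def reverseFlip {n : ℕ} (α : Fin n → SignType) : Fin n → SignType :=
  fun i => (-1) ^ (i : ℕ) * α i.rev

end

/-! Both face posets are identified with one explicit set of sign vectors, `IsGaleFace m` with `m =
n - d - 1`; everything then follows by comparing the two descriptions.

Polytope. For large `K` the deformed cube is combinatorially a cube, and a face of it projects to a
proper face of the image exactly when the normals of its tight inequalities, truncated to the `m`
eliminated coordinates, have a linear dependency with positive coefficients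
(`eventually_boundaryFaces_ncp`). By duality (`exists_pos_dependency`) this is a question about the
signs that a vector `y` can take on the truncated rows. Newton interpolation identifies `y` with a
polynomial `p` of degree less than `m`, and in the limit `ε → 0` row `i ≥ 1` (0-based) reads off
`(-1)^(i-1) * p(i)`. The required signs are therefore attainable unless the support contains `m + 1`
positions of alternating parity, which would force too many sign changes.

Row `0` of the Gale matrix vanishes, so only the sign of its `ε`-term matters; it imposes a sign on
`p(1)`, just as row `1` does. If its sign is `-1` and row `1` is present too, the two rows become
opposite in the limit. Sign conditions are then not stable under perturbation, so this case is
contracted along the first coordinate; the contracted rows are again Gale rows, shifted and negated,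
which gives the recursive clause of `IsGaleFace` (`exists_delta_detects`).

Sphere. Gale evenness for the pulling triangulations (`mem_pullingTriangulation_iff`) is also a
statement about alternating chains. After reversing and flipping, the last coordinate becomes the
first, and the three layers of a fissure match the three possible first signs (`isGaleFace_one_iff`,
`isGaleFace_zero_iff`, `isGaleFace_neg_one_iff`); hence `mem_bbc_iff`.

Facets are the faces with exactly `m + 1` nonzero signs. For a set of that size, containing an
alternating chain is a parity condition on gaps, and unfolding the recursion along the leading
nonzero signs yields the cubical Gale evenness condition (`cubicalGale_iff`). -/

/-! ## Alternating chains and the combinatorial description of the faces -/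

/-- There is a chain of `m + 1` elements of `W`, starting with `i`, in which the parity
alternates. -/
def AltFrom (W : Set ℕ) : ℕ → ℕ → Prop
  | 0, i => i ∈ W
  | m + 1, i => i ∈ W ∧ ∃ j, i < j ∧ Odd (i + j) ∧ AltFrom W m j

/-- `W` contains an increasing chain of `m + 1` elements of alternating parity. -/
def HasAlt (m : ℕ) (W : Set ℕ) : Prop := ∃ i, AltFrom W m i

/-- The tail of a sequence of signs, negated. -/
def negTail (β : ℕ → SignType) : ℕ → SignType := fun i => -β (i + 1)

/-- The combinatorial description of the faces of the projected deformed cube in terms of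
alternating chains of nonzero positions; `m` is the number of eliminated coordinates. -/
def IsGaleFace : ℕ → (ℕ → SignType) → Prop
  | 0, β => ∃ i, β i ≠ 0
  | m + 1, β =>
    (β 0 = 0 ∧ HasAlt (m + 1) (Function.support β)) ∨
    (β 0 = 1 ∧ HasAlt (m + 1) (insert 1 (Function.support β \ {0}))) ∨
    (β 0 = -1 ∧ β 1 = 0 ∧ HasAlt (m + 1) (Function.support β)) ∨
    (β 0 = -1 ∧ β 1 ≠ 0 ∧ IsGaleFace m (negTail β))

/-! ### Manipulation of alternating chains. -/

theorem AltFrom.mem {W : Set ℕ} {m i : ℕ} (h : AltFrom W m i) : i ∈ W := by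
  cases m with
  | zero => exact h
  | succ m => exact h.1

theorem AltFrom.mono {W V : Set ℕ} {m i : ℕ} (h : AltFrom W m i) (hWV : ∀ j ∈ W, i ≤ j → j ∈ V) :
    AltFrom V m i := by
  induction m generalizing i with
  | zero => exact hWV i h le_rfl
  | succ m ih =>
    obtain ⟨h0, j, hij, hodd, hj⟩ := h
    exact ⟨hWV i h0 le_rfl, j, hij, hodd, ih hj fun k hk hjk => hWV k hk (by omega)⟩

theorem HasAlt.mono {W V : Set ℕ} {m : ℕ} (h : HasAlt m W) (hWV : W ⊆ V) : HasAlt m V := by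
  obtain ⟨i, hi⟩ := h
  exact ⟨i, hi.mono fun j hj _ => hWV hj⟩

theorem AltFrom.truncate {W : Set ℕ} {m i : ℕ} (h : AltFrom W (m + 1) i) : AltFrom W m i := by
  induction m generalizing i with
  | zero => exact h.1
  | succ m ih =>
    obtain ⟨h0, j, hij, hodd, hj⟩ := h
    exact ⟨h0, j, hij, hodd, ih hj⟩

/-- If `a` and `i` have opposite parity, prepend `a` and drop the last element; if they have the
same parity, let `a` take the place of `i`. -/
theorem AltFrom.restart {W : Set ℕ} {m i a : ℕ} (h : AltFrom W m i) (ha : a ∈ W) (hai : a ≤ i) :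
    AltFrom W m a := by
  rcases hai.eq_or_lt with rfl | hai
  · exact h
  cases m with
  | zero => exact ha
  | succ m =>
    by_cases hp : Odd (a + i)
    · exact ⟨ha, i, hai, hp, h.truncate⟩
    · obtain ⟨h0, j, hij, hodd, hj⟩ := h
      refine ⟨ha, j, by omega, ?_, hj⟩
      rw [Nat.not_odd_iff_even] at hp
      grind

theorem altFrom_shift {W : Set ℕ} {m i : ℕ} :
    AltFrom {j | j + 1 ∈ W} m i ↔ AltFrom W m (i + 1) := by
  induction m generalizing i with
  | zero => rfl
  | succ m ih =>
    constructor
    · rintro ⟨h0, j, hij, hodd, hj⟩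
      exact ⟨h0, j + 1, by omega, by grind, ih.1 hj⟩
    · rintro ⟨h0, j, hij, hodd, hj⟩
      obtain ⟨j, rfl⟩ : ∃ k, j = k + 1 := ⟨j - 1, by omega⟩
      exact ⟨h0, j, by omega, by grind, ih.2 hj⟩

theorem AltFrom.exists_finset {W : Set ℕ} {m i : ℕ} (h : AltFrom W m i) :
    ∃ S : Finset ℕ, S.card = m + 1 ∧ (∀ j ∈ S, j ∈ W ∧ i ≤ j) ∧ AltFrom (S : Set ℕ) m i := by
  induction m generalizing i with
  | zero => exact ⟨{i}, by simp, by simpa [AltFrom] using h, by simp [AltFrom]⟩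
  | succ m ih =>
    obtain ⟨h0, j, hij, hodd, hj⟩ := h
    obtain ⟨S, hS, hSW, hSA⟩ := ih hj
    have hiS : i ∉ S := fun hi => by have := (hSW i hi).2; omega
    refine ⟨insert i S, by simp [hiS, hS], ?_, by simp, j, hij, hodd,
      hSA.mono fun k hk _ => by simpa using Or.inr hk⟩
    intro k hk
    rcases Finset.mem_insert.1 hk with rfl | hk
    · exact ⟨h0, le_rfl⟩
    · exact ⟨(hSW k hk).1, by have := (hSW k hk).2; omega⟩

/-- A chain of `m + 1` elements in a set with at most `m + 1` elements exhausts it, hence starts at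
the minimum. This makes chains rigid on the supports of facets. -/
theorem AltFrom.le_of_card {S : Finset ℕ} {m i : ℕ} (h : AltFrom (S : Set ℕ) m i)
    (hS : S.card ≤ m + 1) : ∀ j ∈ S, i ≤ j := by
  obtain ⟨T, hT, hTS, -⟩ := h.exists_finset
  have : T = S := Finset.eq_of_subset_of_card_le (fun j hj => by simpa using (hTS j hj).1)
    (by omega)
  exact this ▸ fun j hj => (hTS j hj).2

theorem HasAlt.card_le {S : Finset ℕ} {m : ℕ} (h : HasAlt m (S : Set ℕ)) : m + 1 ≤ S.card := by
  obtain ⟨i, hi⟩ := h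
  obtain ⟨T, hT, hTS, -⟩ := hi.exists_finset
  exact hT ▸ Finset.card_le_card fun j hj => by simpa using (hTS j hj).1

/-! ### The combinatorial faces: closure under subfaces, and facets. -/

theorem SignType.eq_neg_one_of {s : SignType} (h0 : s ≠ 0) (h1 : s ≠ 1) : s = -1 := by
  revert s; decide

/-- A chain avoiding position `0` works for every sign there. In the recursive clause its first
element is dropped, so that after the shift the rest avoids `0` again. -/
theorem IsGaleFace.of_hasAlt {m : ℕ} {β : ℕ → SignType}
    (h : HasAlt m (Function.support β \ {0})) : IsGaleFace m β := by
  induction m generalizing β with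
  | zero =>
    obtain ⟨i, hi⟩ := h
    exact ⟨i, hi.1⟩
  | succ m ih =>
    by_cases h0 : β 0 = 0
    · exact Or.inl ⟨h0, h.mono Set.sdiff_subset⟩
    by_cases h1 : β 0 = 1
    · exact Or.inr (Or.inl ⟨h1, h.mono (Set.subset_insert _ _)⟩)
    have h2 := SignType.eq_neg_one_of h0 h1
    by_cases h3 : β 1 = 0
    · exact Or.inr (Or.inr (Or.inl ⟨h2, h3, h.mono Set.sdiff_subset⟩))
    refine Or.inr (Or.inr (Or.inr ⟨h2, h3, ih ?_⟩))
    obtain ⟨i, ⟨hi, hi0⟩, j, hij, -, hj⟩ := h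
    obtain ⟨j, rfl⟩ : ∃ k, j = k + 1 := ⟨j - 1, by omega⟩
    have hi0 : i ≠ 0 := hi0
    refine ⟨j, AltFrom.mono (altFrom_shift.2 hj) ?_⟩
    rintro k ⟨hk, -⟩ hjk
    refine ⟨by simpa [negTail] using hk, ?_⟩
    simp only [Set.mem_singleton_iff]
    omega

theorem IsGaleFace.exists_ne_zero {m : ℕ} {β : ℕ → SignType} (h : IsGaleFace m β) :
    ∃ i, β i ≠ 0 := by
  cases m with
  | zero => exact h
  | succ m =>
    rcases h with ⟨-, i, hi⟩ | ⟨h, -⟩ | ⟨h, -⟩ | ⟨h, -⟩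
    · exact ⟨i, hi.mem⟩
    all_goals exact ⟨0, by simp [h]⟩

/-- Making more signs nonzero may switch to another clause of the definition, because the entries
`0` and `1` select the clause. A chain, possibly shortened by its first element, then avoids
position `0`, and `IsGaleFace.of_hasAlt` applies. -/
theorem IsGaleFace.mono {m : ℕ} {β γ : ℕ → SignType} (h : IsGaleFace m γ)
    (hβ : ∀ i, γ i = 0 ∨ β i = γ i) : IsGaleFace m β := by
  have hsupp : Function.support γ ⊆ Function.support β := by
    intro i hi
    have hi : γ i ≠ 0 := hi
    rcases hβ i with h | h
    · exact absurd h hi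
    · simpa [h] using hi
  induction m generalizing β γ with
  | zero =>
    obtain ⟨i, hi⟩ := h
    exact ⟨i, hsupp hi⟩
  | succ m ih =>
    rcases h with ⟨h0, h⟩ | ⟨h0, h⟩ | ⟨h0, h1, h⟩ | ⟨h0, h1, h⟩
    · apply IsGaleFace.of_hasAlt
      refine h.mono fun i hi => ⟨hsupp hi, ?_⟩
      rintro rfl
      exact hi h0
    · refine Or.inr (Or.inl ⟨?_, h.mono ?_⟩)
      · rcases hβ 0 with h' | h' <;> simp_all
      · exact Set.insert_subset_insert (Set.sdiff_subset_sdiff_left hsupp)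
    · have hβ0 : β 0 = -1 := by rcases hβ 0 with h' | h' <;> simp_all
      by_cases hβ1 : β 1 = 0
      · exact Or.inr (Or.inr (Or.inl ⟨hβ0, hβ1, h.mono hsupp⟩))
      refine Or.inr (Or.inr (Or.inr ⟨hβ0, hβ1, IsGaleFace.of_hasAlt ?_⟩))
      obtain ⟨i, hi, j, hij, -, hj⟩ := h
      obtain ⟨j, rfl⟩ : ∃ k, j = k + 1 := ⟨j - 1, by omega⟩
      have hj0 : j ≠ 0 := by
        rintro rfl
        exact hj.mem h1
      refine ⟨j, AltFrom.mono (altFrom_shift.2 hj) ?_⟩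
      intro k hk hjk
      refine ⟨by simpa [negTail] using hsupp hk, ?_⟩
      simp only [Set.mem_singleton_iff]
      omega
    · have hβ0 : β 0 = -1 := by rcases hβ 0 with h' | h' <;> simp_all
      have hβ1 : β 1 ≠ 0 := hsupp h1
      refine Or.inr (Or.inr (Or.inr ⟨hβ0, hβ1, ih h ?_ ?_⟩))
      · intro i
        simpa [negTail] using hβ (i + 1)
      · intro i hi
        simpa [negTail] using @hsupp (i + 1) (by simpa [negTail] using hi)

open Classical in
/-- The sequence `β` with all entries outside `S` replaced by zero. -/
def restrictSign (β : ℕ → SignType) (S : Finset ℕ) : ℕ → SignType := fun i => if i ∈ S then β i else 0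

theorem support_restrictSign {β : ℕ → SignType} {S : Finset ℕ} (hS : ∀ i ∈ S, β i ≠ 0) :
    Function.support (restrictSign β S) = S := by
  ext i
  by_cases hi : i ∈ S <;> simp [restrictSign, hi, hS]

theorem restrictSign_le (β : ℕ → SignType) (S : Finset ℕ) (i : ℕ) :
    restrictSign β S i = 0 ∨ β i = restrictSign β S i := by
  by_cases hi : i ∈ S <;> simp [restrictSign, hi]

/-- Every face lies in a facet, and if the first sign of the face is nonzero, then the facet may
be chosen to have the same first sign. -/
theorem IsGaleFace.exists_facet {m : ℕ} {β : ℕ → SignType} (h : IsGaleFace m β) :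
    ∃ (γ : ℕ → SignType) (S : Finset ℕ), Function.support γ = S ∧ S.card = m + 1 ∧
      IsGaleFace m γ ∧ (∀ i, γ i = 0 ∨ β i = γ i) ∧ (β 0 ≠ 0 → γ 0 = β 0) := by
  induction m generalizing β with
  | zero =>
    obtain ⟨i, hi, hi'⟩ : ∃ i, β i ≠ 0 ∧ (β 0 ≠ 0 → i = 0) := by
      obtain ⟨i, hi⟩ := h
      by_cases h0 : β 0 = 0
      · exact ⟨i, hi, fun h => absurd h0 h⟩
      · exact ⟨0, h0, fun _ => rfl⟩
    refine ⟨restrictSign β {i}, {i}, support_restrictSign (by simpa), by simp,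
      ⟨i, by simpa [restrictSign]⟩, restrictSign_le _ _, ?_⟩
    intro h0
    simp [restrictSign, hi' h0]
  | succ m ih =>
    rcases h with ⟨h0, i, h⟩ | ⟨h0, i, h⟩ | ⟨h0, h1, i, h⟩ | ⟨h0, h1, h⟩
    · obtain ⟨S, hS, hSW, hSA⟩ := h.exists_finset
      have hsupp := support_restrictSign (β := β) (S := S) fun i hi => (hSW i hi).1
      refine ⟨restrictSign β S, S, hsupp, hS, ?_, restrictSign_le _ _, fun h => absurd h0 h⟩
      refine Or.inl ⟨by simp [restrictSign, h0], i, by rwa [hsupp]⟩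
    · have hi1 : 1 ≤ i := by
        rcases h.mem with h | h
        · exact h.ge
        · exact Nat.one_le_iff_ne_zero.2 h.2
      -- Position `1` stands in for position `0` here. With the chain starting at `1`, exchanging
      -- `1` for `0` gives a support of the same size that contains `0`.
      have h := h.restart (Set.mem_insert _ _) hi1
      obtain ⟨S, hS, hSW, hSA⟩ := h.exists_finset
      have h1S : 1 ∈ S := by simpa using hSA.mem
      have hT : ∀ i ∈ S.erase 1, β i ≠ 0 ∧ i ≠ 0 := fun j hj => by
        rcases (hSW j (Finset.mem_of_mem_erase hj)).1 with h | h
        · exact absurd h (Finset.ne_of_mem_erase hj)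
        · exact h
      have hsupp := support_restrictSign (β := β) (S := insert 0 (S.erase 1)) fun i hi => by
        rcases Finset.mem_insert.1 hi with rfl | hi
        · simp [h0]
        · exact (hT i hi).1
      refine ⟨restrictSign β (insert 0 (S.erase 1)), insert 0 (S.erase 1), hsupp, ?_, ?_,
        restrictSign_le _ _, fun _ => by simp [restrictSign]⟩
      · rw [Finset.card_insert_of_notMem fun h => (hT 0 h).2 rfl, Finset.card_erase_of_mem h1S]
        omega
      · refine Or.inr (Or.inl ⟨by simp [restrictSign, h0], 1, hSA.mono ?_⟩)
        intro j hj hj1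
        rw [hsupp]
        by_cases hj' : j = 1
        · simp [hj']
        · refine Or.inr ⟨?_, by simp; omega⟩
          simpa [hj'] using Or.inr hj
    · have h := h.restart (a := 0) (by simp [h0]) (Nat.zero_le _)
      obtain ⟨S, hS, hSW, hSA⟩ := h.exists_finset
      have hsupp := support_restrictSign (β := β) (S := S) fun i hi => (hSW i hi).1
      have h0S : 0 ∈ S := by simpa using hSA.mem
      refine ⟨restrictSign β S, S, hsupp, hS, ?_, restrictSign_le _ _,
        fun _ => by simp [restrictSign, h0S]⟩
      refine Or.inr (Or.inr (Or.inl ⟨by simp [restrictSign, h0S, h0], ?_, 0, by rwa [hsupp]⟩))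
      simp [restrictSign, h1]
    · obtain ⟨γ, S, hγ, hS, hG, hle, h0'⟩ := ih h
      have hγ0 : γ 0 = negTail β 0 := h0' (by simpa [negTail] using h1)
      refine ⟨fun i => if i = 0 then -1 else -γ (i - 1),
        insert 0 (S.image (· + 1)), ?_, ?_, ?_, ?_, ?_⟩
      · ext i
        rcases i with _ | i
        · simp
        · have : γ i ≠ 0 ↔ i ∈ S := by
            rw [← Function.mem_support, hγ]
            simp
          simp [this]
      · rw [Finset.card_insert_of_notMem (by simp), Finset.card_image_of_injective _ (add_left_injective 1), hS]
      · refine Or.inr (Or.inr (Or.inr ⟨by simp, ?_, ?_⟩))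
        · simpa [hγ0, negTail] using h1
        · convert hG using 1
          ext i
          simp [negTail]
      · intro i
        rcases i with _ | i
        · simp [h0]
        · rcases hle i with h | h
          · simp [h]
          · right
            simp [← h, negTail]
      · simp [h0]

theorem IsGaleFace.card_le {m : ℕ} {β : ℕ → SignType} (h : IsGaleFace m β) {S : Finset ℕ}
    (hS : ∀ i, β i ≠ 0 → i ∈ S) : m + 1 ≤ S.card := by
  obtain ⟨γ, T, hγ, hT, -, hle, -⟩ := h.exists_facet
  rw [← hT]
  refine Finset.card_le_card fun i hi => hS i ?_
  have hi : γ i ≠ 0 := by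
    rw [← Function.mem_support, hγ]
    simpa using hi
  rcases hle i with h | h
  · exact absurd h hi
  · simpa [h] using hi

/-! ## Polynomials with prescribed signs -/

open Polynomial in
-- By Lagrange interpolation at `m + 1` nodes, the coefficient of degree `m`, which is zero, is the
-- sum of `p(x i) / ∏ (x i - x j)`. The denominators alternate in sign as the values do, so all
-- terms have the same sign and must vanish; `p` then has too many roots.
theorem Polynomial.eq_zero_of_weakly_alternating {m : ℕ} {x : ℕ → ℝ}
    (hx : ∀ j < m, x j < x (j + 1)) {p : ℝ[X]} (hp : p.degree < m)
    (h : ∀ j ≤ m, 0 ≤ (-1) ^ j * p.eval (x j)) : p = 0 := by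
  have hlt : ∀ i j, i < j → j ≤ m → x i < x j := by
    intro i j hij hj
    induction j, hij using Nat.le_induction with
    | base => exact hx i (by omega)
    | succ j hij ih => exact (ih (by omega)).trans (hx j (by omega))
  have hinj : Set.InjOn x (Finset.range (m + 1)) := by
    intro i hi j hj hij
    simp only [Finset.coe_range, Set.mem_Iio] at hi hj
    rcases lt_trichotomy i j with h | h | h
    · exact absurd hij (hlt i j h (by omega)).ne
    · exact h
    · exact absurd hij (hlt j i h (by omega)).ne'
  have hsum := Lagrange.coeff_eq_sum hinj (P := p)
    (hp.trans (by rw [Finset.card_range]; exact_mod_cast Nat.lt_succ_self m))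
  rw [Finset.card_range, Nat.add_sub_cancel, coeff_eq_zero_of_degree_lt hp] at hsum
  have hprod : ∀ i ≤ m,
      0 < (-1) ^ (m - i) * ∏ j ∈ (Finset.range (m + 1)).erase i, (x i - x j) := by
    intro i hi
    have hsplit : (Finset.range (m + 1)).erase i = Finset.range i ∪ Finset.Ioc i m := by
      ext j
      simp only [Finset.mem_erase, Finset.mem_range, Finset.mem_union, Finset.mem_Ioc]
      omega
    have hdisj : Disjoint (Finset.range i) (Finset.Ioc i m) := by
      rw [Finset.disjoint_left]
      intro j hj hj'
      simp only [Finset.mem_range, Finset.mem_Ioc] at hj hj'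
      omega
    rw [hsplit, Finset.prod_union hdisj, mul_left_comm]
    refine mul_pos (Finset.prod_pos fun j hj => ?_) ?_
    · exact sub_pos.2 (hlt j i (Finset.mem_range.1 hj) hi)
    · have : ((-1 : ℝ)) ^ (m - i) = ∏ j ∈ Finset.Ioc i m, (-1 : ℝ) := by simp
      rw [this, ← Finset.prod_mul_distrib]
      refine Finset.prod_pos fun j hj => ?_
      have := hlt i j (Finset.mem_Ioc.1 hj).1 (Finset.mem_Ioc.1 hj).2
      linarith
  have hnonneg : ∀ i ∈ Finset.range (m + 1), 0 ≤ (-1) ^ m * (p.eval (x i) /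
      ∏ j ∈ (Finset.range (m + 1)).erase i, (x i - x j)) := by
    intro i hi
    have hi : i ≤ m := Nat.lt_succ_iff.1 (Finset.mem_range.1 hi)
    have h1 := div_nonneg (h i hi) (hprod i hi).le
    have h2 : (-1 : ℝ) ^ m * (-1) ^ (m - i) = (-1) ^ i := by
      rw [← pow_add, show m + (m - i) = i + 2 * (m - i) by omega, pow_add, pow_mul]
      simp
    have h3 : ((-1 : ℝ) ^ (m - i)) * (-1) ^ (m - i) = 1 := by
      rw [← mul_pow]
      simp
    have h4 : ((-1 : ℝ) ^ (m - i)) ≠ 0 := by simp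
    rw [← h2] at h1
    refine h1.trans_eq ?_
    rw [mul_comm ((-1 : ℝ) ^ m), mul_assoc, mul_div_mul_left _ _ h4, mul_div_assoc]
  have hzero : ∀ i ∈ Finset.range (m + 1), p.eval (x i) = 0 := by
    have h0 : ∑ i ∈ Finset.range (m + 1), (-1) ^ m * (p.eval (x i) /
        ∏ j ∈ (Finset.range (m + 1)).erase i, (x i - x j)) = 0 := by
      rw [← Finset.mul_sum, ← hsum, mul_zero]
    intro i hi
    have h1 := (Finset.sum_eq_zero_iff_of_nonneg hnonneg).1 h0 i hi
    have h2 := hprod i (Nat.lt_succ_iff.1 (Finset.mem_range.1 hi))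
    have h3 : ∏ j ∈ (Finset.range (m + 1)).erase i, (x i - x j) ≠ 0 := right_ne_zero_of_mul h2.ne'
    simpa [h3] using h1
  refine Polynomial.eq_zero_of_degree_lt_of_eval_index_eq_zero (s := Finset.range (m + 1)) hinj
    (hp.trans ?_) hzero
  rw [Finset.card_range]
  exact_mod_cast Nat.lt_succ_self m

theorem AltFrom.exists_seq {W : Set ℕ} {m i : ℕ} (h : AltFrom W m i) :
    ∃ f : ℕ → ℕ, f 0 = i ∧ (∀ j < m, f j < f (j + 1)) ∧ ∀ j ≤ m, f j ∈ W ∧ Even (f j + i + j) := by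
  induction m generalizing i with
  | zero => exact ⟨fun _ => i, rfl, by simp, fun j hj => ⟨h, by grind⟩⟩
  | succ m ih =>
    obtain ⟨h0, j, hij, hodd, hj⟩ := h
    obtain ⟨f, hf0, hf, hfW⟩ := ih hj
    refine ⟨fun k => if k = 0 then i else f (k - 1), by simp, ?_, ?_⟩
    · intro k hk
      rcases k with _ | k
      · simpa [hf0] using hij
      · simpa using hf k (by omega)
    · intro k hk
      rcases k with _ | k
      · simp only [if_true]
        exact ⟨h0, by grind⟩
      · have := hfW k (by omega)
        simp only [Nat.succ_ne_zero, if_false, Nat.add_sub_cancel]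
        exact ⟨this.1, by grind⟩

open Polynomial in
/-- A polynomial of degree less than `m` cannot (weakly) alternate in sign along an alternating
chain of `m + 1` elements. -/
theorem HasAlt.polynomial_eq_zero {m : ℕ} {W : Set ℕ} (hW : HasAlt m W) {x : ℕ → ℝ}
    (hx : StrictMono x) {p : ℝ[X]} (hp : p.degree < m)
    (h : ∀ i ∈ W, 0 ≤ (-1) ^ i * p.eval (x i)) : p = 0 := by
  obtain ⟨i, hi⟩ := hW
  obtain ⟨f, hf0, hf, hfW⟩ := hi.exists_seq
  have hc : (C ((-1 : ℝ) ^ i)) ≠ 0 := by simp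
  have hp' : (C ((-1 : ℝ) ^ i) * p).degree < m := by
    rwa [degree_C_mul (by simp)]
  have := Polynomial.eq_zero_of_weakly_alternating (x := fun j => x (f j)) (m := m)
    (fun j hj => hx (hf j hj)) hp' fun j hj => by
      have h1 := h _ (hfW j hj).1
      have h2 : (-1 : ℝ) ^ f j = (-1) ^ j * (-1) ^ i := by
        have h3 := (hfW j hj).2
        rw [← pow_add]
        rcases Nat.even_or_odd (f j) with h4 | h4
        · rw [h4.neg_one_pow, Even.neg_one_pow (by grind)]
        · rw [h4.neg_one_pow, Odd.neg_one_pow (by grind)]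
      rw [h2] at h1
      rw [eval_mul, eval_C]
      linarith
  simpa [hc] using this

open Polynomial in
/-- If `W` contains no alternating chain of `m + 1` elements, then there is a polynomial of degree
less than `m` whose sign at `i ∈ W` is given by the parity of `i`. -/
theorem exists_polynomial_of_not_hasAlt {m : ℕ} {W : Finset ℕ} (hW : ¬ HasAlt m (W : Set ℕ))
    {x : ℕ → ℝ} (hx : StrictMono x) :
    ∃ p : ℝ[X], p.degree < m ∧ (∀ i ∈ W, 0 < (-1) ^ i * p.eval (x i)) ∧
      ∀ w ∈ W, (∀ i ∈ W, w ≤ i) → ∀ t ≤ x w, 0 < (-1) ^ w * p.eval t := by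
  classical
  -- The third conclusion, a constant sign to the left of the first node, strengthens the induction:
  -- it keeps control of the sign on the block that is split off.
  induction m generalizing W with
  | zero =>
    have hW : ∀ i, i ∉ W := fun i hi => hW ⟨i, hi⟩
    exact ⟨0, by simp, fun i hi => absurd hi (hW i), fun i hi => absurd hi (hW i)⟩
  | succ m ih =>
    rcases W.eq_empty_or_nonempty with rfl | hne
    · exact ⟨0, by rw [degree_zero]; exact WithBot.bot_lt_coe _, by simp, by simp⟩
    set w := W.min' hne with hw
    have hwW : w ∈ W := W.min'_mem hne
    have hwle : ∀ i ∈ W, w ≤ i := fun i hi => W.min'_le i hi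
    have hweq : ∀ v ∈ W, (∀ i ∈ W, v ≤ i) → v = w := fun v hv h => le_antisymm (h w hwW) (hwle v hv)
    -- `W \ V` is the initial block of elements with the parity of `w`. Any chain in `V` extends by
    -- `w`, so `V` admits a polynomial of one degree less.
    set V := W.filter fun i => ∃ j ∈ W, Odd (w + j) ∧ j ≤ i with hV
    have hVW : ∀ i ∈ V, i ∈ W := fun i hi => (Finset.mem_filter.1 hi).1
    obtain ⟨q, hq, hqV, hqmin⟩ := ih (W := V) (by
      rintro ⟨i, hi⟩
      obtain ⟨-, j, hj, hodd, hji⟩ := Finset.mem_filter.1 (Finset.mem_coe.1 hi.mem)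
      have hjV : j ∈ V := Finset.mem_filter.2 ⟨hj, j, hj, hodd, le_rfl⟩
      have := hwle j hj
      refine hW ⟨w, hwW, j, ?_, hodd, (hi.restart hjV hji).mono fun k hk _ => hVW k hk⟩
      rcases this.eq_or_lt with h | h
      · rw [← h] at hodd
        grind
      · exact h)
    by_cases hVne : V.Nonempty
    · set j := V.min' hVne with hj
      have hjV : j ∈ V := V.min'_mem hVne
      have hjle : ∀ i ∈ V, j ≤ i := fun i hi => V.min'_le i hi
      obtain ⟨-, k, hkW, hkodd, hkj⟩ := Finset.mem_filter.1 hjV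
      have hjk : j = k := le_antisymm (hjle k (Finset.mem_filter.2 ⟨hkW, k, hkW, hkodd, le_rfl⟩)) hkj
      rw [← hjk] at hkodd
      have hwj : w < j := by
        rcases (hwle j (hVW j hjV)).eq_or_lt with h | h
        · rw [← h] at hkodd
          grind
        · exact h
      -- The extra root separates the initial block from `V`: the linear factor is positive on `V`
      -- and supplies the sign change before it.
      set r := (x (j - 1) + x j) / 2 with hr
      have hxj : x (j - 1) < x j := hx (by omega)
      have hsmall : ∀ t ≤ x (j - 1), 0 < (-1) ^ w * (q * (X - C r)).eval t := by
        intro t ht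
        have h1 := hqmin j hjV hjle t (by linarith)
        have h2 : (-1 : ℝ) ^ j = -(-1) ^ w := by
          rcases Nat.even_or_odd w with h4 | h4
          · rw [h4.neg_one_pow, Odd.neg_one_pow (by grind)]
          · rw [h4.neg_one_pow, Even.neg_one_pow (by grind), neg_neg]
        rw [h2] at h1
        have h3 : t - r < 0 := by linarith
        simp only [eval_mul, eval_sub, eval_X, eval_C]
        nlinarith
      refine ⟨q * (X - C r), ?_, ?_, ?_⟩
      · rw [degree_mul, degree_X_sub_C]
        push_cast
        exact WithBot.add_lt_add_right (by simp) hq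
      · intro i hi
        by_cases hiV : i ∈ V
        · have h1 := hqV i hiV
          have h2 : 0 < x i - r := by
            have := hx.monotone (hjle i hiV)
            linarith
          simp only [eval_mul, eval_sub, eval_X, eval_C]
          rw [← mul_assoc]
          exact mul_pos h1 h2
        · have hij : i < j := by
            by_contra hcon
            exact hiV (Finset.mem_filter.2 ⟨hi, j, hVW j hjV, hkodd, by omega⟩)
          have heven : ¬ Odd (w + i) := fun h => hiV (Finset.mem_filter.2 ⟨hi, i, hi, h, le_rfl⟩)
          have h1 := hsmall (x i) (hx.monotone (by omega))
          have h2 : (-1 : ℝ) ^ i = (-1) ^ w := by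
            rcases Nat.even_or_odd w with h4 | h4
            · rw [h4.neg_one_pow, Even.neg_one_pow (by grind)]
            · rw [h4.neg_one_pow, Odd.neg_one_pow (by grind)]
          rwa [h2]
      · intro v hv hvle t ht
        rw [hweq v hv hvle] at ht ⊢
        exact hsmall t (ht.trans (hx.monotone (by omega)))
    · have hall : ∀ i ∈ W, (-1 : ℝ) ^ i * (-1) ^ w = 1 := by
        intro i hi
        have heven : ¬ Odd (w + i) := fun h =>
          hVne ⟨i, Finset.mem_filter.2 ⟨hi, i, hi, h, le_rfl⟩⟩
        rw [← pow_add, Even.neg_one_pow (by grind)]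
      refine ⟨C ((-1) ^ w), ?_, ?_, ?_⟩
      · rw [degree_C (by simp)]
        exact_mod_cast Nat.succ_pos m
      · intro i hi
        rw [eval_C, hall i hi]
        exact one_pos
      · intro v hv _ t _
        rw [eval_C, hall v hv]
        exact one_pos

/-! ## Newton interpolation at the positive integers -/

/-- The linear form `∑_{k<m} v_k y_k`. -/
def pairing (m : ℕ) (v y : ℕ → ℝ) : ℝ := ∑ k ∈ Finset.range m, v k * y k

/-- The rows of the Gale transform: `(-1)^(i+1) binom (i-1) k`. -/
def galeRow (i k : ℕ) : ℝ := (-1) ^ (i + 1) * ((i - 1).choose k : ℝ)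

open Polynomial in
-- Newton's forward difference formula: `p(i+1) = ∑ binom(i,k) Δ^k p(1)`, so the differences `Δ^k
-- p(1)` are the coefficients.
theorem exists_coeffs_of_polynomial {m : ℕ} {p : ℝ[X]} (hp : p.degree < m) :
    ∃ y : ℕ → ℝ, ∀ i : ℕ, pairing m (galeRow (i + 1)) y = (-1) ^ i * p.eval (i + 1 : ℝ) := by
  refine ⟨fun k => (fwdDiff (1 : ℝ))^[k] p.eval 1, fun i => ?_⟩
  have hzero : ∀ k, m ≤ k → (fwdDiff (1 : ℝ))^[k] p.eval 1 = 0 := by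
    intro k hk
    rcases eq_or_ne p 0 with rfl | hp0
    · have : (fun t : ℝ => eval t (0 : ℝ[X])) = fun t => 0 := by simp
      simp [fwdDiff_iter_eq_sum_shift]
    · rw [Polynomial.fwdDiff_iter_eq_zero_of_degree_lt]
      · rfl
      · rw [degree_eq_natDegree hp0] at hp
        have : p.natDegree < m := by exact_mod_cast hp
        omega
  have hN := shift_eq_sum_fwdDiff_iter (1 : ℝ) p.eval i 1
  have h1 : ∑ k ∈ Finset.range (i + 1), i.choose k • (fwdDiff (1 : ℝ))^[k] p.eval 1 =
      ∑ k ∈ Finset.range m, i.choose k • (fwdDiff (1 : ℝ))^[k] p.eval 1 := by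
    have h2 : ∑ k ∈ Finset.range (i + 1), i.choose k • (fwdDiff (1 : ℝ))^[k] p.eval 1 =
        ∑ k ∈ Finset.range (max (i + 1) m), i.choose k • (fwdDiff (1 : ℝ))^[k] p.eval 1 := by
      refine Finset.sum_subset (Finset.range_subset_range.2 (le_max_left _ _)) fun k _ hk => ?_
      rw [Nat.choose_eq_zero_of_lt (by simpa using hk), zero_smul]
    rw [h2]
    symm
    refine Finset.sum_subset (Finset.range_subset_range.2 (le_max_right _ _)) fun k _ hk => ?_
    rw [hzero k (by simpa using hk), smul_zero]
  rw [h1] at hN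
  rw [show ((i : ℝ) + 1) = 1 + i • (1 : ℝ) by simp [add_comm], hN, Finset.mul_sum, pairing]
  refine Finset.sum_congr rfl fun k _ => ?_
  simp only [galeRow, nsmul_eq_mul, Nat.add_sub_cancel]
  ring

open Polynomial in
-- The polynomial is `∑ y_k binom(X-1,k)`. If it is zero, evaluation at `1, 2, …` is a unitriangular
-- system (up to signs), whence `y = 0`.
theorem exists_polynomial_of_coeffs (m : ℕ) (y : ℕ → ℝ) :
    ∃ p : ℝ[X], p.degree < m ∧
      (∀ i : ℕ, pairing m (galeRow (i + 1)) y = (-1) ^ i * p.eval (i + 1 : ℝ)) ∧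
      (p = 0 → ∀ k < m, y k = 0) := by
  have key : ∀ i : ℕ, pairing m (galeRow (i + 1)) y = (-1) ^ i *
      (∑ k ∈ Finset.range m, C (y k / k.factorial) *
        (descPochhammer ℝ k).comp (X - 1)).eval (i + 1 : ℝ) := by
    intro i
    rw [eval_finsetSum, Finset.mul_sum, pairing]
    refine Finset.sum_congr rfl fun k _ => ?_
    have h1 : (eval (i : ℝ) (descPochhammer ℝ k)) = (i.choose k : ℝ) * k.factorial := by
      rw [descPochhammer_eval_eq_descFactorial, Nat.descFactorial_eq_factorial_mul_choose]
      push_cast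
      ring
    have h2 : (k.factorial : ℝ) ≠ 0 := by positivity
    simp only [galeRow, eval_mul, eval_C, eval_comp, eval_sub, eval_X, eval_one,
      add_sub_cancel_right, h1, Nat.add_sub_cancel]
    field_simp
    ring
  refine ⟨_, ?_, key, ?_⟩
  · refine mem_degreeLT.1 (Submodule.sum_mem _ fun k hk => mem_degreeLT.2 ?_)
    refine lt_of_le_of_lt degree_le_natDegree ?_
    have h1 : ((C (y k / k.factorial) * (descPochhammer ℝ k).comp (X - 1))).natDegree ≤ k := by
      refine (natDegree_C_mul_le _ _).trans ?_
      rw [natDegree_comp, descPochhammer_natDegree, ← C_1, natDegree_X_sub_C, mul_one]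
    exact_mod_cast lt_of_le_of_lt h1 (Finset.mem_range.1 hk)
  · intro hp k hk
    rw [hp] at key
    simp only [eval_zero, mul_zero] at key
    induction k using Nat.strong_induction_on with
    | _ k ih =>
      have h1 := key k
      rw [pairing, Finset.sum_eq_single_of_mem k (Finset.mem_range.2 hk)] at h1
      · simpa [galeRow] using h1
      · intro l hl hlk
        rcases lt_or_gt_of_ne hlk with h | h
        · rw [ih l h (by omega), mul_zero]
        · simp [galeRow, Nat.choose_eq_zero_of_lt h]

/-! ## Stability of sign conditions under perturbation -/

theorem abs_pairing_sub_le {m : ℕ} {a v y : ℕ → ℝ} {δ : ℝ} (h : ∀ k < m, |v k - a k| ≤ δ) :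
    |pairing m v y - pairing m a y| ≤ δ * ∑ k ∈ Finset.range m, |y k| := by
  rw [pairing, pairing, ← Finset.sum_sub_distrib, Finset.mul_sum]
  refine (Finset.abs_sum_le_sum_abs _ _).trans (Finset.sum_le_sum fun k hk => ?_)
  rw [← sub_mul, abs_mul]
  exact mul_le_mul_of_nonneg_right (h k (Finset.mem_range.1 hk)) (abs_nonneg _)

theorem pairing_smul (m : ℕ) (v y : ℕ → ℝ) (c : ℝ) :
    pairing m v (fun k => c * y k) = c * pairing m v y := by
  rw [pairing, pairing, Finset.mul_sum]
  exact Finset.sum_congr rfl fun k _ => by ring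

/-- Compactness: the sum `g` of the negative parts is positive on the unit sphere, hence at least
some `η > 0` there. If all pairings with a perturbed family are nonnegative at a unit vector, then
`g ≤ |I| * m * δ < η` there. -/
theorem exists_delta_forall_eq_zero {m : ℕ} {I : Finset ℕ} {a : ℕ → ℕ → ℝ}
    (h : ∀ y, (∀ i ∈ I, 0 ≤ pairing m (a i) y) → ∀ k < m, y k = 0) :
    ∃ δ > 0, ∀ v : ℕ → ℕ → ℝ, (∀ i ∈ I, ∀ k < m, |v i k - a i k| < δ) →
      ∀ y, (∀ i ∈ I, 0 ≤ pairing m (v i) y) → ∀ k < m, y k = 0 := by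
  set ext : (Fin m → ℝ) → ℕ → ℝ := fun z k => if hk : k < m then z ⟨k, hk⟩ else 0 with hext
  have hextk : ∀ z (k : Fin m), ext z k = z k := fun z k => by simp [hext]
  set g : (Fin m → ℝ) → ℝ := fun z => ∑ i ∈ I, max 0 (-pairing m (a i) (ext z)) with hg
  have hcont : Continuous g := by
    refine continuous_finsetSum _ fun i _ => continuous_const.max (Continuous.neg ?_)
    refine continuous_finsetSum _ fun k hk => continuous_const.mul ?_
    simp only [hext, Finset.mem_range.1 hk, dif_pos]
    exact continuous_apply _
  have hpos : ∀ z ∈ Metric.sphere (0 : Fin m → ℝ) 1, 0 < g z := by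
    intro z hz
    by_contra hcon
    have h0 : g z = 0 :=
      le_antisymm (not_lt.1 hcon) (Finset.sum_nonneg fun i _ => le_max_left _ _)
    have h1 := (Finset.sum_eq_zero_iff_of_nonneg fun i _ => le_max_left _ _).1 h0
    have h2 := h (ext z) fun i hi => by
      have := le_max_right 0 (-pairing m (a i) (ext z))
      rw [h1 i hi] at this
      linarith
    have h3 : z = 0 := funext fun k => (hextk z k).symm.trans (h2 k k.2)
    simp [h3] at hz
  obtain ⟨η, hη, hgη⟩ := (isCompact_sphere (0 : Fin m → ℝ) 1).exists_forall_le' hcont.continuousOn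
    hpos
  have hden : (0 : ℝ) < I.card * m + 1 := by positivity
  refine ⟨η / (I.card * m + 1), by positivity, fun v hv y hy => ?_⟩
  by_contra hne
  push Not at hne
  obtain ⟨k, hk, hyk⟩ := hne
  set z : Fin m → ℝ := fun k => y k with hz
  have hz0 : z ≠ 0 := fun h => hyk (congrFun h ⟨k, hk⟩)
  have hnorm : 0 < ‖z‖ := norm_pos_iff.2 hz0
  have hsph : ‖z‖⁻¹ • z ∈ Metric.sphere (0 : Fin m → ℝ) 1 := by
    rw [mem_sphere_zero_iff_norm, norm_smul, norm_inv, norm_norm, inv_mul_cancel₀ hnorm.ne']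
  have h1 := hgη _ hsph
  have hpair : ∀ w : ℕ → ℝ, pairing m w (ext (‖z‖⁻¹ • z)) = ‖z‖⁻¹ * pairing m w y := by
    intro w
    rw [← pairing_smul]
    refine Finset.sum_congr rfl fun k hk => ?_
    simp [hext, hz, Finset.mem_range.1 hk]
  have hsum : ∑ k ∈ Finset.range m, |ext (‖z‖⁻¹ • z) k| ≤ m := by
    have : ∀ k ∈ Finset.range m, |ext (‖z‖⁻¹ • z) k| ≤ 1 := by
      intro k hk
      rw [hextk _ ⟨k, Finset.mem_range.1 hk⟩, ← Real.norm_eq_abs]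
      refine (norm_le_pi_norm _ _).trans ?_
      rw [mem_sphere_zero_iff_norm.1 hsph]
    simpa using Finset.sum_le_sum this
  have h2 : g (‖z‖⁻¹ • z) ≤ ∑ i ∈ I, η / (I.card * m + 1) * m := by
    refine Finset.sum_le_sum fun i hi => max_le (by positivity) ?_
    have h3 := abs_pairing_sub_le (y := ext (‖z‖⁻¹ • z)) fun k hk => (hv i hi k hk).le
    have h4 : 0 ≤ pairing m (v i) (ext (‖z‖⁻¹ • z)) := by
      rw [hpair]
      exact mul_nonneg (by positivity) (hy i hi)
    have h5 := (abs_le.1 h3).2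
    have h6 : η / (I.card * m + 1) * ∑ k ∈ Finset.range m, |ext (‖z‖⁻¹ • z) k| ≤
        η / (I.card * m + 1) * m := mul_le_mul_of_nonneg_left hsum (by positivity)
    linarith
  rw [Finset.sum_const, nsmul_eq_mul] at h2
  have h3 : (I.card : ℝ) * (η / (I.card * m + 1) * m) < η := by
    rw [show (I.card : ℝ) * (η / (I.card * m + 1) * m) = η * (I.card * m) / (I.card * m + 1) by ring,
      div_lt_iff₀ hden]
    nlinarith
  linarith

theorem exists_delta_exists_pos {m : ℕ} {I : Finset ℕ} {a : ℕ → ℕ → ℝ}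
    (h : ∃ y, ∀ i ∈ I, 0 < pairing m (a i) y) :
    ∃ δ > 0, ∀ v : ℕ → ℕ → ℝ, (∀ i ∈ I, ∀ k < m, |v i k - a i k| < δ) →
      ∃ y, ∀ i ∈ I, 0 < pairing m (v i) y := by
  obtain ⟨y, hy⟩ := h
  obtain ⟨η, hη, hle⟩ : ∃ η > 0, ∀ i ∈ I, η ≤ pairing m (a i) y := by
    rcases I.eq_empty_or_nonempty with rfl | hI
    · exact ⟨1, one_pos, by simp⟩
    · obtain ⟨j, hj, hmin⟩ := I.exists_min_image (fun i => pairing m (a i) y) hI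
      exact ⟨_, hy j hj, hmin⟩
  have hs : 0 ≤ ∑ k ∈ Finset.range m, |y k| := Finset.sum_nonneg fun _ _ => abs_nonneg _
  refine ⟨η / (∑ k ∈ Finset.range m, |y k| + 1), by positivity, fun v hv => ⟨y, fun i hi => ?_⟩⟩
  have h1 := (abs_le.1 (abs_pairing_sub_le (y := y) fun k hk => (hv i hi k hk).le)).1
  have h2 : η / (∑ k ∈ Finset.range m, |y k| + 1) * ∑ k ∈ Finset.range m, |y k| < η := by
    rw [div_mul_eq_mul_div, div_lt_iff₀ (by positivity)]
    nlinarith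
  have := hle i hi
  linarith

theorem pairing_succ (m : ℕ) (v y : ℕ → ℝ) :
    pairing (m + 1) v y = pairing m (fun k => v (k + 1)) (fun k => y (k + 1)) + v 0 * y 0 :=
  Finset.sum_range_succ' _ _

theorem pairing_of_forall_eq_zero {m : ℕ} {v : ℕ → ℝ} (hv : ∀ k, 0 < k → k < m + 1 → v k = 0)
    (y : ℕ → ℝ) : pairing (m + 1) v y = v 0 * y 0 := by
  rw [pairing_succ, pairing, Finset.sum_eq_zero, zero_add]
  intro k hk
  rw [hv (k + 1) (by omega) (by simpa using hk), zero_mul]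

/-! ## The faces of the projected deformed cube -/

/-- The family `v` of normal vectors detects whether `β` is a face: if `P` holds, then no nonzero
vector is nonnegative on all normal vectors in the support of `β`; otherwise some vector is positive
on all of them. -/
def Detects (m : ℕ) (P : Prop) (β : ℕ → SignType) (v : ℕ → ℕ → ℝ) : Prop :=
  (P → ∀ y, (∀ i, β i ≠ 0 → 0 ≤ pairing m (v i) y) → ∀ k < m, y k = 0) ∧
  (¬ P → ∃ y, ∀ i, β i ≠ 0 → 0 < pairing m (v i) y)

/-- The family `v` is a perturbation by less than `δ` of the rows `galeRow i`, for `i < n`, that is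
lower triangular with the diagonal signs given by `β`. -/
structure IsPerturbation (n m : ℕ) (β : ℕ → SignType) (δ : ℝ) (v : ℕ → ℕ → ℝ) : Prop where
  close : ∀ i, 1 ≤ i → i < n → ∀ k < m, |v i k - galeRow i k| < δ
  triangular : ∀ i k, i < k → k < m → v i k = 0
  sign_eq : ∀ i < m, β i ≠ 0 → SignType.sign (v i i) = β i

/-- The rows `galeRow i`, with the row `0` replaced by a signed unit vector. -/
def limitRow (s : SignType) (i k : ℕ) : ℝ :=
  if i = 0 then (if k = 0 then (s : ℝ) else 0) else galeRow i k

/-- Row `0` of a perturbation need not be close to anything, but by triangularity it is a multiple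
of the first unit vector with the sign of `β 0`. Positive rescaling turns it into the limit row
without affecting the sign conditions, which are stable once the limit satisfies `Detects`. -/
theorem exists_delta_detects_of_limit {m n : ℕ} {P : Prop} {β : ℕ → SignType}
    (hβ : ∀ i, n ≤ i → β i = 0) (h : Detects (m + 1) P β (limitRow (β 0))) :
    ∃ δ > 0, ∀ v, IsPerturbation n (m + 1) β δ v → Detects (m + 1) P β v := by
  classical
  set I : Finset ℕ := (Finset.range n).filter fun i => β i ≠ 0 with hI
  have hmem : ∀ i, i ∈ I ↔ β i ≠ 0 := by
    intro i
    simp only [hI, Finset.mem_filter, Finset.mem_range, and_iff_right_iff_imp]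
    exact fun h => not_le.1 fun h' => h (hβ i h')
  set norm : (ℕ → ℕ → ℝ) → ℕ → ℕ → ℝ :=
    fun v i => if i = 0 then limitRow (β 0) 0 else v i with hnorm
  have hclose : ∀ δ > 0, ∀ v, IsPerturbation n (m + 1) β δ v → ∀ i ∈ I, ∀ k < m + 1,
      |norm v i k - limitRow (β 0) i k| < δ := by
    intro δ hδ v hv i hi k hk
    rcases Nat.eq_zero_or_pos i with rfl | hi0
    · simpa [hnorm] using hδ
    · have := hv.close i hi0 (by
        by_contra hcon
        exact (hmem i).1 hi (hβ i (not_lt.1 hcon))) k hk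
      simpa [hnorm, limitRow, hi0.ne'] using this
  have hpos : ∀ δ v, IsPerturbation n (m + 1) β δ v → ∀ i ∈ I, ∀ y,
      ∃ c > 0, pairing (m + 1) (v i) y = c * pairing (m + 1) (norm v i) y := by
    intro δ v hv i hi y
    rcases Nat.eq_zero_or_pos i with rfl | hi0
    · have h1 := hv.sign_eq 0 (Nat.succ_pos m) ((hmem 0).1 hi)
      have h2 : v 0 0 ≠ 0 := fun h => (hmem 0).1 hi (by rw [← h1, h, sign_zero])
      refine ⟨|v 0 0|, abs_pos.2 h2, ?_⟩
      rw [pairing_of_forall_eq_zero (fun k hk hk' => hv.triangular 0 k hk hk'),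
        pairing_of_forall_eq_zero (fun k hk _ => by simp [hnorm, limitRow, hk.ne'])]
      simp only [hnorm, limitRow, if_true]
      rw [← mul_assoc, ← h1, abs_mul_sign]
    · exact ⟨1, one_pos, by simp [hnorm, hi0.ne']⟩
  by_cases hP : P
  · obtain ⟨δ, hδ, hδ'⟩ := exists_delta_forall_eq_zero (I := I) (a := limitRow (β 0)) (m := m + 1)
      (fun y hy => h.1 hP y fun i hi => hy i ((hmem i).2 hi))
    refine ⟨δ, hδ, fun v hv => ⟨fun _ y hy => ?_, fun h' => absurd hP h'⟩⟩
    refine hδ' (norm v) (hclose δ hδ v hv) y fun i hi => ?_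
    obtain ⟨c, hc, hcv⟩ := hpos δ v hv i hi y
    have := hy i ((hmem i).1 hi)
    rw [hcv] at this
    exact nonneg_of_mul_nonneg_right this hc
  · obtain ⟨y, hy⟩ := h.2 hP
    obtain ⟨δ, hδ, hδ'⟩ := exists_delta_exists_pos (I := I) (a := limitRow (β 0)) (m := m + 1)
      ⟨y, fun i hi => hy i ((hmem i).1 hi)⟩
    refine ⟨δ, hδ, fun v hv => ⟨fun h' => absurd h' hP, fun _ => ?_⟩⟩
    obtain ⟨y, hy⟩ := hδ' (norm v) (hclose δ hδ v hv)
    refine ⟨y, fun i hi => ?_⟩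
    obtain ⟨c, hc, hcv⟩ := hpos δ v hv i ((hmem i).2 hi) y
    rw [hcv]
    exact mul_pos hc (hy i ((hmem i).2 hi))

open Polynomial in
-- `W` and `x` re-encode the support so that index `i ∈ W` demands the sign `(-1)^i` at the abscissa
-- `x i`. The polynomial is negated because row `i` reads off `(-1)^(i-1) * p(i)`.
theorem detects_limitRow {m : ℕ} {β : ℕ → SignType} {W : Finset ℕ} {x : ℕ → ℝ}
    (hx : StrictMono x)
    (h1 : ∀ (q : ℝ[X]) y, (∀ i, pairing m (galeRow (i + 1)) y = (-1) ^ (i + 1) * q.eval (i + 1 : ℝ)) →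
      (∀ i, β i ≠ 0 → 0 ≤ pairing m (limitRow (β 0) i) y) → ∀ i ∈ W, 0 ≤ (-1) ^ i * q.eval (x i))
    (h2 : ∀ (q : ℝ[X]) y, (∀ i, pairing m (galeRow (i + 1)) y = (-1) ^ (i + 1) * q.eval (i + 1 : ℝ)) →
      (∀ i ∈ W, 0 < (-1) ^ i * q.eval (x i)) → ∀ i, β i ≠ 0 → 0 < pairing m (limitRow (β 0) i) y) :
    Detects m (HasAlt m (W : Set ℕ)) β (limitRow (β 0)) := by
  constructor
  · intro hW y hy
    obtain ⟨p, hp, hpy, hp0⟩ := exists_polynomial_of_coeffs m y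
    refine hp0 ?_
    have := hW.polynomial_eq_zero hx (p := -p) (by rwa [degree_neg])
      (h1 (-p) y (fun i => by rw [hpy, eval_neg, pow_succ]; ring) hy)
    simpa using this
  · intro hW
    obtain ⟨q, hq, hqW, -⟩ := exists_polynomial_of_not_hasAlt hW hx
    obtain ⟨y, hy⟩ := exists_coeffs_of_polynomial (p := -q) (by rwa [degree_neg])
    exact ⟨y, h2 q y (fun i => by rw [hy, eval_neg, pow_succ]; ring) hqW⟩

theorem galeRow_one (k : ℕ) : galeRow 1 k = if k = 0 then 1 else 0 := by
  rcases k with _ | k <;> simp [galeRow]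

theorem pairing_limitRow_zero (m : ℕ) (s : SignType) (y : ℕ → ℝ) :
    pairing (m + 1) (limitRow s 0) y = s * y 0 := by
  rw [pairing_of_forall_eq_zero (fun k hk _ => by simp [limitRow, hk.ne'])]
  simp [limitRow]

theorem pairing_galeRow_one (m : ℕ) (y : ℕ → ℝ) : pairing (m + 1) (galeRow 1) y = y 0 := by
  rw [pairing_of_forall_eq_zero (fun k hk _ => by simp [galeRow_one, hk.ne'])]
  simp [galeRow_one]

/-- Since `galeRow 1` is the first unit vector, a nonzero sign at row `0` imposes that sign on
`p(1)`. The sign `+1` acts like position `1`; the sign `-1`, with position `1` absent, acts like an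
even position located at the abscissa `1`. -/
theorem detects_limitRow_of_ne {m n : ℕ} {β : ℕ → SignType} (hβ : ∀ i, n ≤ i → β i = 0)
    (h : ¬ (β 0 = -1 ∧ β 1 ≠ 0)) :
    Detects (m + 1) (IsGaleFace (m + 1) β) β (limitRow (β 0)) := by
  classical
  set I : Finset ℕ := (Finset.range n).filter fun i => β i ≠ 0 with hI
  have hmem : ∀ i, i ∈ I ↔ β i ≠ 0 := by
    intro i
    simp only [hI, Finset.mem_filter, Finset.mem_range, and_iff_right_iff_imp]
    exact fun h => not_le.1 fun h' => h (hβ i h')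
  have hsupp : Function.support β = I := by
    ext i
    simp [hmem]
  have hlim : ∀ i, limitRow (β 0) (i + 1) = galeRow (i + 1) := by
    intro i
    ext k
    simp [limitRow]
  by_cases h0 : β 0 = 0
  · have hiff : IsGaleFace (m + 1) β ↔ HasAlt (m + 1) (I : Set ℕ) := by
      simp [IsGaleFace, h0, hsupp]
    rw [hiff]
    refine detects_limitRow (x := fun i => (i : ℝ)) Nat.strictMono_cast ?_ ?_
    · intro q y hq hy i hi
      have hi := (hmem i).1 hi
      obtain ⟨i, rfl⟩ : ∃ k, i = k + 1 := ⟨i - 1, by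
        have : i ≠ 0 := by rintro rfl; exact hi h0
        omega⟩
      have := hy _ hi
      rw [hlim, hq] at this
      exact_mod_cast this
    · intro q y hq hy i hi
      have := hy i ((hmem i).2 hi)
      obtain ⟨i, rfl⟩ : ∃ k, i = k + 1 := ⟨i - 1, by
        have : i ≠ 0 := by rintro rfl; exact hi h0
        omega⟩
      rw [hlim, hq]
      exact_mod_cast this
  by_cases h1 : β 0 = 1
  · have hiff : IsGaleFace (m + 1) β ↔ HasAlt (m + 1) ((insert 1 (I.erase 0) : Finset ℕ) : Set ℕ) := by
      simp [IsGaleFace, h1, hsupp]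
    rw [hiff]
    refine detects_limitRow (x := fun i => (i : ℝ)) Nat.strictMono_cast ?_ ?_
    · intro q y hq hy i hi
      rcases Finset.mem_insert.1 hi with rfl | hi
      · have h2 := hy 0 h0
        rw [pairing_limitRow_zero, h1, ← pairing_galeRow_one m y, hq 0] at h2
        simpa using h2
      · have hi' := (hmem i).1 (Finset.mem_of_mem_erase hi)
        obtain ⟨i, rfl⟩ : ∃ k, i = k + 1 := ⟨i - 1, by
          have : i ≠ 0 := Finset.ne_of_mem_erase hi
          omega⟩
        have := hy _ hi'
        rw [hlim, hq] at this
        exact_mod_cast this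
    · intro q y hq hy i hi
      rcases i with _ | i
      · have := hy 1 (Finset.mem_insert_self _ _)
        rw [pairing_limitRow_zero, h1, ← pairing_galeRow_one m y, hq 0]
        simpa using this
      · have := hy (i + 1) (Finset.mem_insert_of_mem
          (Finset.mem_erase.2 ⟨Nat.succ_ne_zero i, (hmem _).2 hi⟩))
        rw [hlim, hq]
        exact_mod_cast this
  have h2 := SignType.eq_neg_one_of h0 h1
  have h3 : β 1 = 0 := by
    by_contra h3
    exact h ⟨h2, h3⟩
  have hiff : IsGaleFace (m + 1) β ↔ HasAlt (m + 1) (I : Set ℕ) := by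
    simp [IsGaleFace, h2, h3, hsupp]
  rw [hiff]
  -- Position `0` is moved to the abscissa `1`. The value `3 / 2` at the unused position `1` only
  -- keeps `x` strictly increasing.
  set x : ℕ → ℝ := fun i => if i = 0 then 1 else if i = 1 then 3 / 2 else i with hx
  have hxi : ∀ i, 2 ≤ i → x i = i := by
    intro i hi
    simp [hx, show i ≠ 0 by omega, show i ≠ 1 by omega]
  have hx0 : x 0 = 1 := by simp [hx]
  have hxmono : StrictMono x := by
    refine strictMono_nat_of_lt_succ fun i => ?_
    rcases i with _ | _ | i
    · norm_num [hx]
    · rw [hxi _ le_rfl]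
      norm_num [hx]
    · rw [hxi _ (by omega), hxi _ (by omega)]
      push_cast
      linarith
  have hcast : ((-1 : SignType) : ℝ) = -1 := by simp
  refine detects_limitRow (x := x) hxmono ?_ ?_
  · intro q y hq hy i hi
    rcases i with _ | _ | i
    · have h4 := hy 0 h0
      rw [pairing_limitRow_zero, h2, ← pairing_galeRow_one m y, hq 0] at h4
      simpa [hx0] using h4
    · exact absurd h3 ((hmem _).1 hi)
    · have := hy _ ((hmem _).1 hi)
      rw [hlim, hq] at this
      rw [hxi _ (by omega)]
      exact_mod_cast this
  · intro q y hq hy i hi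
    have := hy i ((hmem i).2 hi)
    rcases i with _ | _ | i
    · rw [pairing_limitRow_zero, h2, ← pairing_galeRow_one m y, hq 0]
      simpa [hx0] using this
    · exact absurd h3 hi
    · rw [hxi _ (by omega)] at this
      rw [hlim, hq]
      exact_mod_cast this

/-! ### Contraction along the first coordinate. -/

/-- The contraction of a family of vectors along the first coordinate, rescaled. -/
noncomputable def contractRow (v : ℕ → ℕ → ℝ) (θ : ℝ) (j k : ℕ) : ℝ :=
  if j = 0 then (if k = 0 then -v 1 1 else 0) else
    -((k + 1) / j * (v (j + 1) (k + 1) - if k = 0 then θ * (v (j + 1) 0 * v 1 1 / v 1 0) else 0))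

theorem galeRow_zero_right (i : ℕ) : |galeRow i 0| = 1 := by
  simp [galeRow]

/-- The absorption identity `(k+1) binom(j,k+1) = j binom(j-1,k)`: up to positive scaling of rows
and columns, deleting the first column of the Gale rows shifts the row index by one and changes the
sign. This is the origin of `negTail`. -/
theorem galeRow_succ_succ {j : ℕ} (hj : 1 ≤ j) (k : ℕ) :
    ((k : ℝ) + 1) / j * galeRow (j + 1) (k + 1) = -galeRow j k := by
  obtain ⟨j, rfl⟩ : ∃ i, j = i + 1 := ⟨j - 1, by omega⟩
  have h : ((j : ℝ) + 1) * j.choose k = (j + 1).choose (k + 1) * (k + 1) := by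
    exact_mod_cast Nat.add_one_mul_choose_eq j k
  have h' : ((k : ℝ) + 1) / (j + 1 : ℕ) * ((j + 1).choose (k + 1) : ℝ) = j.choose k := by
    push_cast
    field_simp
    linarith
  simp only [galeRow, Nat.add_sub_cancel]
  rw [← h', pow_succ _ (j + 1 + 1)]
  ring

/-- The correction term contains `v 1 1`, which is less than `δ` in absolute value because `galeRow
1 1 = 0`. With `|v (i+1) 0| ≤ 2` and `v 1 0 > 1/2` it is at most `4 * δ`. Adding the original error
gives `5 * δ`, and the scaling factor is at most `m + 2`. -/
theorem isPerturbation_contractRow {n m : ℕ} {β : ℕ → SignType} {δ δ' : ℝ} {v : ℕ → ℕ → ℝ}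
    (hv : IsPerturbation n (m + 2) β δ v) (hδ : δ ≤ 1 / 2) (hδ' : 5 * (m + 2) * δ ≤ δ') (hn : 1 < n)
    {θ : ℝ} (h0 : 0 ≤ θ) (h1 : θ ≤ 1) :
    IsPerturbation (n - 1) (m + 1) (negTail β) δ' (contractRow v θ) := by
  have hv10 := hv.close 1 le_rfl hn 0 (by omega)
  have hv11 := hv.close 1 le_rfl hn 1 (by omega)
  rw [galeRow_one, if_pos rfl] at hv10
  rw [galeRow_one, if_neg one_ne_zero, sub_zero] at hv11
  have hv10' : 1 / 2 < v 1 0 := by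
    have := (abs_lt.1 hv10).1
    linarith
  constructor
  · intro i hi hin k hk
    have hclose := hv.close (i + 1) (by omega) (by omega) (k + 1) (by omega)
    have hclose0 := hv.close (i + 1) (by omega) (by omega) 0 (by omega)
    have hi0 : i ≠ 0 := by omega
    have hipos : (1 : ℝ) ≤ i := by exact_mod_cast hi
    have hk' : (k : ℝ) + 1 ≤ m + 2 := by
      have : (k : ℝ) ≤ m + 1 := by exact_mod_cast hk.le
      linarith
    set e : ℝ := if k = 0 then θ * (v (i + 1) 0 * v 1 1 / v 1 0) else 0 with he
    have hebound : |e| ≤ 4 * δ := by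
      by_cases hk0 : k = 0
      · rw [he, if_pos hk0, abs_mul, abs_div, abs_mul, abs_of_nonneg h0,
          abs_of_pos (by linarith : 0 < v 1 0)]
        have h2 : |v (i + 1) 0| ≤ 2 := by
          have h3 := abs_add_le (v (i + 1) 0 - galeRow (i + 1) 0) (galeRow (i + 1) 0)
          rw [sub_add_cancel, galeRow_zero_right] at h3
          linarith
        have h4 : |v (i + 1) 0| * |v 1 1| / v 1 0 ≤ 4 * δ := by
          rw [div_le_iff₀ (by linarith)]
          have h5 : |v (i + 1) 0| * |v 1 1| ≤ 2 * δ :=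
            mul_le_mul h2 hv11.le (abs_nonneg _) (by norm_num)
          have : 0 ≤ δ := (abs_nonneg _).trans hv11.le
          nlinarith
        have h5 : 0 ≤ |v (i + 1) 0| * |v 1 1| / v 1 0 := by positivity
        nlinarith
      · rw [he, if_neg hk0, abs_zero]
        have : 0 ≤ δ := (abs_nonneg _).trans hv11.le
        linarith
    have heq : contractRow v θ i k - galeRow i k =
        -(((k : ℝ) + 1) / i * (v (i + 1) (k + 1) - galeRow (i + 1) (k + 1) - e)) := by
      rw [contractRow, if_neg hi0, ← neg_neg (galeRow i k), ← galeRow_succ_succ hi k]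
      ring
    rw [heq, abs_neg, abs_mul, abs_of_pos (by positivity)]
    have h6 : |v (i + 1) (k + 1) - galeRow (i + 1) (k + 1) - e| < 5 * δ := by
      have := abs_sub (v (i + 1) (k + 1) - galeRow (i + 1) (k + 1)) e
      linarith
    have h7 : ((k : ℝ) + 1) / i ≤ m + 2 := by
      rw [div_le_iff₀ (by linarith)]
      nlinarith
    calc ((k : ℝ) + 1) / i * |v (i + 1) (k + 1) - galeRow (i + 1) (k + 1) - e|
        < ((k : ℝ) + 1) / i * (5 * δ) := by
          exact mul_lt_mul_of_pos_left h6 (by positivity)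
      _ ≤ (m + 2) * (5 * δ) := by
          refine mul_le_mul_of_nonneg_right h7 ?_
          have : 0 ≤ δ := (abs_nonneg _).trans hv11.le
          linarith
      _ ≤ δ' := by linarith
  · intro i k hik hk
    by_cases hi0 : i = 0
    · rw [contractRow, if_pos hi0, if_neg (by omega)]
    · rw [contractRow, if_neg hi0, if_neg (by omega), hv.triangular (i + 1) (k + 1) (by omega)
        (by omega)]
      simp
  · intro i hi hβ
    have hβ' : β (i + 1) ≠ 0 := by simpa [negTail] using hβ
    have hs := hv.sign_eq (i + 1) (by omega) hβ'
    by_cases hi0 : i = 0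
    · subst hi0
      simp only [contractRow, if_true, negTail]
      rw [Left.sign_neg, hs]
    · have hipos : (0 : ℝ) < i := by
        exact_mod_cast Nat.pos_of_ne_zero hi0
      rw [contractRow, if_neg hi0, if_neg hi0, sub_zero, Left.sign_neg, sign_mul, hs,
        sign_pos (by positivity), one_mul, negTail]

theorem pairing_contractRow_zero (m : ℕ) (v : ℕ → ℕ → ℝ) (θ : ℝ) (y : ℕ → ℝ) :
    pairing (m + 1) (contractRow v θ 0) (fun k => -(y (k + 1) / (k + 1))) = v 1 1 * y 1 := by
  rw [pairing_of_forall_eq_zero (fun k hk _ => by simp [contractRow, hk.ne'])]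
  simp [contractRow]

/-- The contracted row is the original row restricted to the hyperplane `hy`, on which `y 0` is
eliminated; the change of variables undoes the column scaling. -/
theorem pairing_contractRow {m j : ℕ} (hj : 1 ≤ j) (v : ℕ → ℕ → ℝ) (θ : ℝ) {y : ℕ → ℝ}
    (hy : y 0 = -(θ * (v 1 1 / v 1 0) * y 1)) :
    pairing (m + 1) (contractRow v θ j) (fun k => -(y (k + 1) / (k + 1))) =
      (j : ℝ)⁻¹ * pairing (m + 2) (v (j + 1)) y := by
  have hj0 : j ≠ 0 := by omega
  have h : ∀ k : ℕ, contractRow v θ j k * -(y (k + 1) / (k + 1)) =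
      (j : ℝ)⁻¹ * (v (j + 1) (k + 1) * y (k + 1)) -
        if k = 0 then (j : ℝ)⁻¹ * (θ * (v (j + 1) 0 * v 1 1 / v 1 0) * y 1) else 0 := by
    intro k
    have hk : (k : ℝ) + 1 ≠ 0 := by positivity
    rw [contractRow, if_neg hj0]
    split_ifs with h
    · subst h
      have : (j : ℝ) ≠ 0 := by exact_mod_cast hj0
      field_simp
    · have : (j : ℝ) ≠ 0 := by exact_mod_cast hj0
      field_simp
      ring
  rw [pairing_succ (m + 1), pairing, Finset.sum_congr rfl fun k _ => h k, Finset.sum_sub_distrib,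
    ← Finset.mul_sum, Finset.sum_ite_eq' , if_pos (by simp), hy, pairing]
  ring

/-- The normal vectors of a small perturbation of the deformed cube detect the faces. -/
theorem exists_delta_detects (m n : ℕ) {β : ℕ → SignType} (hβ : ∀ i, n ≤ i → β i = 0) :
    ∃ δ > 0, ∀ v, IsPerturbation n m β δ v → Detects m (IsGaleFace m β) β v := by
  induction m generalizing n β with
  | zero =>
    refine ⟨1, one_pos, fun v hv => ⟨fun _ y _ k hk => absurd hk (Nat.not_lt_zero k), fun h => ?_⟩⟩
    exact ⟨0, fun i hi => absurd ⟨i, hi⟩ h⟩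
  | succ m ih =>
    by_cases hcase : β 0 = -1 ∧ β 1 ≠ 0
    swap
    · exact exists_delta_detects_of_limit hβ (detects_limitRow_of_ne hβ hcase)
    obtain ⟨h0, h1⟩ := hcase
    have hn : 1 < n := by
      by_contra hcon
      exact h1 (hβ 1 (by omega))
    have hiff : IsGaleFace (m + 1) β ↔ IsGaleFace m (negTail β) := by
      simp [IsGaleFace, h0, h1]
    rw [hiff]
    have hβ0 : β 0 ≠ 0 := by rw [h0]; decide
    have hrow0 : ∀ δ v, IsPerturbation n (m + 1) β δ v → ∀ y,
        pairing (m + 1) (v 0) y = v 0 0 * y 0 ∧ v 0 0 < 0 := by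
      intro δ v hv y
      refine ⟨pairing_of_forall_eq_zero (fun k hk hk' => hv.triangular 0 k hk hk') y, ?_⟩
      have := hv.sign_eq 0 (Nat.succ_pos m) hβ0
      rw [h0] at this
      exact sign_eq_neg_one_iff.1 this
    -- With one coordinate, rows `0` and `1` are a negative and a positive number, so together they
    -- force `y 0 = 0`.
    rcases m with _ | m
    · refine ⟨1 / 2, by norm_num, fun v hv => ⟨fun _ y hy k hk => ?_, fun h => ?_⟩⟩
      · obtain rfl : k = 0 := by omega
        obtain ⟨h2, h3⟩ := hrow0 _ v hv y
        have h4 := hy 0 hβ0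
        have h5 := hy 1 h1
        rw [h2] at h4
        rw [pairing_succ, pairing, Finset.sum_range_zero, zero_add] at h5
        have h6 := hv.close 1 le_rfl hn 0 (by omega)
        rw [galeRow_one, if_pos rfl] at h6
        have h7 := (abs_lt.1 h6).1
        exact le_antisymm (nonpos_of_mul_nonneg_right h4 h3)
          (nonneg_of_mul_nonneg_right h5 (by linarith))
      · exact absurd ⟨0, by simpa [negTail] using h1⟩ h
    obtain ⟨δ', hδ', hmain⟩ := ih (n - 1) (β := negTail β) (fun i hi => by
      rw [negTail, hβ (i + 1) (by omega), neg_zero])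
    refine ⟨min (1 / 2) (δ' / (5 * (m + 2))), by positivity, fun v hv => ?_⟩
    set δ := min (1 / 2) (δ' / (5 * (m + 2))) with hδ
    have hδ1 : δ ≤ 1 / 2 := min_le_left _ _
    have hδ2 : 5 * (m + 2) * δ ≤ δ' := by
      have h2 : δ ≤ δ' / (5 * (m + 2)) := min_le_right _ _
      rw [le_div_iff₀ (by positivity)] at h2
      linarith
    have hv10 : 0 < v 1 0 := by
      have h6 := hv.close 1 le_rfl hn 0 (by omega)
      rw [galeRow_one, if_pos rfl] at h6
      have := (abs_lt.1 h6).1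
      linarith
    have hs11 := hv.sign_eq 1 (by omega) h1
    have hv11 : v 1 1 ≠ 0 := by
      intro h
      rw [h, sign_zero] at hs11
      exact h1 hs11.symm
    have hrow1 : ∀ y, pairing (m + 2) (v 1) y = v 1 0 * y 0 + v 1 1 * y 1 := by
      intro y
      rw [pairing_succ, pairing_of_forall_eq_zero]
      · ring
      · intro k hk hk'
        exact hv.triangular 1 (k + 1) (by omega) (by omega)
    have htail : ∀ j, negTail β j ≠ 0 ↔ β (j + 1) ≠ 0 := fun j => by simp [negTail]
    constructor
    · intro hG y hy
      obtain ⟨h2, h3⟩ := hrow0 _ v hv y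
      have h4 := hy 0 hβ0
      rw [h2] at h4
      have hy0 : y 0 ≤ 0 := nonpos_of_mul_nonneg_right h4 h3
      have h5 := hy 1 h1
      rw [hrow1] at h5
      -- Rows `0` and `1` confine `y 0` to the interval from `-(v 1 1 / v 1 0) * y 1` to `0`; `θ` is
      -- its position there. The contraction depends on `y` through `θ`, which is why the
      -- perturbation bound has to be uniform in `θ`.
      obtain ⟨θ, hθ0, hθ1, hθ⟩ : ∃ θ : ℝ, 0 ≤ θ ∧ θ ≤ 1 ∧ y 0 = -(θ * (v 1 1 / v 1 0) * y 1) := by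
        have h6 : v 1 0 * y 0 ≤ 0 := mul_nonpos_of_nonneg_of_nonpos hv10.le hy0
        rcases eq_or_ne (v 1 1 * y 1) 0 with h7 | h7
        · refine ⟨0, le_rfl, zero_le_one, ?_⟩
          rw [h7, add_zero] at h5
          have : v 1 0 * y 0 = 0 := le_antisymm h6 h5
          simpa [hv10.ne'] using this
        · have h8 : 0 < v 1 1 * y 1 := lt_of_le_of_ne (by linarith) h7.symm
          refine ⟨-(v 1 0 * y 0) / (v 1 1 * y 1), div_nonneg (by linarith) h8.le, ?_, ?_⟩
          · rw [div_le_one h8]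
            linarith
          · have : y 1 ≠ 0 := right_ne_zero_of_mul h7
            field_simp
      have hzero := (hmain _ (isPerturbation_contractRow hv hδ1 hδ2 hn hθ0 hθ1)).1 hG
        (fun k => -(y (k + 1) / (k + 1))) fun i hi => by
          rcases i with _ | i
          · rw [pairing_contractRow_zero]
            linarith [mul_nonpos_of_nonneg_of_nonpos hv10.le hy0]
          · rw [pairing_contractRow (by omega) v θ hθ]
            exact mul_nonneg (by positivity) (hy _ ((htail _).1 hi))
      have hsucc : ∀ k < m + 1, y (k + 1) = 0 := by
        intro k hk
        have h6 := hzero k hk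
        have h7 : (k : ℝ) + 1 ≠ 0 := by positivity
        simpa [h7] using h6
      intro k hk
      rcases k with _ | k
      · rw [hθ, hsucc 0 (by omega)]
        simp
      · exact hsucc k (by omega)
    · intro hG
      -- The midpoint `θ = 1 / 2` lies inside the interval, so rows `0` and `1` both become strictly
      -- positive.
      obtain ⟨z, hz⟩ := (hmain _ (isPerturbation_contractRow hv hδ1 hδ2 hn (θ := 1 / 2)
        (by norm_num) (by norm_num))).2 hG
      set y : ℕ → ℝ := fun k => if k = 0 then -(1 / 2 * (v 1 1 / v 1 0) * -z 0) else -(k * z (k - 1))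
        with hy
      have hy1 : y 1 = -z 0 := by simp [hy]
      have hyz : z = fun k => -(y (k + 1) / (k + 1)) := by
        ext k
        have h7 : (k : ℝ) + 1 ≠ 0 := by positivity
        simp only [hy, Nat.succ_ne_zero, if_false, Nat.add_sub_cancel]
        push_cast
        field_simp
      have hy0 : y 0 = -(1 / 2 * (v 1 1 / v 1 0) * y 1) := by
        rw [hy1]
        simp [hy]
      rw [hyz] at hz
      have h6 : 0 < v 1 1 * y 1 := by
        have := hz 0 ((htail 0).2 h1)
        rwa [pairing_contractRow_zero] at this
      have h7 : v 1 0 * y 0 = -(1 / 2 * (v 1 1 * y 1)) := by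
        rw [hy0]
        field_simp
      refine ⟨y, fun i hi => ?_⟩
      rcases i with _ | _ | i
      · obtain ⟨h2, h3⟩ := hrow0 _ v hv y
        rw [h2]
        refine mul_pos_of_neg_of_neg h3 ?_
        by_contra hcon
        have := mul_nonneg hv10.le (not_lt.1 hcon)
        linarith
      · rw [zero_add, hrow1, h7]
        linarith
      · have := hz (i + 1) ((htail _).2 hi)
        rw [pairing_contractRow (by omega) v _ hy0] at this
        exact pos_of_mul_pos_right this (by positivity)

/-! ## Positive linear dependencies -/

/-- If no nonzero vector is nonnegative on all of the vectors `v i`, then these vectors have a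
linear dependency with positive coefficients. -/
theorem exists_pos_dependency {m : ℕ} {I : Finset ℕ} {v : ℕ → ℕ → ℝ}
    (h : ∀ y, (∀ i ∈ I, 0 ≤ pairing m (v i) y) → ∀ k < m, y k = 0) :
    ∃ c : ℕ → ℝ, (∀ i ∈ I, 0 < c i) ∧ ∀ k < m, ∑ i ∈ I, c i * v i k = 0 := by
  set T : (ℕ → ℝ) →ₗ[ℝ] (Fin m → ℝ) :=
    { toFun := fun c k => ∑ i ∈ I, c i * v i k
      map_add' := fun a b => by
        ext k
        simp [add_mul, Finset.sum_add_distrib]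
      map_smul' := fun a b => by
        ext k
        simp [Finset.mul_sum, mul_assoc] } with hT
  have hTapply : ∀ c (k : Fin m), T c k = ∑ i ∈ I, c i * v i k := fun c k => rfl
  set ext : (I → ℝ) →ₗ[ℝ] (ℕ → ℝ) :=
    { toFun := fun c i => if hi : i ∈ I then c ⟨i, hi⟩ else 0
      map_add' := fun a b => by
        ext i
        by_cases hi : i ∈ I <;> simp [hi]
      map_smul' := fun a b => by
        ext i
        by_cases hi : i ∈ I <;> simp [hi] } with hext
  have hextapply : ∀ c (i : I), ext c i = c i := fun c i => by simp [hext]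
  set S : (I → ℝ) →ₗ[ℝ] (Fin m → ℝ) := T.comp ext with hS
  have hSapply : ∀ c, S c = ∑ i : I, c i • fun k : Fin m => v i k := by
    intro c
    ext k
    rw [hS, LinearMap.comp_apply, hTapply, ← Finset.sum_coe_sort, Finset.sum_apply]
    exact Finset.sum_congr rfl fun i _ => by rw [hextapply]; rfl
  have hdual : ∀ f : (Fin m → ℝ) →ₗ[ℝ] ℝ, (∀ i ∈ I, 0 ≤ f fun k => v i k) → f = 0 := by
    intro f hf
    set y : ℕ → ℝ := fun k => if hk : k < m then f (Pi.single ⟨k, hk⟩ 1) else 0 with hy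
    have h1 : ∀ w : ℕ → ℝ, pairing m w y = f fun k => w k := by
      intro w
      rw [pairing, Finset.sum_range, LinearMap.pi_apply_eq_sum_univ f]
      refine Finset.sum_congr rfl fun k _ => ?_
      simp only [hy, k.2, dif_pos, smul_eq_mul]
      congr 2
      ext j
      simp [Pi.single_apply, eq_comm]
    have h2 := h y fun i hi => by rw [h1]; exact hf i hi
    refine LinearMap.pi_ext' fun k => LinearMap.ext_ring ?_
    have := h2 k k.2
    simpa [hy] using this
  -- A functional vanishing on the range is nonnegative on all `v i`, hence zero.
  have hsurj : Function.Surjective S := by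
    rw [← LinearMap.range_eq_top]
    by_contra hne
    obtain ⟨f, hf0, hf⟩ := Submodule.exists_le_ker_of_lt_top _ (lt_top_iff_ne_top.2 hne)
    refine hf0 (hdual f fun i hi => ?_)
    have : S (Pi.single ⟨i, hi⟩ 1) = fun k : Fin m => v i k := by
      rw [hSapply, Finset.sum_eq_single ⟨i, hi⟩]
      · simp
      · intro j _ hj
        simp [Pi.single_eq_of_ne hj]
      · simp
    rw [← this]
    exact (LinearMap.mem_ker.1 (hf (LinearMap.mem_range_self _ _))).ge
  set P : Set (I → ℝ) := {c | ∀ i, 0 < c i} with hP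
  have hPopen : IsOpen P := by
    have : P = Set.pi Set.univ fun _ => Set.Ioi 0 := by
      ext c
      simp [hP]
    rw [this]
    exact isOpen_set_pi Set.finite_univ fun _ _ => isOpen_Ioi
  have hPconv : Convex ℝ P := by
    intro a ha b hb s t hs ht hst i
    have := ha i
    have := hb i
    simp only [Pi.add_apply, Pi.smul_apply, smul_eq_mul]
    rcases hs.eq_or_lt with rfl | hs
    · rw [show t = 1 by linarith]
      linarith
    · have := mul_pos hs (ha i)
      have := mul_nonneg ht (hb i).le
      linarith
  -- The image of the positive orthant is open and convex. If it missed `0`, a separating functional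
  -- would be nonpositive on each `v i`, its negative would be zero by `hdual`, and this contradicts
  -- strict separation.
  have hopen : IsOpen (S '' P) :=
    (LinearMap.isOpenMap_of_finiteDimensional S hsurj) _ hPopen
  by_cases hmem : (0 : Fin m → ℝ) ∈ S '' P
  · obtain ⟨c, hc, hc0⟩ := hmem
    refine ⟨ext c, fun i hi => ?_, fun k hk => ?_⟩
    · rw [hextapply c ⟨i, hi⟩]
      exact hc ⟨i, hi⟩
    · exact congrFun hc0 ⟨k, hk⟩
  · exfalso
    obtain ⟨f, hf⟩ := geometric_hahn_banach_open_point (hPconv.linear_image S) hopen hmem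
    simp only [map_zero] at hf
    have h1 : ∀ i ∈ I, 0 ≤ (-(f : (Fin m → ℝ) →ₗ[ℝ] ℝ)) fun k => v i k := by
      intro i hi
      rw [LinearMap.neg_apply, Left.nonneg_neg_iff]
      by_contra hcon
      push Not at hcon
      -- The coordinate vector lies only on the boundary of the orthant; it is approached through
      -- interior points as `t → 0`.
      have h2 : Continuous fun t : ℝ => f (S (Pi.single ⟨i, hi⟩ 1 + t • fun _ => 1)) := by
        have : Continuous S := LinearMap.continuous_of_finiteDimensional S
        fun_prop
      have h3 : f (S (Pi.single ⟨i, hi⟩ 1 + (0 : ℝ) • fun _ => 1)) ≤ 0 := by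
        refine le_of_tendsto (h2.continuousWithinAt (s := Set.Ioi 0) (x := 0)) ?_
        filter_upwards [self_mem_nhdsWithin] with t ht
        refine (hf _ ⟨_, fun j => ?_, rfl⟩).le
        have ht : 0 < t := ht
        simp only [Pi.add_apply, Pi.smul_apply, smul_eq_mul, mul_one]
        by_cases hj : j = ⟨i, hi⟩
        · subst hj
          simp
          linarith
        · simpa [Pi.single_eq_of_ne hj] using ht
      rw [zero_smul, add_zero] at h3
      have : S (Pi.single ⟨i, hi⟩ 1) = fun k : Fin m => v i k := by
        rw [hSapply, Finset.sum_eq_single ⟨i, hi⟩]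
        · simp
        · intro j _ hj
          simp [Pi.single_eq_of_ne hj]
        · simp
      rw [this] at h3
      exact absurd hcon (not_lt.2 h3)
    have h2 := hdual _ h1
    have h3 := hf _ ⟨fun _ => 1, fun _ => one_pos, rfl⟩
    have h4 := LinearMap.congr_fun h2 (S fun _ => 1)
    simp only [LinearMap.neg_apply, LinearMap.zero_apply, neg_eq_zero] at h4
    exact absurd h4 h3.ne

/-! ## Preserved faces of the deformed cube -/

/-- A sequence of signs of length `n`, extended by zero. -/
def extendSign {n : ℕ} (β : Fin n → SignType) (i : ℕ) : SignType :=
  if h : i < n then β ⟨i, h⟩ else 0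

theorem extendSign_val {n : ℕ} (β : Fin n → SignType) (i : Fin n) : extendSign β i = β i := by
  simp [extendSign]

theorem extendSign_of_le {n : ℕ} (β : Fin n → SignType) {i : ℕ} (h : n ≤ i) :
    extendSign β i = 0 := by
  simp [extendSign, not_lt.2 h]

/-- The normal vectors of the inequalities of the deformed cube with signs `β`, truncated to the
eliminated coordinates, have a linear dependency with coefficients that are positive exactly on the
support of `β`. -/
def IsPreserved (d n : ℕ) (ε : ℝ) (β : Fin n → SignType) : Prop :=
  β ≠ 0 ∧ ∃ c : Fin n → ℝ, (∀ i, β i ≠ 0 → 0 < c i) ∧ (∀ i, β i = 0 → c i = 0) ∧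
    ∀ k : Fin n, (k : ℕ) + d + 1 < n →
      ∑ i, c i * (galeEntry d n i k + if i = k then ε * (β i : ℝ) else 0) = 0

/-- The normal vectors of the inequalities of the deformed cube with signs `β`. -/
def cubeRow (ε : ℝ) (β : ℕ → SignType) (i k : ℕ) : ℝ :=
  (if i = 0 then 0 else galeRow i k) + if i = k then ε * (β i : ℝ) else 0

theorem galeRow_eq_zero {i k : ℕ} (hi : i ≠ 0) (hik : i ≤ k) : galeRow i k = 0 := by
  rw [galeRow, Nat.choose_eq_zero_of_lt (by omega), Nat.cast_zero, mul_zero]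

theorem galeEntry_eq {d n : ℕ} {i k : Fin n} (hk : (k : ℕ) + d + 1 < n) :
    galeEntry d n i k = if (i : ℕ) = 0 then 0 else galeRow i k := by
  by_cases hik : (k : ℕ) < i
  · rw [galeEntry, if_pos ⟨hk, hik⟩, if_neg (by omega), galeRow]
  · rw [galeEntry, if_neg fun h => hik h.2]
    split_ifs with h
    · rfl
    · rw [galeRow_eq_zero h (not_lt.1 hik)]

theorem isPerturbation_cubeRow (n m : ℕ) (β : ℕ → SignType) {ε δ : ℝ} (hε : 0 < ε) (hδ : ε < δ) :
    IsPerturbation n m β δ (cubeRow ε β) := by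
  refine ⟨fun i hi _ k _ => ?_, fun i k hik _ => ?_, fun i _ hβ => ?_⟩
  · have hi0 : i ≠ 0 := by omega
    rw [cubeRow, if_neg hi0, add_sub_cancel_left]
    split_ifs
    · have h1 : |(β i : ℝ)| ≤ 1 := by
        rcases β i with _ | _ | _ <;> simp
      rw [abs_mul, abs_of_pos hε]
      nlinarith
    · rw [abs_zero]
      linarith
  · rw [cubeRow, if_neg hik.ne, add_zero]
    split_ifs with h
    · rfl
    · exact galeRow_eq_zero h hik.le
  · have h1 : cubeRow ε β i i = ε * (β i : ℝ) := by
      rw [cubeRow, if_pos rfl]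
      split_ifs with h
      · rw [zero_add]
      · rw [galeRow_eq_zero h le_rfl, zero_add]
    rw [h1, sign_mul, sign_pos hε, one_mul]
    rcases β i with _ | _ | _ <;> simp

/-- A vector positive on all rows of the support rules out a positive dependency, since pairing with
it gives a positive number; when the rows positively span, `exists_pos_dependency` supplies one. -/
theorem isPreserved_iff_of_detects {d n : ℕ} {ε : ℝ} {β : Fin n → SignType}
    (h : Detects (n - d - 1) (IsGaleFace (n - d - 1) (extendSign β)) (extendSign β)
      (cubeRow ε (extendSign β))) :
    IsPreserved d n ε β ↔ IsGaleFace (n - d - 1) (extendSign β) := by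
  classical
  have hrow : ∀ i k : Fin n, (k : ℕ) + d + 1 < n →
      galeEntry d n i k + (if i = k then ε * (β i : ℝ) else 0) =
        cubeRow ε (extendSign β) i k := by
    intro i k hk
    rw [galeEntry_eq hk, cubeRow, extendSign_val]
    simp only [Fin.ext_iff]
  constructor
  · rintro ⟨hβ, c, hpos, hzero, hsum⟩
    by_contra hG
    obtain ⟨y, hy⟩ := h.2 hG
    obtain ⟨i, hi⟩ := Function.ne_iff.1 hβ
    have h1 : ∑ i : Fin n, c i * pairing (n - d - 1) (cubeRow ε (extendSign β) i) y = 0 := by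
      simp only [pairing, Finset.mul_sum]
      rw [Finset.sum_comm]
      refine Finset.sum_eq_zero fun k hk => ?_
      have hk := Finset.mem_range.1 hk
      have h2 := hsum ⟨k, by omega⟩ (by simp only; omega)
      rw [Finset.sum_congr rfl fun i _ => by
        rw [hrow i ⟨k, by omega⟩ (by simp only; omega)]] at h2
      rw [Finset.sum_congr rfl fun i _ => (mul_assoc _ _ _).symm, ← Finset.sum_mul, h2, zero_mul]
    have h2 : ∀ i ∈ Finset.univ, 0 ≤ c i * pairing (n - d - 1) (cubeRow ε (extendSign β) i) y := by
      intro i _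
      by_cases hi : β i = 0
      · rw [hzero i hi, zero_mul]
      · exact (mul_pos (hpos i hi) (hy i (by rwa [extendSign_val]))).le
    have h3 := (Finset.sum_eq_zero_iff_of_nonneg h2).1 h1 i (Finset.mem_univ i)
    exact (mul_pos (hpos i hi) (hy i (by rwa [extendSign_val]))).ne' h3
  · intro hG
    set I : Finset ℕ := (Finset.range n).filter fun i => extendSign β i ≠ 0 with hI
    have hmem : ∀ i, i ∈ I ↔ extendSign β i ≠ 0 := by
      intro i
      simp only [hI, Finset.mem_filter, Finset.mem_range, and_iff_right_iff_imp]
      exact fun h => not_le.1 fun h' => h (extendSign_of_le β h')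
    obtain ⟨c, hpos, hsum⟩ := exists_pos_dependency (I := I) fun y hy =>
      h.1 hG y fun i hi => hy i ((hmem i).2 hi)
    refine ⟨?_, fun i => if β i = 0 then 0 else c i, fun i hi => ?_, fun i hi => by simp [hi],
      fun k hk => ?_⟩
    · rintro rfl
      obtain ⟨i, hi⟩ := hG.exists_ne_zero
      refine hi ?_
      simp [extendSign]
    · simp only [if_neg hi]
      exact hpos i ((hmem i).2 (by rwa [extendSign_val]))
    · refine Eq.trans ?_ (hsum k (by omega))
      rw [Finset.sum_congr rfl fun i _ => by rw [hrow i k hk], hI, Finset.sum_filter,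
        Finset.sum_range]
      refine Finset.sum_congr rfl fun i _ => ?_
      rw [extendSign_val]
      by_cases hi : β i = 0 <;> simp [hi]

/-- For small `ε`, the preserved faces are given by the combinatorial description. -/
theorem eventually_isPreserved_iff (d n : ℕ) :
    ∀ᶠ ε : ℝ in 𝓝[>] 0, ∀ β : Fin n → SignType,
      IsPreserved d n ε β ↔ IsGaleFace (n - d - 1) (extendSign β) := by
  rw [eventually_all]
  intro β
  obtain ⟨δ, hδ, h⟩ := exists_delta_detects (n - d - 1) n (β := extendSign β)
    fun i hi => extendSign_of_le β hi
  filter_upwards [Ioo_mem_nhdsGT hδ] with ε hε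
  exact isPreserved_iff_of_detects (h _ (isPerturbation_cubeRow _ _ _ hε.1 hε.2))

/-! ## The face lattice of the projected deformed cube -/

/-- Triangular systems of equations have solutions. -/
theorem exists_fixedPoint_of_triangular {ι : Type*} [Finite ι] (r : ι → ℕ)
    (F : (ι → ℝ) → ι → ℝ) (hF : ∀ i x y, (∀ k, r k < r i → x k = y k) → F x i = F y i) :
    ∃ x, ∀ i, x i = F x i := by
  have h : ∀ s, ∃ x : ι → ℝ, ∀ i, r i < s → x i = F x i := by
    intro s
    induction s with
    | zero => exact ⟨0, fun i hi => absurd hi (Nat.not_lt_zero _)⟩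
    | succ s ih =>
      obtain ⟨x, hx⟩ := ih
      refine ⟨fun i => if r i < s then x i else F x i, fun i hi => ?_⟩
      have h1 : F (fun i => if r i < s then x i else F x i) i = F x i :=
        hF i _ _ fun k hk => if_pos (by omega)
      rw [h1]
      beta_reduce
      split_ifs with h
      · exact hx i h
      · rfl
  obtain ⟨s, hs⟩ := (Set.finite_range r).bddAbove
  obtain ⟨x, hx⟩ := h (s + 1)
  exact ⟨x, fun i => hx i (Nat.lt_succ_of_le (hs ⟨i, rfl⟩))⟩

theorem galeEntry_eq_zero {d n : ℕ} {i k : Fin n} (h : i ≤ k) : galeEntry d n i k = 0 :=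
  if_neg fun h' => absurd h'.2 (not_lt.2 h)

/-- By induction along the triangular system `|x i| ≤ (2 / ε) * K^i`. Once `K ≥ 4 * A / ε`, the
lower-order terms are at most `K^i / 2` and cannot use up the right-hand side. So opposite
inequalities are never tight together, as for the cube. -/
theorem exists_slack_bound (d n : ℕ) {ε : ℝ} (hε : 0 < ε) :
    ∀ᶠ K : ℝ in atTop, 1 ≤ K ∧ ∀ x : Fin n → ℝ,
      (∀ i, |ε * x i| ≤ |K ^ (i : ℕ) - ∑ k, galeEntry d n i k * x k|) →
      ∀ i : Fin n, 0 < K ^ (i : ℕ) - ∑ k, galeEntry d n i k * x k := by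
  set A : ℝ := ∑ i, ∑ k, |galeEntry d n i k| with hA
  have hA0 : 0 ≤ A := Finset.sum_nonneg fun _ _ => Finset.sum_nonneg fun _ _ => abs_nonneg _
  filter_upwards [eventually_ge_atTop 1, eventually_ge_atTop (4 * A / ε)] with K hK1 hK
  refine ⟨hK1, fun x hx => ?_⟩
  have hKA : 4 * A ≤ K * ε := (div_le_iff₀ hε).1 hK
  have hK0 : 0 < K := by linarith
  have key : ∀ i : Fin n, (∀ k < i, |x k| ≤ 2 / ε * K ^ (k : ℕ)) →
      |∑ k, galeEntry d n i k * x k| ≤ K ^ (i : ℕ) / 2 := by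
    intro i hi
    by_cases hi0 : (i : ℕ) = 0
    · rw [Finset.sum_eq_zero fun k _ => by
        rw [galeEntry_eq_zero (Fin.le_def.2 (by omega)), zero_mul], abs_zero]
      positivity
    obtain ⟨j, hj⟩ : ∃ j, (i : ℕ) = j + 1 := ⟨(i : ℕ) - 1, by omega⟩
    have h1 : |∑ k, galeEntry d n i k * x k| ≤ ∑ k, |galeEntry d n i k| * (2 / ε * K ^ j) := by
      refine (Finset.abs_sum_le_sum_abs _ _).trans (Finset.sum_le_sum fun k _ => ?_)
      rw [abs_mul]
      rcases lt_or_ge k i with hk | hk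
      · refine mul_le_mul_of_nonneg_left ((hi k hk).trans ?_) (abs_nonneg _)
        refine mul_le_mul_of_nonneg_left (pow_le_pow_right₀ hK1 ?_) (by positivity)
        have := Fin.lt_def.1 hk
        omega
      · rw [galeEntry_eq_zero hk, abs_zero, zero_mul, zero_mul]
    have h2 : ∑ k, |galeEntry d n i k| ≤ A :=
      Finset.single_le_sum (f := fun i => ∑ k, |galeEntry d n i k|)
        (fun _ _ => Finset.sum_nonneg fun _ _ => abs_nonneg _) (Finset.mem_univ i)
    rw [← Finset.sum_mul] at h1
    have h3 : A * (2 / ε * K ^ j) ≤ K ^ (i : ℕ) / 2 := by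
      rw [hj, pow_succ, show A * (2 / ε * K ^ j) = (4 * A) * K ^ j / (2 * ε) by field_simp; ring,
        div_le_iff₀ (by positivity)]
      have := mul_le_mul_of_nonneg_right hKA (by positivity : 0 ≤ K ^ j)
      linarith
    exact h1.trans ((mul_le_mul_of_nonneg_right h2 (by positivity)).trans h3)
  have hbound : ∀ s : ℕ, ∀ i : Fin n, (i : ℕ) < s → |x i| ≤ 2 / ε * K ^ (i : ℕ) := by
    intro s
    induction s with
    | zero => exact fun i hi => absurd hi (Nat.not_lt_zero _)
    | succ s ih =>
      intro i hi
      have h1 := key i fun k hk => ih k (by have := Fin.lt_def.1 hk; omega)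
      have h2 := hx i
      have h3 : |K ^ (i : ℕ) - ∑ k, galeEntry d n i k * x k| ≤ 2 * K ^ (i : ℕ) := by
        have h4 := abs_sub (K ^ (i : ℕ)) (∑ k, galeEntry d n i k * x k)
        have h5 : 0 < K ^ (i : ℕ) := by positivity
        rw [abs_of_pos h5] at h4
        linarith
      rw [abs_mul, abs_of_pos hε] at h2
      rw [div_mul_eq_mul_div, le_div_iff₀ hε]
      linarith
  intro i
  have h1 := key i fun k _ => hbound _ k (Nat.lt_succ_self _)
  have h2 : 0 < K ^ (i : ℕ) := by positivity
  have := (abs_le.1 h1).2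
  linarith

/-- The point of the deformed cube lying in the face `β` and on no other facets. -/
theorem exists_mem_deformedCube (d n : ℕ) {ε : ℝ} (hε : 0 < ε) :
    ∀ᶠ K : ℝ in atTop, ∀ β : Fin n → SignType, ∃ x ∈ deformedCube d n ε K,
      ∀ i, ∀ s : SignType, s ≠ 0 → (cubeForm d n ε i s x = K ^ (i : ℕ) ↔ β i = s) := by
  filter_upwards [exists_slack_bound d n hε] with K hK β
  obtain ⟨hK1, hK⟩ := hK
  -- Solve `ε * x i = β i * slack i`, where the slack involves only earlier coordinates. The form
  -- with sign `s` then falls short of `K^i` by `(1 - s * β i) * slack i`.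
  obtain ⟨x, hx⟩ := exists_fixedPoint_of_triangular (ι := Fin n) (fun i => i)
    (fun x i => (β i : ℝ) * (K ^ (i : ℕ) - ∑ k, galeEntry d n i k * x k) / ε) (by
      intro i x y hxy
      have : ∑ k, galeEntry d n i k * x k = ∑ k, galeEntry d n i k * y k := by
        refine Finset.sum_congr rfl fun k _ => ?_
        rcases lt_or_ge k i with hk | hk
        · rw [hxy k hk]
        · rw [galeEntry_eq_zero hk, zero_mul, zero_mul]
      simp only [this])
  have hx' : ∀ i, ε * x i = (β i : ℝ) * (K ^ (i : ℕ) - ∑ k, galeEntry d n i k * x k) := by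
    intro i
    have h := hx i
    rw [eq_div_iff hε.ne'] at h
    linarith
  have hpos := hK x fun i => by
    rw [hx', abs_mul]
    refine mul_le_of_le_one_left (abs_nonneg _) ?_
    rcases β i with _ | _ | _ <;> simp
  have hform : ∀ i s, cubeForm d n ε i s x =
      K ^ (i : ℕ) - (1 - s * β i) * (K ^ (i : ℕ) - ∑ k, galeEntry d n i k * x k) := by
    intro i s
    rw [cubeForm, mul_assoc, hx']
    ring
  refine ⟨x, fun i => ⟨?_, ?_⟩, fun i s hs => ?_⟩
  · rw [hform, sub_le_self_iff]
    refine mul_nonneg ?_ (hpos i).le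
    rcases β i with _ | _ | _ <;> norm_num
  · rw [hform, sub_le_self_iff]
    refine mul_nonneg ?_ (hpos i).le
    rcases β i with _ | _ | _ <;> norm_num
  · rw [hform, sub_eq_self, mul_eq_zero, or_iff_left (hpos i).ne']
    revert hs
    generalize β i = b
    revert s b
    intro s b
    rcases s with _ | _ | _ <;> rcases b with _ | _ | _ <;> (norm_num; try decide)

/-- The normal fan is complete: each functional `c` is a nonnegative combination, with weights `|μ
j|`, of the normals with signs `sign (μ j)`. The system is solved from the last coordinate
backwards, since `galeEntry d n j i` vanishes unless `i < j`. -/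
theorem exists_decomposition (d n : ℕ) {ε : ℝ} (hε : 0 < ε) (c : Fin n → ℝ) :
    ∃ μ : Fin n → ℝ, ∀ i, c i = ε * μ i + ∑ j, |μ j| * galeEntry d n j i := by
  obtain ⟨μ, hμ⟩ := exists_fixedPoint_of_triangular (ι := Fin n) (fun i => n - i)
    (fun μ i => (c i - ∑ j, |μ j| * galeEntry d n j i) / ε) (by
      intro i x y hxy
      have : ∑ j, |x j| * galeEntry d n j i = ∑ j, |y j| * galeEntry d n j i := by
        refine Finset.sum_congr rfl fun k _ => ?_
        rcases lt_or_ge i k with hk | hk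
        · rw [hxy k (by have := Fin.lt_def.1 hk; omega)]
        · rw [galeEntry_eq_zero hk, mul_zero, mul_zero]
      simp only [this])
  refine ⟨μ, fun i => ?_⟩
  have h := hμ i
  rw [eq_div_iff hε.ne'] at h
  linarith

theorem sum_mul_cubeForm {d n : ℕ} {ε : ℝ} (a : Fin n → ℝ) (β : Fin n → SignType)
    (x : Fin n → ℝ) :
    ∑ j, a j * cubeForm d n ε j (β j) x =
      ∑ i, (∑ j, a j * (galeEntry d n j i + if j = i then ε * (β j : ℝ) else 0)) * x i := by
  have h : ∀ j, cubeForm d n ε j (β j) x =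
      ∑ i, (galeEntry d n j i + if j = i then ε * (β j : ℝ) else 0) * x i := by
    intro j
    simp only [cubeForm, add_mul, Finset.sum_add_distrib, ite_mul, zero_mul, Finset.sum_ite_eq,
      Finset.mem_univ, if_true]
    ring
  simp only [h, Finset.mul_sum, Finset.sum_mul]
  rw [Finset.sum_comm]
  exact Finset.sum_congr rfl fun i _ => Finset.sum_congr rfl fun j _ => by ring

theorem cubeForm_le {d n : ℕ} {ε K : ℝ} {x : Fin n → ℝ} (hx : x ∈ deformedCube d n ε K) {i : Fin n}
    {s : SignType} (hs : s ≠ 0) : cubeForm d n ε i s x ≤ K ^ (i : ℕ) := by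
  by_cases h : s = 1
  · exact h ▸ (hx i).1
  · exact SignType.eq_neg_one_of hs h ▸ (hx i).2

/-- A nonnegative combination of the facet normals is maximized exactly on the face whose signs are
the support of the combination. -/
theorem sum_mul_cubeForm_le {d n : ℕ} {ε K : ℝ} {β : Fin n → SignType} {a : Fin n → ℝ}
    (hpos : ∀ i, β i ≠ 0 → 0 < a i) (hzero : ∀ i, β i = 0 → a i = 0) {x : Fin n → ℝ}
    (hx : x ∈ deformedCube d n ε K) :
    ∑ j, a j * cubeForm d n ε j (β j) x ≤ ∑ j, a j * K ^ (j : ℕ) ∧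
      (∑ j, a j * cubeForm d n ε j (β j) x = ∑ j, a j * K ^ (j : ℕ) ↔
        x ∈ deformedCubeFace d n ε K β) := by
  have hle : ∀ j ∈ Finset.univ, a j * cubeForm d n ε j (β j) x ≤ a j * K ^ (j : ℕ) := by
    intro j _
    by_cases hj : β j = 0
    · rw [hzero j hj, zero_mul, zero_mul]
    · exact mul_le_mul_of_nonneg_left (cubeForm_le hx hj) (hpos j hj).le
  refine ⟨Finset.sum_le_sum hle, ?_⟩
  rw [Finset.sum_eq_sum_iff_of_le hle]
  constructor
  · refine fun h => ⟨hx, fun i hi => ?_⟩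
    exact mul_left_cancel₀ (hpos i hi).ne' (h i (Finset.mem_univ i))
  · intro h i _
    by_cases hi : β i = 0
    · rw [hzero i hi, zero_mul, zero_mul]
    · rw [h.2 i hi]

theorem sum_mul_lastCoords {d n : ℕ} (h : d < n) (c x : Fin n → ℝ)
    (hc : ∀ i : Fin n, (i : ℕ) + d + 1 < n → c i = 0) :
    ∑ j, lastCoords h c j * lastCoords h x j = ∑ i, c i * x i := by
  set e : Fin (d + 1) ↪ Fin n := ⟨fun j => ⟨n - (d + 1) + j, by omega⟩, fun i j hij => by
    simpa [Fin.ext_iff] using hij⟩ with he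
  have h1 : ∑ j, lastCoords h c j * lastCoords h x j = ∑ i ∈ Finset.univ.map e, c i * x i := by
    rw [Finset.sum_map]
    rfl
  rw [h1]
  refine Finset.sum_subset (Finset.subset_univ _) fun i _ hi => ?_
  rw [hc i, zero_mul]
  by_contra hcon
  refine hi (Finset.mem_map.2 ⟨⟨i - (n - (d + 1)), by omega⟩, Finset.mem_univ _, ?_⟩)
  apply Fin.ext
  change n - (d + 1) + (i - (n - (d + 1))) = (i : ℕ)
  omega

/-- For large `K` the faces of the projected deformed cube are given by the preserved faces. -/
theorem eventually_boundaryFaces_ncp {d n : ℕ} (hn : d < n) {ε : ℝ} (hε : 0 < ε) :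
    ∀ᶠ K : ℝ in atTop,
      (∀ β, IsPreserved d n ε β → ncpFace hn ε K β ∈ boundaryFaces (ncp hn ε K)) ∧
      (∀ F ∈ boundaryFaces (ncp hn ε K), ∃ β, IsPreserved d n ε β ∧ ncpFace hn ε K β = F) ∧
      ∀ β γ, IsPreserved d n ε γ → (ncpFace hn ε K β ⊆ ncpFace hn ε K γ ↔ FaceLE β γ) := by
  filter_upwards [exists_mem_deformedCube d n hε] with K hK
  -- A point lying on exactly the facets prescribed by `β`; it tests inclusions of faces.
  have hface : ∀ β, ∃ x ∈ deformedCubeFace d n ε K β,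
      ∀ γ, x ∈ deformedCubeFace d n ε K γ ↔ FaceLE β γ := by
    intro β
    obtain ⟨x, hx, hxβ⟩ := hK β
    have h : ∀ γ, x ∈ deformedCubeFace d n ε K γ ↔ FaceLE β γ := by
      intro γ
      constructor
      · intro h i
        by_cases hi : γ i = 0
        · exact Or.inl hi
        · exact Or.inr ((hxβ i _ hi).1 (h.2 i hi))
      · intro h
        exact ⟨hx, fun i hi => (hxβ i _ hi).2 ((h i).resolve_left hi)⟩
    exact ⟨x, (h β).2 fun i => Or.inr rfl, h⟩
  -- The dependency makes the combined normal vanish on the eliminated coordinates, so it descends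
  -- to a functional on the projection.
  have hpres : ∀ β, IsPreserved d n ε β → ∃ (l : Fin (d + 1) → ℝ) (M : ℝ),
      ∀ x ∈ deformedCube d n ε K, ∑ j, l j * lastCoords hn x j ≤ M ∧
        (∑ j, l j * lastCoords hn x j = M ↔ x ∈ deformedCubeFace d n ε K β) := by
    rintro β ⟨hβ, a, hpos, hzero, hsum⟩
    set c : Fin n → ℝ := fun i =>
      ∑ j, a j * (galeEntry d n j i + if j = i then ε * (β j : ℝ) else 0) with hc
    refine ⟨lastCoords hn c, ∑ j, a j * K ^ (j : ℕ), fun x hx => ?_⟩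
    rw [sum_mul_lastCoords hn c x hsum, hc, ← sum_mul_cubeForm]
    exact sum_mul_cubeForm_le hpos hzero hx
  have hmem : ∀ β, IsPreserved d n ε β → ∀ x ∈ deformedCube d n ε K,
      (lastCoords hn x ∈ ncpFace hn ε K β ↔ x ∈ deformedCubeFace d n ε K β) := by
    intro β hβ x hx
    obtain ⟨l, M, hl⟩ := hpres β hβ
    refine ⟨?_, fun h => ⟨x, h, rfl⟩⟩
    rintro ⟨z, hz, hzx⟩
    rw [← (hl x hx).2, ← hzx]
    exact (hl z hz.1).2.2 hz
  refine ⟨fun β hβ => ⟨fun _ => ?_, ?_, ?_⟩, fun F hF => ?_, fun β γ hγ => ?_⟩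
  · obtain ⟨l, M, hl⟩ := hpres β hβ
    refine ⟨LinearMap.toContinuousLinearMap (∑ j, l j • LinearMap.proj j), ?_⟩
    have hlin : ∀ y, LinearMap.toContinuousLinearMap
        (∑ j, l j • LinearMap.proj (R := ℝ) (φ := fun _ : Fin (d + 1) => ℝ) j) y =
          ∑ j, l j * y j := by
      intro y
      simp
    ext y
    simp only [Set.mem_ofPred_eq, hlin]
    constructor
    · rintro ⟨x, hx, rfl⟩
      refine ⟨⟨x, hx.1, rfl⟩, ?_⟩
      rintro _ ⟨z, hz, rfl⟩
      rw [(hl x hx.1).2.2 hx]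
      exact (hl z hz).1
    · rintro ⟨⟨x, hx, rfl⟩, hmax⟩
      obtain ⟨z, hz, -⟩ := hface β
      have h1 := hmax _ ⟨z, hz.1, rfl⟩
      rw [(hl z hz.1).2.2 hz] at h1
      exact ⟨x, (hl x hx).2.1 (le_antisymm (hl x hx).1 h1), rfl⟩
  · obtain ⟨x, hx, -⟩ := hface β
    exact ⟨_, x, hx, rfl⟩
  · intro heq
    obtain ⟨x, hx, hx'⟩ := hface 0
    have h1 : lastCoords hn x ∈ ncpFace hn ε K β := by
      rw [heq]
      exact ⟨x, hx.1, rfl⟩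
    have h2 := (hx' β).1 ((hmem β hβ x hx.1).1 h1)
    refine hβ.1 (funext fun i => ?_)
    rcases h2 i with h | h
    · exact h
    · exact h.symm
  · obtain ⟨hexp, hne, hproper⟩ := hF
    obtain ⟨l, hl⟩ := hexp hne
    set c : Fin n → ℝ := fun i =>
      if h : (i : ℕ) + d + 1 < n then 0 else l (Pi.single ⟨i - (n - (d + 1)), by omega⟩ 1) with hc
    have hlc : ∀ x, l (lastCoords hn x) = ∑ i, c i * x i := by
      intro x
      have h0 : ∀ y, l y = ∑ j, lastCoords hn c j * y j := by
        intro y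
        have h1 := LinearMap.pi_apply_eq_sum_univ (l : (Fin (d + 1) → ℝ) →ₗ[ℝ] ℝ) y
        rw [ContinuousLinearMap.coe_coe] at h1
        rw [h1]
        refine Finset.sum_congr rfl fun j _ => ?_
        have h2 : ¬ (n - (d + 1) + (j : ℕ) + d + 1 < n) := by omega
        rw [smul_eq_mul, mul_comm]
        congr 1
        simp only [lastCoords, hc, dif_neg h2]
        congr 1
        ext k
        simp only [Pi.single_apply, Fin.ext_iff]
        congr 1
        rw [eq_iff_iff]
        omega
      rw [h0, sum_mul_lastCoords hn c x]
      intro i hi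
      simp only [hc, dif_pos hi]
    -- Conversely, the exposing functional pulled back to the cube lies in the normal cone of a face
    -- `β`. Its vanishing on the eliminated coordinates is the dependency for `β`.
    obtain ⟨μ, hμ⟩ := exists_decomposition d n hε c
    set β : Fin n → SignType := fun i => SignType.sign (μ i) with hβ
    have hcβ : ∀ i, c i =
        ∑ j, |μ j| * (galeEntry d n j i + if j = i then ε * (β j : ℝ) else 0) := by
      intro i
      simp only [mul_add, Finset.sum_add_distrib, mul_ite, mul_zero, Finset.sum_ite_eq',
        Finset.mem_univ, if_true]
      rw [hμ i, mul_left_comm, hβ, abs_mul_sign]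
      ring
    have hpos : ∀ i, β i ≠ 0 → 0 < |μ i| := by
      intro i hi
      exact abs_pos.2 fun h => hi (by rw [hβ]; simp only [h, sign_zero])
    have hzero : ∀ i, β i = 0 → |μ i| = 0 := by
      intro i hi
      rw [abs_eq_zero]
      exact sign_eq_zero_iff.1 hi
    have hlβ : ∀ x, l (lastCoords hn x) = ∑ j, |μ j| * cubeForm d n ε j (β j) x := by
      intro x
      rw [hlc, sum_mul_cubeForm]
      exact Finset.sum_congr rfl fun i _ => by rw [hcβ]
    have hF : ncpFace hn ε K β = F := by
      rw [hl]
      ext y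
      constructor
      · rintro ⟨x, hx, rfl⟩
        refine ⟨⟨x, hx.1, rfl⟩, ?_⟩
        rintro _ ⟨z, hz, rfl⟩
        rw [hlβ, hlβ, (sum_mul_cubeForm_le hpos hzero hx.1).2.2 hx]
        exact (sum_mul_cubeForm_le hpos hzero hz).1
      · rintro ⟨⟨x, hx, rfl⟩, hmax⟩
        obtain ⟨z, hz, -⟩ := hface β
        have h1 := hmax _ ⟨z, hz.1, rfl⟩
        rw [hlβ, hlβ, (sum_mul_cubeForm_le hpos hzero hz.1).2.2 hz] at h1
        have h2 := sum_mul_cubeForm_le hpos hzero hx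
        exact ⟨x, h2.2.1 (le_antisymm h2.1 h1), rfl⟩
    refine ⟨β, ⟨fun h0 => hproper ?_, fun i => |μ i|, hpos, hzero, fun k hk => ?_⟩, hF⟩
    · rw [← hF, h0]
      refine congrArg _ (Set.ext fun x => ?_)
      exact ⟨fun h => h.1, fun h => ⟨h, fun i hi => absurd rfl hi⟩⟩
    · rw [← hcβ]
      simp only [hc, dif_pos hk]
  · constructor
    · intro hsub
      obtain ⟨x, hx, hx'⟩ := hface β
      exact (hx' γ).1 ((hmem γ hγ x hx.1).1 (hsub ⟨x, hx, rfl⟩))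
    · rintro hle _ ⟨x, hx, rfl⟩
      refine ⟨x, ⟨hx.1, fun i hi => ?_⟩, rfl⟩
      have := (hle i).resolve_left hi
      rw [← this]
      exact hx.2 i (by rwa [this])

/-! ## Alternating sets -/

/-- The chain runs through all of `T`, so along it position and rank change parity together.
`hasAlt_of_even` is the converse. -/
theorem AltFrom.even_of_card {T : Finset ℕ} {m i : ℕ} (h : AltFrom (T : Set ℕ) m i)
    (hT : T.card = m + 1) : ∀ p ∈ T, Even (p + i + (T.filter (· < p)).card) := by
  induction m generalizing T i with
  | zero =>
    intro p hp
    have h1 := h.le_of_card hT.le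
    obtain ⟨a, rfl⟩ := Finset.card_eq_one.1 hT
    have hi : i ∈ ({a} : Finset ℕ) := by simpa using h.mem
    rw [Finset.mem_singleton] at hi hp
    subst hi hp
    simp [Finset.filter_singleton]
  | succ m ih =>
    intro p hp
    have hle := h.le_of_card hT.le
    obtain ⟨hi, j, hij, hodd, hj⟩ := h
    have hi : i ∈ T := by simpa using hi
    have hj' : AltFrom ((T.erase i : Finset ℕ) : Set ℕ) m j := hj.mono fun k hk hjk => by
      simp only [Finset.coe_erase, Set.mem_sdiff, Set.mem_singleton_iff]
      exact ⟨hk, by omega⟩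
    rcases eq_or_ne p i with rfl | hpi
    · have : T.filter (· < p) = ∅ := Finset.filter_eq_empty_iff.2 fun k hk => not_lt.2 (hle k hk)
      rw [this, Finset.card_empty]
      exact ⟨p, by omega⟩
    · have h1 := ih hj' (by rw [Finset.card_erase_of_mem hi]; omega) p (Finset.mem_erase.2 ⟨hpi, hp⟩)
      have h2 : (T.filter (· < p)) = insert i ((T.erase i).filter (· < p)) := by
        ext k
        simp only [Finset.mem_filter, Finset.mem_insert, Finset.mem_erase]
        have := hle p hp
        constructor
        · rintro ⟨hk, hkp⟩
          by_cases hki : k = i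
          · exact Or.inl hki
          · exact Or.inr ⟨⟨hki, hk⟩, hkp⟩
        · rintro (rfl | ⟨⟨_, hk⟩, hkp⟩)
          · exact ⟨hi, by omega⟩
          · exact ⟨hk, hkp⟩
      rw [h2, Finset.card_insert_of_notMem (by simp)]
      grind

theorem hasAlt_of_even {T : Finset ℕ} {m c : ℕ} (hT : T.card = m + 1)
    (h : ∀ p ∈ T, Even (p + c + (T.filter (· < p)).card)) : HasAlt m (T : Set ℕ) := by
  induction m generalizing T c with
  | zero =>
    obtain ⟨a, rfl⟩ := Finset.card_eq_one.1 hT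
    exact ⟨a, by simp [AltFrom]⟩
  | succ m ih =>
    have hne : T.Nonempty := Finset.card_pos.1 (by omega)
    set i := T.min' hne with hi
    have hiT : i ∈ T := T.min'_mem hne
    have hle : ∀ k ∈ T, i ≤ k := fun k hk => T.min'_le k hk
    have hcount : ∀ p ∈ T.erase i,
        (T.filter (· < p)).card = ((T.erase i).filter (· < p)).card + 1 := by
      intro p hp
      have h2 : (T.filter (· < p)) = insert i ((T.erase i).filter (· < p)) := by
        ext k
        simp only [Finset.mem_filter, Finset.mem_insert, Finset.mem_erase]
        have := hle p (Finset.mem_of_mem_erase hp)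
        have := Finset.ne_of_mem_erase hp
        constructor
        · rintro ⟨hk, hkp⟩
          by_cases hki : k = i
          · exact Or.inl hki
          · exact Or.inr ⟨⟨hki, hk⟩, hkp⟩
        · rintro (rfl | ⟨⟨_, hk⟩, hkp⟩)
          · exact ⟨hiT, by omega⟩
          · exact ⟨hk, hkp⟩
      rw [h2, Finset.card_insert_of_notMem (by simp)]
    have hcard : (T.erase i).card = m + 1 := by
      rw [Finset.card_erase_of_mem hiT]
      omega
    obtain ⟨j, hj⟩ := ih (T := T.erase i) (c := c + 1) hcard fun p hp => by
      have := h p (Finset.mem_of_mem_erase hp)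
      rw [hcount p hp] at this
      grind
    have hjT : j ∈ T.erase i := Finset.mem_coe.1 hj.mem
    have hjmin := hj.le_of_card hcard.le
    have h1 := h i hiT
    have h2 := h j (Finset.mem_of_mem_erase hjT)
    rw [hcount j hjT] at h2
    have h3 : (T.erase i).filter (· < j) = ∅ :=
      Finset.filter_eq_empty_iff.2 fun k hk => not_lt.2 (hjmin k hk)
    have h4 : T.filter (· < i) = ∅ :=
      Finset.filter_eq_empty_iff.2 fun k hk => not_lt.2 (hle k hk)
    rw [h3, Finset.card_empty] at h2
    rw [h4, Finset.card_empty] at h1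
    refine ⟨i, by simpa using hiT, j, ?_, ?_, hj.mono fun k hk _ => by
      simp only [Finset.coe_erase, Set.mem_sdiff] at hk
      exact hk.1⟩
    · have := hle j (Finset.mem_of_mem_erase hjT)
      have := Finset.ne_of_mem_erase hjT
      omega
    · grind

/-! ## Faces of cyclic polytopes -/

/-- The positions, counted from the end, of the last vertex and of the vertices not
in `S`. -/
def coPositions {k : ℕ} (S : Finset (Fin k)) : Set ℕ :=
  {p | 1 ≤ p ∧ p ≤ k ∧ ∀ j : Fin k, (j : ℕ) + p = k → j ∈ S → p = 1}

open Polynomial in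
-- Without a chain there is `q` of degree less than `k - d` with alternating signs on the positions.
-- Then `g`, reflected, times `q` has degree less than `k - 1`, so its difference of order `k - 1`
-- vanishes; but all terms of that difference have one sign, and the term of the last vertex is
-- nonzero.
theorem hasAlt_of_polynomial {d k : ℕ} {S : Finset (Fin k)} {g : ℝ[X]}
    (hk : 1 ≤ k) (hg : g.natDegree + 1 ≤ d) (hnonneg : ∀ j : Fin k, 0 ≤ g.eval ((j : ℝ) + 1))
    (hzero : ∀ j ∈ S, (j : ℕ) + 1 ≠ k → g.eval ((j : ℝ) + 1) = 0)
    (hlast : 0 < g.eval (k : ℝ)) : HasAlt (k - d) (coPositions S) := by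
  classical
  set W : Finset ℕ := (Finset.Icc 1 k).filter fun p => p ∈ coPositions S with hW
  have hWS : (W : Set ℕ) = coPositions S := by
    ext p
    simp only [hW, Finset.coe_filter, Finset.mem_Icc, Set.mem_ofPred_eq, and_iff_right_iff_imp]
    exact fun h => ⟨h.1, h.2.1⟩
  rw [← hWS]
  by_contra hcon
  obtain ⟨q, hq, hqW, -⟩ := exists_polynomial_of_not_hasAlt hcon (x := fun p => (p : ℝ))
    Nat.strictMono_cast
  have h1W : 1 ∈ W := by
    rw [← Finset.mem_coe, hWS]
    exact ⟨le_rfl, hk, fun _ _ _ => rfl⟩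
  have hq1 := hqW 1 h1W
  have hq0 : q ≠ 0 := by
    rintro rfl
    simp at hq1
  have hqdeg : q.natDegree < k - d := by
    rw [degree_eq_natDegree hq0] at hq
    exact_mod_cast hq
  set f : ℝ[X] := g.comp (C ((k : ℝ) + 1) - X) * q with hf
  have hlin : (C ((k : ℝ) + 1) - X).natDegree ≤ 1 :=
    (natDegree_sub_le _ _).trans (max_le ((natDegree_C _).le.trans zero_le_one) natDegree_X_le)
  have hfdeg : f.natDegree < k - 1 := by
    have h1 := natDegree_mul_le (p := g.comp (C ((k : ℝ) + 1) - X)) (q := q)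
    have h2 := natDegree_comp_le (p := g) (q := C ((k : ℝ) + 1) - X)
    have h3 : g.natDegree * (C ((k : ℝ) + 1) - X).natDegree ≤ g.natDegree :=
      (Nat.mul_le_mul_left _ hlin).trans (by omega)
    rw [hf]
    omega
  have hdiff := congrFun (Polynomial.fwdDiff_iter_eq_zero_of_degree_lt hfdeg) 1
  rw [fwdDiff_iter_eq_sum_shift, show k - 1 + 1 = k by omega, Pi.zero_apply] at hdiff
  have hterm : ∀ j ∈ Finset.range k, 0 ≤ (-1 : ℝ) ^ k *
      (((-1 : ℤ) ^ (k - 1 - j) * ((k - 1).choose j : ℤ)) • f.eval (1 + j • (1 : ℝ))) ∧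
      (j = 0 → 0 < (-1 : ℝ) ^ k *
      (((-1 : ℤ) ^ (k - 1 - j) * ((k - 1).choose j : ℤ)) • f.eval (1 + j • (1 : ℝ)))) := by
    intro j hj
    have hj := Finset.mem_range.1 hj
    have hsign : (-1 : ℝ) ^ k * (-1) ^ (k - 1 - j) = (-1) ^ (j + 1) := by
      rw [← pow_add, show k + (k - 1 - j) = (j + 1) + 2 * (k - 1 - j) by omega, pow_add, pow_mul]
      simp
    have hval : (-1 : ℝ) ^ k *
        (((-1 : ℤ) ^ (k - 1 - j) * ((k - 1).choose j : ℤ)) • f.eval (1 + j • (1 : ℝ))) =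
        ((k - 1).choose j : ℝ) * (g.eval (((k - 1 - j : ℕ) : ℝ) + 1) *
          ((-1) ^ (j + 1) * q.eval ((j + 1 : ℕ) : ℝ))) := by
      have hk' : ((k - 1 - j : ℕ) : ℝ) + 1 = k + 1 - (j + 1) := by
        have : ((k - 1 - j : ℕ) : ℝ) + 1 + j = k := by
          exact_mod_cast (show k - 1 - j + 1 + j = k by omega)
        linarith
      rw [← hsign, hk', hf, zsmul_eq_mul]
      simp only [eval_mul, eval_comp, eval_sub, eval_C, eval_X, nsmul_eq_mul, mul_one]
      push_cast
      rw [add_comm (1 : ℝ) (j : ℝ)]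
      ring
    rw [hval]
    have hgnn := hnonneg ⟨k - 1 - j, by omega⟩
    simp only at hgnn
    constructor
    · refine mul_nonneg (Nat.cast_nonneg _) ?_
      by_cases hjW : j + 1 ∈ W
      · exact mul_nonneg hgnn (hqW _ hjW).le
      · have hnot : j + 1 ∉ coPositions S := by
          rwa [← hWS, Finset.mem_coe]
        have : ∃ i : Fin k, (i : ℕ) + (j + 1) = k ∧ i ∈ S ∧ j + 1 ≠ 1 := by
          by_contra hne
          push Not at hne
          exact hnot ⟨by omega, by omega, hne⟩
        obtain ⟨i, hi, hiS, hj1⟩ := this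
        have := hzero i hiS (by omega)
        rw [show k - 1 - j = (i : ℕ) by omega, this, zero_mul]
    · rintro rfl
      rw [Nat.choose_zero_right, Nat.cast_one, one_mul]
      refine mul_pos ?_ (by simpa using hq1)
      have : ((k - 1 - 0 : ℕ) : ℝ) + 1 = k := by
        exact_mod_cast (show k - 1 - 0 + 1 = k by omega)
      rwa [this]
  have hpos : 0 < ∑ j ∈ Finset.range k, (-1 : ℝ) ^ k *
      (((-1 : ℤ) ^ (k - 1 - j) * ((k - 1).choose j : ℤ)) • f.eval (1 + j • (1 : ℝ))) :=
    Finset.sum_pos' (fun j hj => (hterm j hj).1)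
      ⟨0, Finset.mem_range.2 hk, (hterm 0 (Finset.mem_range.2 hk)).2 rfl⟩
  rw [← Finset.mul_sum, hdiff, mul_zero] at hpos
  exact lt_irrefl _ hpos

open Polynomial in
-- `g` has simple roots at the `d - 1` vertices complementary to a chain `T` through position `1`.
-- By the parity rule for `T`, an even number of these roots lies beyond each vertex of `T`, so `g`
-- is positive there.
theorem exists_polynomial_of_hasAlt {d k : ℕ} {S : Finset (Fin k)} (hk : 1 ≤ k) (hdk : d ≤ k)
    (hd : 1 ≤ d) (h : HasAlt (k - d) (coPositions S)) :
    ∃ (Z : Finset ℕ) (g : ℝ[X]), Z.card = d - 1 ∧ (∀ z ∈ Z, 2 ≤ z ∧ z ≤ k) ∧ g.natDegree = d - 1 ∧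
      (∀ j : Fin k, 0 ≤ g.eval ((j : ℝ) + 1)) ∧
      (∀ j : Fin k, k - j ∈ Z → g.eval ((j : ℝ) + 1) = 0) ∧
      (∀ j ∈ S, (j : ℕ) + 1 ≠ k → k - j ∈ Z) ∧ 0 < g.eval (k : ℝ) := by
  classical
  obtain ⟨i, hi⟩ := h
  have h1 : (1 : ℕ) ∈ coPositions S := ⟨le_rfl, hk, fun _ _ _ => rfl⟩
  obtain ⟨T, hT, hTW, hTA⟩ := (hi.restart h1 hi.mem.1).exists_finset
  have heven := hTA.even_of_card hT
  have h1T : 1 ∈ T := by simpa using hTA.mem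
  have hTsub : T ⊆ Finset.Icc 1 k := fun t ht =>
    Finset.mem_Icc.2 ⟨(hTW t ht).1.1, (hTW t ht).1.2.1⟩
  set Z : Finset ℕ := Finset.Icc 1 k \ T with hZ
  have hZcard : Z.card = d - 1 := by
    rw [hZ, Finset.card_sdiff_of_subset hTsub, Nat.card_Icc, hT]
    omega
  have heval : ∀ x : ℝ, (∏ z ∈ Z, (X - C ((k : ℝ) + 1 - z))).eval x =
      ∏ z ∈ Z, (x - (k + 1 - z)) := by
    intro x
    simp [eval_prod]
  have hzero : ∀ j : Fin k, k - j ∈ Z →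
      (∏ z ∈ Z, (X - C ((k : ℝ) + 1 - z))).eval ((j : ℝ) + 1) = 0 := by
    intro j hj
    rw [heval]
    refine Finset.prod_eq_zero hj ?_
    rw [Nat.cast_sub j.2.le]
    ring
  have hpos : ∀ j : Fin k, k - j ∈ T →
      0 < (∏ z ∈ Z, (X - C ((k : ℝ) + 1 - z))).eval ((j : ℝ) + 1) := by
    intro j hj
    rw [heval]
    set p := k - (j : ℕ) with hp
    have hpk : ((j : ℝ)) = k - p := by
      rw [hp, Nat.cast_sub j.2.le]
      ring
    rw [hpk, ← Finset.prod_filter_mul_prod_filter_not Z (· < p)]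
    refine mul_pos ?_ (Finset.prod_pos fun z hz => ?_)
    · have hcard : Even (Z.filter (· < p)).card := by
        have h2 : (Z.filter (· < p)).card + (T.filter (· < p)).card + 1 = p := by
          have h3 : (Finset.Icc 1 k).filter (· < p) = Finset.Ico 1 p := by
            ext t
            simp only [Finset.mem_filter, Finset.mem_Icc, Finset.mem_Ico]
            omega
          have h4 : (Z.filter (· < p)).card + (T.filter (· < p)).card =
              ((Finset.Icc 1 k).filter (· < p)).card := by
            rw [← Finset.card_union_of_disjoint, ← Finset.filter_union, hZ,
              Finset.sdiff_union_of_subset hTsub]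
            exact Finset.disjoint_filter_filter Finset.sdiff_disjoint
          rw [h3, Nat.card_Ico] at h4
          have := (Finset.mem_Icc.1 (hTsub hj)).1
          omega
        have h5 := heven p hj
        grind
      rw [show ∏ z ∈ Z.filter (· < p), ((k : ℝ) - p + 1 - (k + 1 - z)) =
        ∏ z ∈ Z.filter (· < p), (-1) * ((p : ℝ) - z) from
          Finset.prod_congr rfl fun z _ => by ring, Finset.prod_mul_distrib, Finset.prod_const,
        hcard.neg_one_pow, one_mul]
      refine Finset.prod_pos fun z hz => ?_
      have : (z : ℝ) < p := by exact_mod_cast (Finset.mem_filter.1 hz).2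
      linarith
    · obtain ⟨hzZ, hzp⟩ := Finset.mem_filter.1 hz
      have hne : z ≠ p := by
        rintro rfl
        exact (Finset.mem_sdiff.1 hzZ).2 hj
      have : (p : ℝ) < z := by exact_mod_cast (show p < z by omega)
      linarith
  refine ⟨Z, ∏ z ∈ Z, (X - C ((k : ℝ) + 1 - z)), hZcard, ?_, ?_, ?_, hzero, ?_, ?_⟩
  · intro z hz
    obtain ⟨hz, hzT⟩ := Finset.mem_sdiff.1 hz
    obtain ⟨hz1, hzk⟩ := Finset.mem_Icc.1 hz
    have : z ≠ 1 := by
      rintro rfl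
      exact hzT h1T
    omega
  · rw [natDegree_finsetProd_X_sub_C_eq_card, hZcard]
  · intro j
    by_cases hj : k - (j : ℕ) ∈ T
    · exact (hpos j hj).le
    · refine (hzero j (Finset.mem_sdiff.2 ⟨Finset.mem_Icc.2 ⟨?_, ?_⟩, hj⟩)).ge <;> omega
  · intro j hj hjk
    refine Finset.mem_sdiff.2 ⟨Finset.mem_Icc.2 ⟨by omega, by omega⟩, fun hjT => ?_⟩
    have := (hTW _ hjT).1.2.2 j (by omega) hj
    omega
  · have := hpos ⟨k - 1, by omega⟩ (by simpa [Nat.sub_sub_self hk] using h1T)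
    have hcast : ((k - 1 : ℕ) : ℝ) + 1 = k := by exact_mod_cast Nat.sub_add_cancel hk
    simpa [hcast] using this

open Polynomial in
/-- Gale's evenness condition for the faces of the pulling triangulation. -/
theorem mem_pullingTriangulation_iff {d k : ℕ} (hd : 2 ≤ d) (hdk : d ≤ k) (S : Finset (Fin k)) :
    S ∈ pullingTriangulation (d - 1) k ↔ HasAlt (k - d) (coPositions S) := by
  have hk : 1 ≤ k := by omega
  have hmemC : ∀ j, momentPoint (d - 1) k j ∈ cyclicPolytope (d - 1) k := fun j =>
    subset_convexHull ℝ _ ⟨j, rfl⟩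
  constructor
  · rintro ⟨F, ⟨hexp, hne, -⟩, hlast, hS⟩
    obtain ⟨l, hl⟩ := hexp hne
    obtain ⟨x₀, hx₀⟩ := hne
    have hmax : ∀ y ∈ cyclicPolytope (d - 1) k, l y ≤ l x₀ := by
      rw [hl] at hx₀
      exact hx₀.2
    have hmemF : ∀ y ∈ cyclicPolytope (d - 1) k, y ∈ F ↔ l y = l x₀ := by
      intro y hy
      constructor
      · intro hyF
        rw [hl] at hyF hx₀
        exact le_antisymm (hmax y hy) (hyF.2 x₀ hx₀.1)
      · intro hyl
        rw [hl]
        exact ⟨hy, fun z hz => hyl ▸ hmax z hz⟩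
    -- The slack of the supporting hyperplane along the moment curve is a polynomial of degree at
    -- most `d - 1`.
    set g : ℝ[X] := C (l x₀) - ∑ i : Fin (d - 1), C (l (Pi.single i 1)) * X ^ ((i : ℕ) + 1) with hg
    have hgdeg : g.natDegree + 1 ≤ d := by
      have : g.natDegree ≤ d - 1 := by
        refine (natDegree_sub_le _ _).trans (max_le (by simp) ?_)
        refine natDegree_sum_le_of_forall_le _ _ fun i _ => ?_
        refine (natDegree_C_mul_X_pow_le _ _).trans ?_
        omega
      omega
    have heval : ∀ j : Fin k, g.eval ((j : ℝ) + 1) = l x₀ - l (momentPoint (d - 1) k j) := by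
      intro j
      have h1 := LinearMap.pi_apply_eq_sum_univ (l : (Fin (d - 1) → ℝ) →ₗ[ℝ] ℝ)
        (momentPoint (d - 1) k j)
      rw [ContinuousLinearMap.coe_coe] at h1
      rw [h1, hg, eval_sub, eval_C, eval_finsetSum]
      congr 1
      refine Finset.sum_congr rfl fun i _ => ?_
      rw [eval_mul, eval_C, eval_pow, eval_X, smul_eq_mul, mul_comm, momentPoint]
      congr 2
      ext t
      simp [Pi.single_apply, eq_comm]
    refine hasAlt_of_polynomial hk hgdeg (fun j => ?_) (fun j hj hjk => ?_) ?_
    · rw [heval, sub_nonneg]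
      exact hmax _ (hmemC j)
    · rw [heval, sub_eq_zero]
      exact ((hmemF _ (hmemC j)).1 ((hS j hj).resolve_right hjk)).symm
    · have hcast : ((k - 1 : ℕ) : ℝ) + 1 = k := by exact_mod_cast Nat.sub_add_cancel hk
      have h1 := heval ⟨k - 1, by omega⟩
      have h2 := hlast ⟨k - 1, by omega⟩ (Nat.sub_add_cancel hk)
      rw [hmemF _ (hmemC _)] at h2
      simp only [hcast] at h1
      rw [h1, sub_pos]
      exact lt_of_le_of_ne (hmax _ (hmemC _)) h2
  · intro h
    obtain ⟨Z, g, hZ, hZk, hgdeg, hnonneg, hzero, hSZ, hlast⟩ :=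
      exists_polynomial_of_hasAlt hk hdk (by omega) h
    set l : StrongDual ℝ (Fin (d - 1) → ℝ) := LinearMap.toContinuousLinearMap
      (∑ i : Fin (d - 1), (-g.coeff (i + 1)) • LinearMap.proj i) with hl
    have hlapply : ∀ j : Fin k, l (momentPoint (d - 1) k j) = g.coeff 0 - g.eval ((j : ℝ) + 1) := by
      intro j
      rw [eval_eq_sum_range, hgdeg, Finset.sum_range_succ', Finset.sum_range]
      simp [hl, momentPoint, Finset.sum_neg_distrib]
    have hmax : ∀ y ∈ cyclicPolytope (d - 1) k, l y ≤ g.coeff 0 := by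
      intro y hy
      have h1 : cyclicPolytope (d - 1) k ⊆ {y | l y ≤ g.coeff 0} := by
        refine convexHull_min ?_ (convex_halfSpace_le l.toLinearMap.isLinear _)
        rintro _ ⟨j, rfl⟩
        change l _ ≤ _
        rw [hlapply, sub_le_self_iff]
        exact hnonneg j
      exact h1 hy
    have hmem : ∀ j : Fin k, g.eval ((j : ℝ) + 1) = 0 →
        momentPoint (d - 1) k j ∈ {x ∈ cyclicPolytope (d - 1) k |
          ∀ y ∈ cyclicPolytope (d - 1) k, l y ≤ l x} := by
      intro j hj
      refine ⟨hmemC j, fun y hy => ?_⟩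
      rw [hlapply, hj, sub_zero]
      exact hmax y hy
    -- A root exists because `d ≥ 2`: it gives a vertex on the face and shows that the last vertex
    -- is not maximal for `l`.
    obtain ⟨z, hz⟩ : Z.Nonempty := Finset.card_pos.1 (by omega)
    obtain ⟨hz2, hzk⟩ := hZk z hz
    have hz0 : g.eval (((⟨k - z, by omega⟩ : Fin k) : ℝ) + 1) = 0 :=
      hzero ⟨k - z, by omega⟩ (by
        rw [show k - ((⟨k - z, by omega⟩ : Fin k) : ℕ) = z by simp only; omega]
        exact hz)
    have hlastF : ∀ j : Fin k, (j : ℕ) + 1 = k →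
        momentPoint (d - 1) k j ∉ {x ∈ cyclicPolytope (d - 1) k |
          ∀ y ∈ cyclicPolytope (d - 1) k, l y ≤ l x} := by
      rintro j hj ⟨-, hjF⟩
      have h1 := hjF _ (hmemC ⟨k - z, by omega⟩)
      rw [hlapply, hlapply, hz0, sub_zero, le_sub_self_iff] at h1
      have : (j : ℝ) + 1 = k := by exact_mod_cast hj
      rw [this] at h1
      linarith
    refine ⟨_, ⟨fun _ => ⟨l, rfl⟩, ⟨_, hmem _ hz0⟩, fun heq => ?_⟩, hlastF, fun j hj => ?_⟩
    · refine hlastF ⟨k - 1, by omega⟩ (Nat.sub_add_cancel hk) ?_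
      rw [heq]
      exact hmemC _
    · by_cases hjk : (j : ℕ) + 1 = k
      · exact Or.inr hjk
      · exact Or.inl (hmem j (hzero j (hSZ j hj hjk)))

/-! ## Extending sequences of signs at the front -/

/-- The positions of the nonzero entries, moved by one, together with the position `1`. -/
def shiftedSupport (γ : ℕ → SignType) : Set ℕ := insert 1 {p | 1 ≤ p ∧ γ (p - 1) ≠ 0}

theorem IsGaleFace.hasAlt_support {m : ℕ} {γ : ℕ → SignType} (h : IsGaleFace m γ) (h0 : γ 0 = 0) :
    HasAlt m (Function.support γ) := by
  cases m with
  | zero => exact h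
  | succ m =>
    rcases h with ⟨-, h⟩ | ⟨h, -⟩ | ⟨h, -⟩ | ⟨h, -⟩
    · exact h
    all_goals rw [h0] at h; exact absurd h (by decide)

theorem shiftedSupport_negTail (B : ℕ → SignType) :
    shiftedSupport (negTail B) = insert 1 (Function.support B \ {0}) := by
  ext p
  rcases p with _ | p
  · simp [shiftedSupport]
  · simp [shiftedSupport, negTail]

open Classical in
theorem coe_insert_image_eq_shiftedSupport {γ : ℕ → SignType} {S : Finset ℕ}
    (hS : Function.support γ = S) :
    ((insert 1 (S.image (· + 1)) : Finset ℕ) : Set ℕ) = shiftedSupport γ := by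
  have hS' : ∀ i, γ i ≠ 0 ↔ i ∈ S := fun i => by
    rw [← Function.mem_support, hS, Finset.mem_coe]
  ext p
  rcases p with _ | p
  · simp [shiftedSupport]
  · simp [shiftedSupport, hS']

theorem negTail_shift {B : ℕ → SignType} :
    {j | j + 1 ∈ Function.support B} = Function.support (negTail B) := by
  ext j
  simp [negTail]

/-- The sequences starting with `-1` are faces if and only if their tails lie in a facet that is not
a facet of the mirror complex. -/
theorem isGaleFace_neg_one_iff {m : ℕ} {B : ℕ → SignType} (h0 : B 0 = -1) :
    IsGaleFace (m + 1) B ↔ ∃ (γ : ℕ → SignType) (S : Finset ℕ), Function.support γ = S ∧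
      S.card = m + 1 ∧ IsGaleFace m γ ∧ (∀ i, γ i = 0 ∨ negTail B i = γ i) ∧
        ¬ HasAlt (m + 1) (shiftedSupport γ) := by
  classical
  constructor
  · rintro (⟨h, -⟩ | ⟨h, -⟩ | ⟨-, h1, i, hi⟩ | ⟨-, h1, hG⟩)
    · exact absurd (h0.symm.trans h) (by decide)
    · exact absurd (h0.symm.trans h) (by decide)
    -- In the chain from `0` the second element is odd. The rest of the chain is the support of the
    -- desired facet `γ`; position `1`, being odd too, cannot precede it, so `γ` is not in the
    -- mirror complex.
    · obtain ⟨-, j, hj0, hodd, hj⟩ := hi.restart (a := 0) (by simp [h0]) (Nat.zero_le _)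
      obtain ⟨j, rfl⟩ : ∃ k, j = k + 1 := ⟨j - 1, by omega⟩
      have hj1 : j ≠ 0 := by
        rintro rfl
        exact hj.mem h1
      rw [← altFrom_shift, negTail_shift] at hj
      obtain ⟨S, hS, hSW, hSA⟩ := hj.exists_finset
      have hsupp := support_restrictSign (β := negTail B) (S := S) fun i hi => (hSW i hi).1
      have h0S : 0 ∉ S := fun h => by
        have := (hSW 0 h).2
        omega
      refine ⟨restrictSign (negTail B) S, S, hsupp, hS, IsGaleFace.of_hasAlt ?_,
        restrictSign_le _ _, ?_⟩
      · rw [hsupp]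
        refine ⟨j, hSA.mono fun k hk _ => ⟨hk, ?_⟩⟩
        rintro rfl
        exact h0S hk
      · rw [← coe_insert_image_eq_shiftedSupport hsupp]
        rintro ⟨i₀, hi₀⟩
        have hcard : (S.image (· + 1)).card = m + 1 := by
          rw [Finset.card_image_of_injective _ (add_left_injective 1), hS]
        have h1S : 1 ∉ S.image (· + 1) := by simpa using h0S
        have hle := hi₀.le_of_card (by rw [Finset.card_insert_of_notMem h1S, hcard])
          1 (Finset.mem_insert_self _ _)
        have hmem := hi₀.mem
        obtain rfl : i₀ = 1 := by
          rcases Finset.mem_insert.1 (Finset.mem_coe.1 hmem) with h | h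
          · exact h
          · obtain ⟨a, -, rfl⟩ := Finset.mem_image.1 h
            omega
        obtain ⟨-, j', hj', hodd', hj'A⟩ := hi₀
        have hA' : AltFrom ((S.image (· + 1) : Finset ℕ) : Set ℕ) m j' :=
          hj'A.mono fun k hk hjk => by
            rcases Finset.mem_insert.1 (Finset.mem_coe.1 hk) with h | h
            · omega
            · exact Finset.mem_coe.2 h
        have hA : AltFrom ((S.image (· + 1) : Finset ℕ) : Set ℕ) m (j + 1) := by
          rw [← altFrom_shift]
          exact hSA.mono fun k hk _ => by simpa using hk
        have h2 := hA.le_of_card hcard.le j' (Finset.mem_coe.1 hA'.mem)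
        have h3 := hA'.le_of_card hcard.le (j + 1) (Finset.mem_coe.1 hA.mem)
        obtain rfl : j' = j + 1 := by omega
        grind
    -- A facet with nonzero first sign already has position `1` in its shifted support, which then
    -- has only `m + 1` elements, one too few for the chain.
    · obtain ⟨γ, S, hγ, hS, hG', hle, hγ0⟩ := hG.exists_facet
      have hB : negTail B 0 ≠ 0 := by simpa [negTail] using h1
      have h0S : 0 ∈ S := by
        rw [← Finset.mem_coe, ← hγ, Function.mem_support, hγ0 hB]
        exact hB
      refine ⟨γ, S, hγ, hS, hG', hle, ?_⟩
      rw [← coe_insert_image_eq_shiftedSupport hγ]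
      intro hA
      have := hA.card_le
      rw [Finset.insert_eq_of_mem (by simpa using h0S),
        Finset.card_image_of_injective _ (add_left_injective 1), hS] at this
      omega
  · rintro ⟨γ, S, hγ, hS, hG, hle, hA⟩
    set Γ : ℕ → SignType := fun i => if i = 0 then -1 else -γ (i - 1) with hΓ
    have hΓγ : negTail Γ = γ := by
      ext i
      simp [negTail, hΓ]
    refine IsGaleFace.mono (γ := Γ) ?_ fun i => ?_
    · by_cases hγ0 : γ 0 = 0
      · refine Or.inr (Or.inr (Or.inl ⟨by simp [hΓ], by simp [hΓ, hγ0], ?_⟩))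
        obtain ⟨i, hi⟩ := hG.hasAlt_support hγ0
        have hi0 : i ≠ 0 := by
          rintro rfl
          exact hi.mem hγ0
        -- If `1` could precede the shifted chain, `γ` would be in the mirror complex; hence `0` can
        -- precede it.
        by_cases hodd : Odd (1 + (i + 1))
        · refine absurd ⟨1, Set.mem_insert _ _, i + 1, by omega, hodd, altFrom_shift.1 ?_⟩ hA
          exact hi.mono fun k hk _ => Or.inr ⟨Nat.le_add_left 1 k, hk⟩
        · refine ⟨0, by simp [hΓ], i + 1, by omega, by grind, altFrom_shift.1 ?_⟩
          rwa [negTail_shift, hΓγ]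
      · exact Or.inr (Or.inr (Or.inr ⟨by simp [hΓ], by simpa [hΓ] using hγ0, by rwa [hΓγ]⟩))
    · rcases i with _ | i
      · simp [h0, hΓ]
      · rcases hle i with h | h
        · simp [hΓ, h]
        · right
          simp [hΓ, ← h, negTail]

theorem isGaleFace_one_iff {m : ℕ} {B : ℕ → SignType} (h0 : B 0 = 1) :
    IsGaleFace (m + 1) B ↔ HasAlt (m + 1) (shiftedSupport (negTail B)) := by
  rw [shiftedSupport_negTail]
  simp [IsGaleFace, h0]

/-- The middle layer of the fissure, the intersection of the outer two. The crucial case has one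
chain starting at `1` and another at `0`: their second elements have opposite parity, so the smaller
one can be put in front of the tail starting at the larger. -/
theorem isGaleFace_zero_iff {m : ℕ} {B B' : ℕ → SignType} (h0 : B 0 = 0) (h0' : B' 0 = -1)
    (h : negTail B = negTail B') :
    IsGaleFace (m + 1) B ↔
      HasAlt (m + 1) (shiftedSupport (negTail B)) ∧ IsGaleFace (m + 1) B' := by
  have hsucc : ∀ i, B (i + 1) = B' (i + 1) := fun i => by simpa [negTail] using congrFun h i
  have hiff : IsGaleFace (m + 1) B ↔ HasAlt (m + 1) (Function.support B) := by
    simp [IsGaleFace, h0]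
  have hsupp : ∀ i, i ≠ 0 → (B i ≠ 0 ↔ B' i ≠ 0) := by
    intro i hi
    obtain ⟨i, rfl⟩ : ∃ k, i = k + 1 := ⟨i - 1, by omega⟩
    rw [hsucc]
  have hB0 : Function.support B ⊆ Function.support B \ {0} := fun i hi => by
    refine ⟨hi, ?_⟩
    rintro rfl
    exact hi h0
  rw [shiftedSupport_negTail]
  constructor
  · intro hG
    refine ⟨(hiff.1 hG).mono (hB0.trans (Set.subset_insert _ _)), hG.mono fun i => ?_⟩
    rcases i with _ | i
    · exact Or.inl h0
    · exact Or.inr (hsucc i).symm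
  · rintro ⟨⟨i, hi⟩, hG⟩
    rw [hiff]
    have hi0 : i ≠ 0 := by
      rcases hi.mem with h | h
      · rw [h]
        exact one_ne_zero
      · exact h.2
    by_cases h1 : B 1 = 0
    · have h1' : B' 1 = 0 := by rw [← hsucc, h1]
      obtain ⟨i', hi'⟩ : HasAlt (m + 1) (Function.support B') := by
        rcases hG with ⟨-, h⟩ | ⟨h, -⟩ | ⟨-, -, h⟩ | ⟨-, h, -⟩
        · exact h
        · exact absurd (h0'.symm.trans h) (by decide)
        · exact h
        · exact absurd h1' h
      have hmono' : ∀ {m j}, j ≠ 0 → AltFrom (Function.support B') m j →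
          AltFrom (Function.support B) m j := fun hj hA =>
        hA.mono fun k hk hjk => (hsupp k (by omega)).2 hk
      have hmono : ∀ {m j}, 1 < j → AltFrom (insert 1 (Function.support B \ {0})) m j →
          AltFrom (Function.support B) m j := fun hj hA => hA.mono fun k hk hjk => by
        rcases hk with hk | hk
        · omega
        · exact hk.1
      rcases eq_or_ne i' 0 with rfl | hi'0
      swap
      · exact ⟨i', hmono' hi'0 hi'⟩
      rcases eq_or_ne i 1 with rfl | hi1
      swap
      · exact ⟨i, hmono (by omega) hi⟩
      obtain ⟨-, j, hj, hodd, hjA⟩ := hi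
      obtain ⟨-, j', hj', hodd', hjA'⟩ := hi'
      have hjA := hmono hj hjA
      have hjA' := hmono' (by omega) hjA'
      rcases lt_trichotomy j j' with hlt | rfl | hlt
      · exact ⟨j, hjA.mem, j', hlt, by grind, hjA'⟩
      · grind
      · exact ⟨j', hjA'.mem, j, hlt, by grind, hjA⟩
    · refine HasAlt.mono ⟨i, hi⟩ ?_
      rintro k (rfl | hk)
      · exact h1
      · exact hk.1

/-! ## Faces and facets as sign vectors -/

/-- The set of positions of the nonzero entries, as natural numbers. -/
def suppFinset {n : ℕ} (β : Fin n → SignType) : Finset ℕ :=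
  (Finset.univ.filter fun i => β i ≠ 0).map Fin.valEmbedding

theorem coe_suppFinset {n : ℕ} (β : Fin n → SignType) :
    Function.support (extendSign β) = suppFinset β := by
  ext i
  simp only [Function.mem_support, suppFinset, Finset.coe_map, Set.mem_image, Finset.mem_coe,
    Finset.mem_filter, Finset.mem_univ, true_and, Fin.valEmbedding_apply]
  constructor
  · intro h
    have hi : i < n := by
      by_contra hcon
      exact h (extendSign_of_le β (not_lt.1 hcon))
    exact ⟨⟨i, hi⟩, by rwa [← extendSign_val β ⟨i, hi⟩], rfl⟩
  · rintro ⟨j, hj, rfl⟩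
    rwa [extendSign_val]

theorem card_suppFinset {n : ℕ} (β : Fin n → SignType) :
    (suppFinset β).card + (zeroSet β).card = n := by
  rw [suppFinset, Finset.card_map, zeroSet, add_comm, Finset.card_filter_add_card_filter_not,
    Finset.card_univ, Fintype.card_fin]

theorem faceLE_iff_extendSign {n : ℕ} (β γ : Fin n → SignType) :
    FaceLE β γ ↔ ∀ i, extendSign γ i = 0 ∨ extendSign β i = extendSign γ i := by
  constructor
  · intro h i
    by_cases hi : i < n
    · have := h ⟨i, hi⟩
      rwa [← extendSign_val β, ← extendSign_val γ] at this
    · exact Or.inl (extendSign_of_le γ (not_lt.1 hi))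
  · intro h i
    have := h i
    rwa [extendSign_val, extendSign_val] at this

theorem exists_extendSign_eq {n : ℕ} {β : Fin n → SignType} {γ : ℕ → SignType}
    (h : ∀ i, γ i = 0 ∨ extendSign β i = γ i) : ∃ γ' : Fin n → SignType, extendSign γ' = γ := by
  refine ⟨fun i => γ i, funext fun i => ?_⟩
  by_cases hi : i < n
  · exact extendSign_val (fun i : Fin n => γ i) ⟨i, hi⟩
  · rw [extendSign_of_le _ (not_lt.1 hi)]
    rcases h i with h | h
    · exact h.symm
    · rw [← h, extendSign_of_le _ (not_lt.1 hi)]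

theorem extendSign_injective {n : ℕ} :
    Function.Injective (extendSign : (Fin n → SignType) → ℕ → SignType) := by
  intro β γ h
  ext i
  rw [← extendSign_val β, ← extendSign_val γ, h]

/-- The facets are the faces with exactly `m + 1` nonzero entries. -/
theorem maximal_isGaleFace_iff {n m : ℕ} (β : Fin n → SignType) :
    (IsGaleFace m (extendSign β) ∧
      ∀ γ : Fin n → SignType, IsGaleFace m (extendSign γ) → FaceLE β γ → γ = β) ↔
      IsGaleFace m (extendSign β) ∧ (suppFinset β).card = m + 1 := by
  refine and_congr_right fun hG => ⟨fun h => ?_, fun hcard γ hγ hle => ?_⟩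
  · obtain ⟨γ, S, hγ, hS, hGγ, hle, -⟩ := hG.exists_facet
    obtain ⟨γ, rfl⟩ := exists_extendSign_eq hle
    have := h γ hGγ ((faceLE_iff_extendSign β γ).2 hle)
    rw [this, coe_suppFinset] at hγ
    rw [Finset.coe_injective hγ, hS]
  · have hsub : suppFinset γ ⊆ suppFinset β := by
      rw [← Finset.coe_subset, ← coe_suppFinset, ← coe_suppFinset]
      intro i hi
      rcases (faceLE_iff_extendSign β γ).1 hle i with h | h
      · exact absurd h hi
      · rw [Function.mem_support, h]
        exact hi
    have hle' : m + 1 ≤ (suppFinset γ).card := hγ.card_le fun i hi => by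
      rwa [← Finset.mem_coe, ← coe_suppFinset]
    have heq := Finset.eq_of_subset_of_card_le hsub (by omega)
    ext i
    by_cases hi : γ i = 0
    · have h1 : (i : ℕ) ∉ suppFinset β := by
        rw [← heq, ← Finset.mem_coe, ← coe_suppFinset, Function.mem_support, extendSign_val]
        simpa using hi
      rw [← Finset.mem_coe, ← coe_suppFinset, Function.mem_support, extendSign_val, not_not] at h1
      rw [hi, h1]
    · exact ((hle i).resolve_left hi).symm

/-! ## Reversing and flipping -/

theorem reverseFlip_faceLE_iff {n : ℕ} (α β : Fin n → SignType) :
    FaceLE (reverseFlip α) (reverseFlip β) ↔ FaceLE α β := by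
  have h : ∀ (k : ℕ) (a b : SignType), ((-1) ^ k * b = 0 ∨ (-1) ^ k * a = (-1) ^ k * b) ↔
      (b = 0 ∨ a = b) := by
    intro k
    rcases neg_one_pow_eq_or SignType k with h | h <;> rw [h] <;> decide
  constructor
  · intro hle i
    have := (h _ _ _).1 (hle i.rev)
    rwa [Fin.rev_rev] at this
  · exact fun hle i => (h _ _ _).2 (hle i.rev)

theorem reverseFlip_bijective {n : ℕ} :
    Function.Bijective (reverseFlip : (Fin n → SignType) → Fin n → SignType) := by
  rw [Fintype.bijective_iff_injective_and_card]
  refine ⟨fun α β h => funext fun i => ?_, rfl⟩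
  have h1 := congrFun h i.rev
  simp only [reverseFlip, Fin.rev_rev] at h1
  have h2 : ∀ (k : ℕ) (a b : SignType), (-1) ^ k * a = (-1) ^ k * b → a = b := by
    intro k
    rcases neg_one_pow_eq_or SignType k with h | h <;> rw [h] <;> decide
  exact h2 _ _ _ h1

theorem extendSign_reverseFlip_zero {k : ℕ} (α : Fin (k + 1) → SignType) :
    extendSign (reverseFlip α) 0 = α (Fin.last k) := by
  have := extendSign_val (reverseFlip α) 0
  rw [Fin.val_zero] at this
  rw [this, reverseFlip]
  simp

/-- The alternating signs in `reverseFlip` are made for this: deleting the last coordinate turns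
into `negTail`. -/
theorem negTail_extendSign_reverseFlip {k : ℕ} (α : Fin (k + 1) → SignType) :
    negTail (extendSign (reverseFlip α)) = extendSign (reverseFlip (Fin.init α)) := by
  ext i
  by_cases hi : i < k
  · have h1 := extendSign_val (reverseFlip α) ⟨i + 1, by omega⟩
    have h2 := extendSign_val (reverseFlip (Fin.init α)) ⟨i, hi⟩
    simp only at h1 h2
    rw [negTail, h1, h2]
    simp only [reverseFlip, Fin.init, pow_succ]
    rw [show (⟨i + 1, by omega⟩ : Fin (k + 1)).rev = (⟨i, hi⟩ : Fin k).rev.castSucc by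
      ext
      simp [Fin.val_rev]]
    generalize α _ = a
    rcases neg_one_pow_eq_or SignType i with h | h <;> rw [h] <;> revert a <;> decide
  · rw [negTail, extendSign_of_le _ (by omega), extendSign_of_le _ (by omega), neg_zero]

/-! ## The cubical complexes built by fissures -/

theorem coPositions_zeroSet {k : ℕ} (hk : 1 ≤ k) (α : Fin k → SignType) :
    coPositions (zeroSet α) = shiftedSupport (extendSign (reverseFlip α)) := by
  ext p
  have hne : ∀ (e : ℕ) (a : SignType), (-1) ^ e * a ≠ 0 ↔ a ≠ 0 := by
    intro e
    rcases neg_one_pow_eq_or SignType e with h | h <;> rw [h] <;> decide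
  simp only [coPositions, shiftedSupport, zeroSet, Finset.mem_filter, Finset.mem_univ, true_and,
    Set.mem_insert_iff, Set.mem_ofPred_eq]
  constructor
  · rintro ⟨hp1, hpk, h⟩
    by_cases hp : p = 1
    · exact Or.inl hp
    · refine Or.inr ⟨hp1, ?_⟩
      have h1 := extendSign_val (reverseFlip α) ⟨p - 1, by omega⟩
      simp only at h1
      rw [h1, reverseFlip, hne]
      exact fun h0 => hp (h _ (by rw [Fin.val_rev]; simp only; omega) h0)
  · rintro (rfl | ⟨hp1, h⟩)
    · exact ⟨le_rfl, hk, fun _ _ _ => rfl⟩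
    · have hpk : p ≤ k := by
        by_contra hcon
        exact h (extendSign_of_le _ (by omega))
      refine ⟨hp1, hpk, fun j hj hj0 => ?_⟩
      have h1 := extendSign_val (reverseFlip α) ⟨p - 1, by omega⟩
      simp only at h1
      rw [h1, reverseFlip, hne] at h
      refine absurd ?_ h
      rw [← hj0]
      congr 1
      ext
      rw [Fin.val_rev]
      simp only
      omega

/-- The faces of the cubical complexes `S_k`. -/
theorem mem_bbc_iff {d k : ℕ} (hd : 2 ≤ d) (hk : d + 1 ≤ k) (α : Fin k → SignType) :
    α ∈ bbc d (fun i => pullingTriangulation (d - 1) i) k ↔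
      IsGaleFace (k - d - 1) (extendSign (reverseFlip α)) := by
  induction k, hk using Nat.le_induction with
  | base =>
    rw [bbc, if_pos le_rfl, show d + 1 - d - 1 = 0 by omega, cubeBoundary, Set.mem_ofPred_eq]
    change _ ↔ (Function.support (extendSign (reverseFlip α))).Nonempty
    rw [Function.support_nonempty_iff, not_iff_not]
    have h0 : extendSign (reverseFlip (0 : Fin (d + 1) → SignType)) = 0 := by
      ext i
      simp [extendSign, reverseFlip]
    rw [← h0, extendSign_injective.eq_iff, reverseFlip_bijective.1.eq_iff]
  | succ k hk ih =>
    set T : (i : ℕ) → Set (Finset (Fin i)) := fun i => pullingTriangulation (d - 1) i with hT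
    obtain ⟨m, hm⟩ : ∃ m, k - d = m + 1 := ⟨k - d - 1, by omega⟩
    rw [show k + 1 - d - 1 = m + 1 by omega]
    rw [show k - d - 1 = m by omega] at ih
    rw [bbc, if_neg (by omega)]
    have hM : ∀ γ : Fin k → SignType, γ ∈ mirror (T k) ↔
        HasAlt (m + 1) (shiftedSupport (extendSign (reverseFlip γ))) := by
      intro γ
      rw [mirror, Set.mem_ofPred_eq, hT, mem_pullingTriangulation_iff hd (by omega), hm,
        coPositions_zeroSet (by omega)]
    have hF : ∀ γ : Fin k → SignType, IsFacet (bbc d T k) γ ↔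
        IsGaleFace m (extendSign (reverseFlip γ)) ∧
          (suppFinset (reverseFlip γ)).card = m + 1 := by
      intro γ
      rw [← maximal_isGaleFace_iff, IsFacet, ih]
      refine and_congr_right fun _ => ?_
      rw [reverseFlip_bijective.2.forall (p := fun γ' => IsGaleFace m (extendSign γ') →
        FaceLE (reverseFlip γ) γ' → γ' = reverseFlip γ)]
      refine forall_congr' fun γ' => ?_
      rw [ih, reverseFlip_faceLE_iff, reverseFlip_bijective.1.eq_iff]
    -- Stated for an arbitrary `B`, because the middle layer needs it with the first entry `0`
    -- replaced by `-1`.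
    have hC : ∀ B : ℕ → SignType, B 0 = -1 →
        negTail B = extendSign (reverseFlip (Fin.init α : Fin k → SignType)) →
        ((Fin.init α : Fin k → SignType) ∈ complementComplex (bbc d T k) (mirror (T k)) ↔
          IsGaleFace (m + 1) B) := by
      intro B hB0 hB
      rw [isGaleFace_neg_one_iff hB0, hB]
      constructor
      · rintro ⟨γ, hγ, hγM, hle⟩
        rw [hF] at hγ
        refine ⟨_, _, coe_suppFinset (reverseFlip γ), hγ.2, hγ.1, ?_, by rwa [hM] at hγM⟩
        rwa [← faceLE_iff_extendSign, reverseFlip_faceLE_iff]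
      · rintro ⟨γ, S, hγ, hS, hG, hle, hA⟩
        obtain ⟨γ, rfl⟩ := exists_extendSign_eq hle
        obtain ⟨γ, rfl⟩ := reverseFlip_bijective.2 γ
        rw [coe_suppFinset] at hγ
        refine ⟨γ, (hF γ).2 ⟨hG, by rw [Finset.coe_injective hγ, hS]⟩, by rwa [hM], ?_⟩
        rwa [← faceLE_iff_extendSign, reverseFlip_faceLE_iff] at hle
    set B := extendSign (reverseFlip α) with hBdef
    have hB0 : B 0 = α (Fin.last k) := extendSign_reverseFlip_zero α
    have hBt : negTail B = extendSign (reverseFlip (Fin.init α)) := negTail_extendSign_reverseFlip α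
    rcases SignType.trichotomy (α (Fin.last k)) with h | h | h
    · rw [← hC B (hB0.trans h) hBt]
      simp [fissure, h]
    · set B' : ℕ → SignType := fun i => if i = 0 then -1 else B i with hB'
      have hBB' : negTail B = negTail B' := by
        ext i
        simp [negTail, hB']
      rw [isGaleFace_zero_iff (hB0.trans h) (by simp [hB']) hBB',
        ← hC B' (by simp [hB']) (hBB'.symm.trans hBt), hBt, ← hM]
      simp [fissure, h]
    · rw [isGaleFace_one_iff (hB0.trans h), hBt, ← hM]
      simp [fissure, h]

/-! ## The cubical Gale evenness condition -/

theorem hasAlt_shift {W : Set ℕ} {m : ℕ} (hW : 0 ∉ W) :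
    HasAlt m {j | j + 1 ∈ W} ↔ HasAlt m W := by
  constructor
  · rintro ⟨i, hi⟩
    exact ⟨i + 1, altFrom_shift.1 hi⟩
  · rintro ⟨i, hi⟩
    obtain ⟨i, rfl⟩ : ∃ k, i = k + 1 := ⟨i - 1, by
      have : i ≠ 0 := by
        rintro rfl
        exact hW hi.mem
      omega⟩
    exact ⟨i, altFrom_shift.2 hi⟩

theorem neg_one_pow_succ_eq_neg (k : ℕ) : (-1 : SignType) ^ (k + 1) = -(-1) ^ k := by
  rcases neg_one_pow_eq_or SignType k with h | h <;> rw [pow_succ, h] <;> decide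

/-- The facets in terms of the number `t` of leading nonzero entries. -/
theorem isGaleFace_iff_of_leading {m t : ℕ} {b : ℕ → SignType} {S : Finset ℕ}
    (hS : Function.support b = S) (hcard : S.card = m + 1) (hlead : ∀ i < t, b i ≠ 0)
    (ht : b t = 0) :
    IsGaleFace m b ↔ (t = 0 ∧ HasAlt m (Function.support b)) ∨
      (0 < t ∧ t ≤ m ∧ (∀ i, i + 1 < t → b i = (-1) ^ (i + 1)) ∧
        (b (t - 1) = (-1) ^ (t + 1) → HasAlt (m + 1 - t) (insert t {j | t < j ∧ b j ≠ 0})) ∧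
        (b (t - 1) = (-1) ^ t → HasAlt (m + 1 - t) (insert (t - 1) {j | t < j ∧ b j ≠ 0}))) ∨
      (t = m + 1 ∧ ∀ i, i + 1 < t → b i = (-1) ^ (i + 1)) := by
  classical
  have hmem : ∀ i, i ∈ S ↔ b i ≠ 0 := fun i => by
    rw [← Finset.mem_coe, ← hS, Function.mem_support]
  induction m generalizing t b S with
  | zero =>
    obtain ⟨a, rfl⟩ := Finset.card_eq_one.1 hcard
    have ha : b a ≠ 0 := (hmem a).1 (Finset.mem_singleton_self a)
    have ht1 : t ≤ 1 := by
      by_contra hcon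
      have h0 := (hmem 0).2 (hlead 0 (by omega))
      have h1 := (hmem 1).2 (hlead 1 (by omega))
      rw [Finset.mem_singleton] at h0 h1
      omega
    refine iff_of_true ⟨a, ha⟩ ?_
    rcases Nat.eq_zero_or_pos t with rfl | ht0
    · exact Or.inl ⟨rfl, a, ha⟩
    · exact Or.inr (Or.inr ⟨by omega, fun i hi => by omega⟩)
  | succ m ih =>
    rcases Nat.eq_zero_or_pos t with rfl | ht0
    · simp [IsGaleFace, ht]
    have hb0 : b 0 ≠ 0 := hlead 0 ht0
    rcases Nat.lt_or_ge 1 t with ht1 | ht1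
    · have hb1 : b 1 ≠ 0 := hlead 1 ht1
      -- With `b 1 ≠ 0` the inserted position `1` adds nothing, and removing `0` leaves too few
      -- positions for a chain. So the leading sign must be `-1`, and the recursion produces the
      -- pattern `-1, +1, …`.
      by_cases h1 : b 0 = 1
      · have hset : (insert 1 (Function.support b \ {0}) : Set ℕ) = ((S.erase 0 : Finset ℕ) : Set ℕ) := by
          rw [hS, Finset.coe_erase, Set.insert_eq_of_mem]
          exact ⟨(hmem 1).2 hb1, one_ne_zero⟩
        refine iff_of_false ?_ ?_
        · rintro (⟨h, -⟩ | ⟨-, h⟩ | ⟨h, -⟩ | ⟨h, -⟩)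
          · exact hb0 h
          · rw [hset] at h
            have := h.card_le
            rw [Finset.card_erase_of_mem ((hmem 0).2 hb0)] at this
            omega
          · exact absurd (h.symm.trans h1) (by decide)
          · exact absurd (h.symm.trans h1) (by decide)
        · rintro (⟨h, -⟩ | ⟨-, -, h, -⟩ | ⟨-, h⟩)
          · omega
          · exact absurd ((h 0 ht1).symm.trans h1) (by decide)
          · exact absurd ((h 0 ht1).symm.trans h1) (by decide)
      have h2 := SignType.eq_neg_one_of hb0 h1
      have hiff : IsGaleFace (m + 1) b ↔ IsGaleFace m (negTail b) := by
        simp [IsGaleFace, h2, hb1]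
      obtain ⟨t, rfl⟩ : ∃ k, t = k + 1 := ⟨t - 1, by omega⟩
      have hS' : Function.support (negTail b) = ((S.erase 0).image (· - 1) : Finset ℕ) := by
        ext j
        have hneg : negTail b j ≠ 0 ↔ b (j + 1) ≠ 0 := by simp [negTail]
        simp only [Function.mem_support, hneg, Finset.coe_image, Set.mem_image,
          Finset.mem_coe, Finset.mem_erase, hmem]
        constructor
        · exact fun hj => ⟨j + 1, ⟨by omega, hj⟩, by omega⟩
        · rintro ⟨i, ⟨hi0, hi⟩, rfl⟩
          rwa [Nat.sub_add_cancel (by omega)]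
      have hcard' : ((S.erase 0).image (· - 1)).card = m + 1 := by
        rw [Finset.card_image_of_injOn, Finset.card_erase_of_mem ((hmem 0).2 hb0), hcard]
        · omega
        · intro i hi j hj hij
          have := Finset.ne_of_mem_erase (Finset.mem_coe.1 hi)
          have := Finset.ne_of_mem_erase (Finset.mem_coe.1 hj)
          simp only at hij
          omega
      have hih := ih (t := t) hS' hcard' (fun i hi => by
        simpa [negTail] using hlead (i + 1) (by omega)) (by simpa [negTail] using ht) (fun i => by
          rw [← Finset.mem_coe, ← hS', Function.mem_support])
      refine hiff.trans (hih.trans ?_)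
      have hpat : (∀ i, i + 1 < t → negTail b i = (-1) ^ (i + 1)) ↔
          ∀ i, i + 1 < t + 1 → b i = (-1) ^ (i + 1) := by
        constructor
        · intro h i hi
          rcases i with _ | i
          · exact h2
          · rw [neg_one_pow_succ_eq_neg, ← h i (by omega), negTail, neg_neg]
        · intro h i hi
          rw [negTail, h (i + 1) (by omega), neg_one_pow_succ_eq_neg (i + 1), neg_neg]
      have hval : ∀ e, negTail b (t - 1) = (-1) ^ e ↔ b (t + 1 - 1) = (-1) ^ (e + 1) := by
        intro e
        rw [negTail, neg_one_pow_succ_eq_neg, Nat.sub_add_cancel (by omega), Nat.add_sub_cancel,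
          neg_eq_iff_eq_neg]
      have hset : ∀ a, HasAlt (m + 1 - t) (insert a {j | t < j ∧ negTail b j ≠ 0}) ↔
          HasAlt (m + 1 + 1 - (t + 1)) (insert (a + 1) {j | t + 1 < j ∧ b j ≠ 0}) := by
        intro a
        rw [← hasAlt_shift (W := insert (a + 1) {j | t + 1 < j ∧ b j ≠ 0}) (by simp),
          Nat.add_sub_add_right]
        have : {j | j + 1 ∈ insert (a + 1) {j | t + 1 < j ∧ b j ≠ 0}} =
            insert a {j | t < j ∧ negTail b j ≠ 0} := by
          ext j
          simp [negTail]
        rw [this]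
      rw [hpat, hval, hval, hset, hset, Nat.sub_add_cancel (by omega : 1 ≤ t)]
      simp only [Nat.succ_ne_zero, false_and, false_or, Nat.add_right_cancel_iff,
        Nat.add_sub_cancel, Nat.add_le_add_iff_right, show t ≠ 0 by omega, show 0 < t by omega,
        Nat.succ_pos]
    · obtain rfl : t = 1 := by omega
      have hsub : (insert 1 (Function.support b \ {0}) : Set ℕ) = insert 1 {j | 1 < j ∧ b j ≠ 0} := by
        ext j
        rcases j with _ | _ | j <;> simp
      have hsub' : Function.support b = insert 0 {j | 1 < j ∧ b j ≠ 0} := by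
        ext j
        rcases j with _ | _ | j <;> simp [hb0, ht]
      by_cases h1 : b 0 = 1
      · simp [IsGaleFace, h1, hsub]
      · have h2 := SignType.eq_neg_one_of hb0 h1
        simp [IsGaleFace, h2, ht, ← hsub']

/-- The chain must use every element of the enlarged set, so it begins with `a` followed by the
minimum `p` of `T`. -/
theorem hasAlt_insert_iff {T : Finset ℕ} {r a p : ℕ} (hT : T.card = r + 1) (ha : ∀ q ∈ T, a < q)
    (hp : p ∈ T) (hmin : ∀ q ∈ T, p ≤ q) :
    HasAlt (r + 1) (insert a (T : Set ℕ)) ↔ HasAlt r (T : Set ℕ) ∧ Odd (a + p) := by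
  classical
  have haT : a ∉ T := fun h => lt_irrefl _ (ha a h)
  have hstart : ∀ i, AltFrom (T : Set ℕ) r i → i = p := fun i hi =>
    le_antisymm (hi.le_of_card hT.le p hp) (hmin i (Finset.mem_coe.1 hi.mem))
  constructor
  · rintro ⟨i, hi⟩
    rw [← Finset.coe_insert] at hi
    have hle := hi.le_of_card (by rw [Finset.card_insert_of_notMem haT, hT]) a
      (Finset.mem_insert_self _ _)
    obtain rfl : i = a := by
      rcases Finset.mem_insert.1 (Finset.mem_coe.1 hi.mem) with h | h
      · exact h
      · have := ha i h
        omega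
    obtain ⟨-, j, hj, hodd, hjA⟩ := hi
    have hjT : AltFrom (T : Set ℕ) r j := hjA.mono fun k hk hjk => by
      rcases Finset.mem_insert.1 (Finset.mem_coe.1 hk) with h | h
      · omega
      · exact h
    exact ⟨⟨j, hjT⟩, hstart j hjT ▸ hodd⟩
  · rintro ⟨⟨i, hi⟩, hodd⟩
    obtain rfl := hstart i hi
    exact ⟨a, Set.mem_insert _ _, i, ha i hp, hodd, hi.mono fun k hk _ => Or.inr hk⟩

theorem mem_suppFinset {n : ℕ} {β : Fin n → SignType} {i : ℕ} :
    i ∈ suppFinset β ↔ extendSign β i ≠ 0 := by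
  rw [← Finset.mem_coe, ← coe_suppFinset, Function.mem_support]

theorem lt_of_mem_suppFinset {n : ℕ} {β : Fin n → SignType} {i : ℕ} (h : i ∈ suppFinset β) :
    i < n := by
  by_contra hcon
  exact mem_suppFinset.1 h (extendSign_of_le β (not_lt.1 hcon))

theorem card_zeros_between {n : ℕ} (β : Fin n → SignType) {s : ℕ} {i j : Fin n} (hs : s ≤ i)
    (hij : i < j) (hi : β i ≠ 0) :
    (Finset.univ.filter fun k => i < k ∧ k < j ∧ β k = 0).card +
      (((suppFinset β).filter (s ≤ ·)).filter (· < (j : ℕ))).card + i =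
      j + (((suppFinset β).filter (s ≤ ·)).filter (· < (i : ℕ))).card := by
  classical
  have hij' : (i : ℕ) < j := hij
  set Z := (Finset.univ.filter fun k : Fin n => i < k ∧ k < j ∧ β k = 0).map Fin.valEmbedding with hZ
  rw [← Finset.card_map Fin.valEmbedding, ← hZ]
  set T := (suppFinset β).filter (s ≤ ·) with hT
  have hZmem : ∀ k, k ∈ Z ↔ (i : ℕ) < k ∧ k < j ∧ extendSign β k = 0 := by
    intro k
    simp only [hZ, Finset.mem_map, Finset.mem_filter, Finset.mem_univ, true_and,
      Fin.valEmbedding_apply]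
    constructor
    · rintro ⟨k, ⟨h1, h2, h3⟩, rfl⟩
      exact ⟨h1, h2, by rwa [extendSign_val]⟩
    · rintro ⟨h1, h2, h3⟩
      have hk : k < n := by omega
      exact ⟨⟨k, hk⟩, ⟨h1, h2, by rwa [← extendSign_val β ⟨k, hk⟩]⟩, rfl⟩
  have h1 : T.filter (· < (j : ℕ)) = T.filter (· < (i : ℕ)) ∪ (Finset.Ico (i : ℕ) j \ Z) := by
    ext k
    simp only [hT, Finset.mem_filter, Finset.mem_union, Finset.mem_sdiff, Finset.mem_Ico, hZmem,
      mem_suppFinset]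
    by_cases hki : k = i
    · subst hki
      rw [extendSign_val]
      simp [hi, hs, hij']
    · by_cases hk0 : extendSign β k = 0
      · simp only [hk0, ne_eq, not_true, false_and, false_or, and_true, false_iff]
        omega
      · simp only [hk0, ne_eq, not_false_iff, true_and, and_false, and_true]
        omega
  have h2 : Disjoint (T.filter (· < (i : ℕ))) (Finset.Ico (i : ℕ) j \ Z) := by
    rw [Finset.disjoint_left]
    intro k hk hk'
    have := (Finset.mem_filter.1 hk).2
    have := (Finset.mem_Ico.1 (Finset.mem_sdiff.1 hk').1).1
    omega
  have h3 : Z ⊆ Finset.Ico (i : ℕ) j := fun k hk => by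
    have := (hZmem k).1 hk
    exact Finset.mem_Ico.2 ⟨this.1.le, this.2.1⟩
  rw [h1, Finset.card_union_of_disjoint h2, Finset.card_sdiff_of_subset h3, Nat.card_Ico]
  have h4 := Finset.card_le_card h3
  rw [Nat.card_Ico] at h4
  omega

/-- The zeros between two nonzero entries are the difference in position minus the difference in
rank, by `card_zeros_between`. Even gaps mean that position and rank keep the same relative parity,
which is alternation. -/
theorem galeEvenFrom_iff {n r s : ℕ} (β : Fin n → SignType)
    (hcard : ((suppFinset β).filter (s ≤ ·)).card = r + 1) :
    GaleEvenFrom β s ↔ HasAlt r (((suppFinset β).filter (s ≤ ·) : Finset ℕ) : Set ℕ) := by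
  set T := (suppFinset β).filter (s ≤ ·) with hT
  have hTmem : ∀ i : Fin n, (i : ℕ) ∈ T ↔ s ≤ i ∧ β i ≠ 0 := by
    intro i
    rw [hT, Finset.mem_filter, mem_suppFinset, extendSign_val, and_comm]
  constructor
  · intro h
    have hne : T.Nonempty := Finset.card_pos.1 (by omega)
    set a := T.min' hne with ha
    have haT : a ∈ T := T.min'_mem hne
    have han := lt_of_mem_suppFinset (Finset.mem_filter.1 haT).1
    refine hasAlt_of_even (c := a) hcard fun p hp => ?_
    have hpn := lt_of_mem_suppFinset (Finset.mem_filter.1 hp).1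
    have hzero : T.filter (· < a) = ∅ :=
      Finset.filter_eq_empty_iff.2 fun k hk => not_lt.2 (T.min'_le k hk)
    rcases (T.min'_le p hp).eq_or_lt with heq | hlt
    · rw [← ha] at heq
      rw [← heq, hzero, Finset.card_empty]
      exact ⟨a, by omega⟩
    · have h1 := (hTmem ⟨a, han⟩).1 haT
      have h2 := (hTmem ⟨p, hpn⟩).1 hp
      have h3 := h ⟨a, han⟩ ⟨p, hpn⟩ h1.1 hlt h1.2 h2.2
      have h4 := card_zeros_between β h1.1 (i := ⟨a, han⟩) (j := ⟨p, hpn⟩) hlt h1.2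
      simp only [← hT] at h4
      rw [hzero, Finset.card_empty] at h4
      grind
  · rintro ⟨c, hc⟩ i j hsi hij hi hj
    have heven := hc.even_of_card hcard
    have h1 := heven i ((hTmem i).2 ⟨hsi, hi⟩)
    have h2 := heven j ((hTmem j).2 ⟨hsi.trans (Fin.lt_def.1 hij).le, hj⟩)
    have h3 := card_zeros_between β hsi hij hi
    rw [← hT] at h3
    grind

theorem leadingZeros_add {n s p : ℕ} (β : Fin n → SignType) (hsp : s ≤ p)
    (hp : p ∈ suppFinset β) (hmin : ∀ q ∈ suppFinset β, s ≤ q → p ≤ q) :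
    leadingZeros β s + s = p := by
  classical
  have hpn := lt_of_mem_suppFinset hp
  rw [leadingZeros, ← Finset.card_map Fin.valEmbedding]
  have : (Finset.univ.filter fun k : Fin n => s ≤ k ∧ ∀ l : Fin n, s ≤ l → l ≤ k → β l = 0).map
      Fin.valEmbedding = Finset.Ico s p := by
    ext k
    simp only [Finset.mem_map, Finset.mem_filter, Finset.mem_univ, true_and,
      Fin.valEmbedding_apply, Finset.mem_Ico]
    constructor
    · rintro ⟨k, ⟨h1, h2⟩, rfl⟩
      refine ⟨h1, ?_⟩
      by_contra hcon
      have h3 := h2 ⟨p, hpn⟩ hsp (Fin.le_def.2 (not_lt.1 hcon))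
      rw [mem_suppFinset] at hp
      exact hp ((extendSign_val β ⟨p, hpn⟩).trans h3)
    · rintro ⟨h1, h2⟩
      refine ⟨⟨k, by omega⟩, ⟨h1, fun l hl hlk => ?_⟩, rfl⟩
      by_contra hne
      have h3 := hmin l (mem_suppFinset.2 (by rwa [extendSign_val])) hl
      have := Fin.le_def.1 hlk
      simp only at this
      omega
  rw [this, Nat.card_Ico]
  omega

theorem and_imp_iff_of_or {p q r s t : Prop} (h : p ∨ q) :
    ((p → r ∧ s) ∧ (q → r ∧ t)) ↔ r ∧ (p → s) ∧ (q → t) := by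
  tauto

/-- The cubical Gale evenness condition characterizes the facets. -/
theorem cubicalGale_iff {d n : ℕ} (hd : 1 ≤ d) (hn : d < n) (β : Fin n → SignType) :
    CubicalGale d n β ↔
      IsGaleFace (n - d - 1) (extendSign β) ∧ (suppFinset β).card = n - d - 1 + 1 := by
  classical
  have hsum := card_suppFinset β
  obtain ⟨m, hm⟩ : ∃ m, n = m + 1 + d := ⟨n - d - 1, by omega⟩
  rw [show n - d - 1 = m by omega, CubicalGale, and_comm,
    show (zeroSet β).card = d ↔ (suppFinset β).card = m + 1 by omega]
  refine and_congr_left fun hcard => ?_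
  have key : ∀ t : ℕ, (∀ i : Fin n, (i : ℕ) < t → β i ≠ 0) → (∀ i : Fin n, (i : ℕ) = t → β i = 0) →
      (IsGaleFace m (extendSign β) ↔ ((t = 0 ∧ GaleEvenFrom β 0) ∨
     (0 < t ∧ t + d < n ∧
       (∀ i : Fin n, (i : ℕ) + 1 < t → β i = (-1) ^ ((i : ℕ) + 1)) ∧
       GaleEvenFrom β (t + 1) ∧
       (∀ i : Fin n, (i : ℕ) + 1 = t →
         (β i = (-1) ^ (t + 1) → Even (leadingZeros β (t + 1))) ∧
         (β i = (-1) ^ t → Odd (leadingZeros β (t + 1))))) ∨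
     (t + d = n ∧ ∀ i : Fin n, (i : ℕ) + 1 < t → β i = (-1) ^ ((i : ℕ) + 1)))) := by
    intro t hlead ht
    -- The definition does not bound `t`; for large `t` its requirements on entries become vacuous.
    -- Counting nonzero entries excludes `t > m + 1`, the case `t > n` separately.
    have htn : t ≤ m + 1 ∨ n < t := by
      by_contra hcon
      push Not at hcon
      have hsub : Finset.range t ⊆ suppFinset β := fun i hi => by
        have hi := Finset.mem_range.1 hi
        have := hlead ⟨i, by omega⟩ hi
        rwa [mem_suppFinset, extendSign_val β ⟨i, by omega⟩]
      have := Finset.card_le_card hsub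
      rw [Finset.card_range] at this
      omega
    have htn : t ≤ m + 1 := by
      refine htn.resolve_right fun h => ?_
      have hsub : Finset.range n ⊆ suppFinset β := fun i hi => by
        have hi := Finset.mem_range.1 hi
        have := hlead ⟨i, hi⟩ (by simp only; omega)
        rwa [mem_suppFinset, extendSign_val β ⟨i, hi⟩]
      have := Finset.card_le_card hsub
      rw [Finset.card_range] at this
      omega
    have hlead' : ∀ i < t, extendSign β i ≠ 0 := fun i hi => by
      have := hlead ⟨i, by omega⟩ hi
      rwa [extendSign_val β ⟨i, by omega⟩]
    have ht' : extendSign β t = 0 := by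
      rw [extendSign_val β ⟨t, by omega⟩]
      exact ht _ rfl
    rw [isGaleFace_iff_of_leading (coe_suppFinset β) hcard hlead' ht']
    have hpat : (∀ i, i + 1 < t → extendSign β i = (-1) ^ (i + 1)) ↔
        ∀ i : Fin n, (i : ℕ) + 1 < t → β i = (-1) ^ ((i : ℕ) + 1) := by
      constructor
      · intro h i hi
        rw [← extendSign_val β i, h i hi]
      · intro h i hi
        rw [extendSign_val β ⟨i, by omega⟩]
        exact h _ hi
    refine or_congr ?_ (or_congr ?_ ?_)
    · refine and_congr_right fun _ => ?_
      have h0 : (suppFinset β).filter (0 ≤ ·) = suppFinset β := by simp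
      rw [galeEvenFrom_iff (r := m) β (by rw [h0, hcard]), h0, coe_suppFinset]
    · refine and_congr_right fun ht0 => ?_
      rw [show t + d < n ↔ t ≤ m by omega, hpat]
      refine and_congr_right fun htm => and_congr_right fun _ => ?_
      set T := (suppFinset β).filter (t + 1 ≤ ·) with hT
      obtain ⟨r, hr⟩ : ∃ r, m = r + t := ⟨m - t, by omega⟩
      have hTcard : T.card = r + 1 := by
        have h1 : suppFinset β = Finset.range t ∪ T := by
          ext i
          simp only [hT, Finset.mem_union, Finset.mem_range, Finset.mem_filter, mem_suppFinset]
          rcases lt_trichotomy i t with h | rfl | h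
          · simp [h, hlead' i h]
          · simp [ht']
          · simp [Nat.not_lt.2 h.le, Nat.succ_le_of_lt h]
        have h2 : Disjoint (Finset.range t) T := by
          rw [Finset.disjoint_left]
          intro i hi hi'
          have := Finset.mem_range.1 hi
          have := (Finset.mem_filter.1 hi').2
          omega
        rw [h1, Finset.card_union_of_disjoint h2, Finset.card_range] at hcard
        omega
      have hTset : {j | t < j ∧ extendSign β j ≠ 0} = (T : Set ℕ) := by
        ext j
        simp only [hT, Finset.coe_filter, mem_suppFinset, Set.mem_ofPred_eq]
        exact and_comm
      have hne : T.Nonempty := Finset.card_pos.1 (by omega)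
      set p := T.min' hne with hp
      have hpT : p ∈ T := T.min'_mem hne
      have hpmin : ∀ q ∈ T, p ≤ q := fun q hq => T.min'_le q hq
      have htT : ∀ q ∈ T, t + 1 ≤ q := fun q hq => (Finset.mem_filter.1 hq).2
      have hlz := leadingZeros_add β (htT p hpT) (Finset.mem_filter.1 hpT).1 fun q hq hsq =>
        hpmin q (Finset.mem_filter.2 ⟨hq, hsq⟩)
      rw [galeEvenFrom_iff β hTcard, hTset, show m + 1 - t = r + 1 by omega,
        hasAlt_insert_iff hTcard (fun q hq => htT q hq) hpT hpmin,
        hasAlt_insert_iff hTcard (a := t - 1) (fun q hq => by have := htT q hq; omega) hpT hpmin]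
      have hi : ((⟨t - 1, by omega⟩ : Fin n) : ℕ) + 1 = t := by simp only; omega
      have hval : extendSign β (t - 1) = β ⟨t - 1, by omega⟩ := extendSign_val β ⟨t - 1, by omega⟩
      have hforall : (∀ i : Fin n, (i : ℕ) + 1 = t →
         (β i = (-1) ^ (t + 1) → Even (leadingZeros β (t + 1))) ∧
         (β i = (-1) ^ t → Odd (leadingZeros β (t + 1)))) ↔
         (extendSign β (t - 1) = (-1) ^ (t + 1) → Even (leadingZeros β (t + 1))) ∧
         (extendSign β (t - 1) = (-1) ^ t → Odd (leadingZeros β (t + 1))) := by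
        rw [hval]
        constructor
        · exact fun h => h _ hi
        · intro h i hi'
          rwa [show i = ⟨t - 1, by omega⟩ from Fin.ext (by simp only; omega)]
      have hsign : extendSign β (t - 1) = (-1) ^ (t + 1) ∨ extendSign β (t - 1) = (-1) ^ t := by
        have h1 := hlead' (t - 1) (by omega)
        revert h1
        generalize extendSign β (t - 1) = a
        rw [neg_one_pow_succ_eq_neg]
        rcases neg_one_pow_eq_or SignType t with h | h <;> rw [h] <;> revert a <;> decide
      -- By `hlz` the first nonzero position after `t` is `p = leadingZeros + t + 1`, so parities
      -- relative to `t` and `t - 1` translate into the parity of the number of zeros.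
      have he1 : Odd (t + p) ↔ Even (leadingZeros β (t + 1)) := by
        rw [← hlz]
        grind
      have he2 : Odd (t - 1 + p) ↔ Odd (leadingZeros β (t + 1)) := by
        rw [← hlz]
        grind
      rw [hforall, he1, he2, and_imp_iff_of_or hsign]
    · rw [hpat, show t = m + 1 ↔ t + d = n by omega]
  constructor
  · rintro ⟨t, hlead, ht, h⟩
    exact (key t hlead ht).2 h
  · intro hG
    have hex : ∃ t, extendSign β t = 0 := ⟨n, extendSign_of_le β le_rfl⟩
    have hlead : ∀ i : Fin n, (i : ℕ) < Nat.find hex → β i ≠ 0 := fun i hi => by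
      rw [← extendSign_val β]
      exact Nat.find_min hex hi
    have ht : ∀ i : Fin n, (i : ℕ) = Nat.find hex → β i = 0 := fun i hi => by
      rw [← extendSign_val β, hi]
      exact Nat.find_spec hex
    exact ⟨_, hlead, ht, (key _ hlead ht).1 hG⟩

/-! ## The main theorem -/

theorem corollary3p4 (d n : ℕ) (hd : 3 ≤ d) (hn : d < n) :
    ∀ᶠ ε : ℝ in 𝓝[>] 0, ∀ᶠ K : ℝ in atTop,
      Set.BijOn (ncpFace hn ε K) {β | CubicalGale d n β} (polytopeFacets (ncp hn ε K)) ∧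
      ∃ Ψ : (fun α β : bbc d (fun i => pullingTriangulation (d - 1) i) n =>
              FaceLE (α : Fin n → SignType) β) ≃r
            (fun F G : boundaryFaces (ncp hn ε K) => (F : Set (Fin (d + 1) → ℝ)) ⊆ G),
        ∀ α, (Ψ α : Set (Fin (d + 1) → ℝ)) = ncpFace hn ε K (reverseFlip α) := by
  filter_upwards [eventually_isPreserved_iff d n, self_mem_nhdsWithin] with ε hε hε0
  filter_upwards [eventually_boundaryFaces_ncp hn hε0] with K hK
  obtain ⟨hmem, hsurj, hle⟩ := hK
  simp only [hε] at hmem hsurj hle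
  have hinj : ∀ β γ, IsGaleFace (n - d - 1) (extendSign β) →
      IsGaleFace (n - d - 1) (extendSign γ) → ncpFace hn ε K β = ncpFace hn ε K γ → β = γ := by
    intro β γ hβ hγ h
    have h1 := (hle β γ hγ).1 h.subset
    have h2 := (hle γ β hβ).1 h.superset
    ext i
    rcases h1 i with h1 | h1
    · rcases h2 i with h2 | h2
      · rw [h1, h2]
      · exact h2.symm
    · exact h1
  have hfacet : ∀ β, CubicalGale d n β ↔ IsGaleFace (n - d - 1) (extendSign β) ∧
      ∀ γ : Fin n → SignType, IsGaleFace (n - d - 1) (extendSign γ) → FaceLE β γ → γ = β := fun β =>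
    (cubicalGale_iff (by omega) hn β).trans (maximal_isGaleFace_iff β).symm
  refine ⟨⟨?_, ?_, ?_⟩, ?_⟩
  · intro β hβ
    obtain ⟨hG, hmax⟩ := (hfacet β).1 hβ
    refine ⟨hmem β hG, fun F hF hβF => ?_⟩
    obtain ⟨γ, hγ, rfl⟩ := hsurj F hF
    rw [hmax γ hγ ((hle β γ hγ).1 hβF)]
  · intro β hβ γ hγ h
    exact hinj β γ ((hfacet β).1 hβ).1 ((hfacet γ).1 hγ).1 h
  · rintro F ⟨hF, hmax⟩
    obtain ⟨β, hβ, rfl⟩ := hsurj F hF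
    refine ⟨β, (hfacet β).2 ⟨hβ, fun γ hγ hβγ => ?_⟩, rfl⟩
    have h1 := (hle β γ hγ).2 hβγ
    exact hinj γ β hγ hβ (Set.Subset.antisymm (hmax (hmem γ hγ) h1) h1)
  · have hbbc := mem_bbc_iff (d := d) (k := n) (by omega) (by omega)
    set f : bbc d (fun i => pullingTriangulation (d - 1) i) n → boundaryFaces (ncp hn ε K) :=
      fun α => ⟨ncpFace hn ε K (reverseFlip α), hmem _ ((hbbc α).1 α.2)⟩ with hf
    have hbij : Function.Bijective f := by
      constructor
      · intro α β h
        refine Subtype.ext (reverseFlip_bijective.1 ?_)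
        exact hinj _ _ ((hbbc α).1 α.2) ((hbbc β).1 β.2) (congrArg Subtype.val h)
      · rintro ⟨F, hF⟩
        obtain ⟨β, hβ, rfl⟩ := hsurj F hF
        obtain ⟨α, rfl⟩ := reverseFlip_bijective.2 β
        exact ⟨⟨α, (hbbc α).2 hβ⟩, rfl⟩
    refine ⟨⟨Equiv.ofBijective f hbij, fun {α β} => ?_⟩, fun α => rfl⟩
    exact (hle _ _ ((hbbc β).1 β.2)).trans (reverseFlip_faceLE_iff _ _)
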